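/- Let $V$ be a real vector space of finite dimension $\mathfrak n\ge 1$ with a positive definite symmetric bilinear form $B$, put $Q(v)=\tfrac12B(v,v)$, and extend $B$ bilinearly to the complexification $\mathcal V=\mathbb C\otimes_{\mathbb R}V$. Write $\mathfrak e(z)=e^{2\pi i z}$ and let $\mathbb H$ be the upper half plane. Let $L\subset V$ be an even lattice (the $\mathbb Z$-span of an $\mathbb R$-basis of $V$, with $Q(L)\subseteq\mathbb Z$), let $L^\sharp=\{v\in V: B(v,L)\subseteq\mathbb Z\}$ be its dual, and let $N$ be its level, the least positive integer with $N\,Q(L^\sharp)\subseteq\mathbb Z$. Let $N'$ be a positive divisor of $N$, let $\underline L_{N'}$ be $L$ with the form $N'B$, and let $\underline L_{N'}^\sharp$ be its dual lattice. Fix a $\mathbb Z$-basis $\mathfrak B=(e_1,\dots,e_{\mathfrak n})$ of $L$ with Gram matrix $G_{\mathfrak B}=(B(e_i,e_j))_{i,j}$, and write $(v)_{\mathfrak B}$ for the coordinates of $v$. For $\alpha,\beta\in V$ and $(\tau,z)\in\mathbb H\times\mathcal V$ put $$\theta_{\alpha,\beta}(\tau,z)=\sum_{v\in L}\mathfrak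 e(B(\beta,v))\,\mathfrak e\bigl(\tau Q(\alpha+v)+B(\alpha+v,z)\bigr).$$ For $\mathbf p\in\mathbb Z_{\ge0}^{\mathfrak n}$ let $s(\mathbf p)$ be the sum of its components; use the same notation $s(\cdot)$ for the sum of the entries of a matrix, a row or a column. Let $d=|\underline L_{N'}^\sharp/L|$, let $\underline L_{N'}^\sharp/L=\{t_1,\dots,t_d\}$, and let $\mathcal P_0=\{\mathbf p_1,\dots,\mathbf p_d\}\subset\mathbb Z_{\ge0}^{\mathfrak n}$ have $d$ elements. Put $$\mathcal F_{\underline L_{N'},\mathcal P_0}^{\mathfrak B}(\tau)=\det\Bigl((2\pi i)^{-s(\mathbf p_i)}\,\partial^{\mathbf p_i}\vartheta_{t_j}(\tau,z)\big|_{z=0}\Bigr)_{1\le i,j\le d},\qquad \vartheta_t(\tau,z)=\sum_{v\in t}\mathfrak e\bigl(\tau N'Q(v)+N'B(v,z)\bigr),$$ where $\partial^{\mathbf p}=\partial^{s(\mathbf p)}/\partial z_1^{p_1}\cdots\partial z_{\mathfrak n}^{p_{\mathfrak n}}$ in the coordinates $z=\sum_j z_je_j$. Let $\widehat{\mathcal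 P_0}$ be the set of $\mathbf q\in\mathbb Z_{\ge0}^{\mathfrak n}$ such that, for some $\mathbf p\in\mathcal P_0$, $\mathbf q\le\mathbf p$ componentwise and $s(\mathbf q)\equiv s(\mathbf p)\bmod 2$. Let $\delta_N=2$ if $N\le2$ and $\delta_N=1$ if $N\ge3$, and let $\mathfrak I$ be the (finite) set of pairs $(\mathbf p,n)$ with $\mathbf p\in\widehat{\mathcal P_0}$ and $n$ an integer with $$0\le n\le\Bigl\lfloor\frac{\delta_NN^2}{24}\Bigl(\frac{N'\mathfrak n}2+s(\mathbf p)\Bigr)\prod_{\ell\mid N,\ \ell\text{ prime}}\Bigl(1-\frac1{\ell^2}\Bigr)\Bigr\rfloor .$$ For $k\in\tfrac12\mathbb Z$, $\mathbf p\in\mathbb Z_{\ge0}^{\mathfrak n}$ and a real $\mathfrak n\times\mathfrak n$ matrix $M$ let $$P_{k,\mathbf p,M}(X_0,\dots,X_{\mathfrak n})=\sum_{\mu}(-1)^{\mu_0}2^{s(\mathbf p)-\mu_0}\Bigl(\prod_{\lfloor (s(\mathbf p)-1)/2\rfloor\le m\le s(\mathbf p)-2-\mu_0}(k+m)\Bigr)\sum_{\Lambda,\Omega}\frac{M^{\Lambda+\Omega}}{\Lambda!\,\Omega!}\,X_0^{\mu_0}\cdots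 X_{\mathfrak n}^{\mu_{\mathfrak n}},$$ where $\mu$ runs over the $(\mu_0,\dots,\mu_{\mathfrak n})\in\mathbb Z_{\ge0}^{\mathfrak n+1}$ with $2\mu_0+\mu_1+\dots+\mu_{\mathfrak n}=s(\mathbf p)$, the index $m$ runs over integers (an empty product is $1$), and $\Lambda,\Omega$ run over the $\mathfrak n\times\mathfrak n$ matrices of nonnegative integers with $s(\Lambda)=\mu_0$, $i$-th row sum of $\Omega$ equal to $\mu_i$ for all $i$, and $s(\Omega_{*,j})+s(\Lambda_{j,*})+s(\Lambda_{*,j})=p_j$ for all $j$ (here $\Lambda_{j,*}$ and $\Lambda_{*,j}$ are the $j$-th row and column); $M^{\Lambda}=\prod m_{ij}^{\lambda_{ij}}$ with $0^0=1$, and $\Lambda!=\prod\lambda_{ij}!$. Call $(\alpha,\beta)$ admissible if $\alpha\in L^\sharp$, $Q(\alpha)\in\frac1{N'}\mathbb Z$ and $\beta\in L^\sharp+\frac1{N'}L$. To an admissible pair associate $\Theta_{\alpha,\beta}\colon\mathfrak I\to\mathbb C$, $$\Theta_{\alpha,\beta}(\mathbf p,n)=\sum_{\substack{v_1,\dots,v_{N'}\in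 L\\ Q(\alpha+v_1)+\dots+Q(\alpha+v_{N'})=n}}\mathfrak e\bigl(B(\beta,v_1+\dots+v_{N'})\bigr)\,P_{N'\mathfrak n/2,\,\mathbf p,\,N'G_{\mathfrak B}}\Bigl(n,\Bigl(\tfrac{(\alpha+v_1)+\dots+(\alpha+v_{N'})}{N'}\Bigr)_{\mathfrak B}\Bigr).$$ **Theorem.** Suppose that $\mathcal F_{\underline L_{N'},\mathcal P_0}^{\mathfrak B}$ is not identically zero on $\mathbb H$. Then for every finite family $(\alpha_i,\beta_i)_{i\in I}$ of admissible pairs and all complex numbers $(a_i)_{i\in I}$, $$\sum_{i\in I}a_i\,\theta_{\alpha_i,\beta_i}^{N'}=0\ \text{ on }\mathbb H\times\mathcal V\quad\Longleftrightarrow\quad\sum_{i\in I}a_i\,\Theta_{\alpha_i,\beta_i}=0\ \text{ on }\mathfrak I.$$ -/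

import Mathlib

open scoped TensorProduct UpperHalfPlane

noncomputable section

namespace LatticeTheta

/-- The function `𝔢(z) = exp(2πiz)`. -/
def e (z : ℂ) : ℂ := Complex.exp (2 * Real.pi * Complex.I * z)

/-- The sum `s(p)` of the components of `p`. -/
def s {n : ℕ} (p : Fin n → ℕ) : ℕ := ∑ j, p j

/-! ### The polynomials `P_{k,p,M}` -/

/-- The `n × n` matrices of natural numbers with all entries at most `m`. -/
def boundedMatrices (n m : ℕ) : Finset (Fin n → Fin n → ℕ) :=
  Fintype.piFinset fun _ => Fintype.piFinset fun _ => Finset.range (m + 1)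

/-- The quotient `Γ(k + σ - 1 - μ₀) / Γ(k + λ')` with `λ' = ⌊(σ - 1) / 2⌋`, that is, the product
of the factors `k + m` for the integers `m` with `λ' ≤ m ≤ σ - 2 - μ₀`. In particular it is `1`
when `σ = μ₀ = 0`, also for `k = 1`, where both Gamma functions have a pole. -/
def gammaQuotient (k : ℝ) (σ μ₀ : ℕ) : ℝ :=
  ∏ m ∈ Finset.Icc (((σ : ℤ) - 1) / 2) ((σ : ℤ) - 2 - μ₀), (k + m)

/-- The polynomial `P_{k,p,M}(X₀, X₁, …, Xₙ)`. The outer sum is over the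
`μ = (μ₀, μ₁, …, μₙ)` with `2μ₀ + μ₁ + ⋯ + μₙ = s(p)`, the inner one over the pairs `(Λ, Ω)` of
matrices with `s(Λ) = μ₀`, with `i`-th row sum of `Ω` equal to `μᵢ`, and with
(`j`-th column sum of `Ω`) + (`j`-th row sum of `Λ`) + (`j`-th column sum of `Λ`) `= pⱼ`.
These conditions force all entries of `μ`, `Λ`, `Ω` to be at most `s(p)`. -/
def P {n : ℕ} (k : ℝ) (p : Fin n → ℕ) (M : Matrix (Fin n) (Fin n) ℝ) :
    MvPolynomial (Fin (n + 1)) ℝ :=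
  ∑ μ ∈ (Fintype.piFinset fun _ : Fin (n + 1) => Finset.range (s p + 1)) with
      2 * μ 0 + ∑ i : Fin n, μ i.succ = s p,
    MvPolynomial.C ((-1) ^ μ 0 * 2 ^ (s p - μ 0) * gammaQuotient k (s p) (μ 0) *
        ∑ x ∈ boundedMatrices n (s p) ×ˢ boundedMatrices n (s p) with
          (∑ i, ∑ j, x.1 i j = μ 0) ∧ (∀ i, ∑ j, x.2 i j = μ i.succ) ∧
            (∀ j, ∑ i, x.2 i j + (∑ i, x.1 j i + ∑ i, x.1 i j) = p j),
          ∏ i, ∏ j, M i j ^ (x.1 i j + x.2 i j) /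
            (((x.1 i j).factorial : ℝ) * ((x.2 i j).factorial : ℝ))) *
      ∏ i, MvPolynomial.X i ^ μ i

/-! ### The closure of a set of exponents, and the index set -/

/-- The set `P̂₀` of all `q` such that `q ≼ p` for some `p ∈ P₀`, where `q ≼ p` means that
`q ≤ p` componentwise and `s(q) ≡ s(p) mod 2`. -/
def precClosure {n : ℕ} (P₀ : Set (Fin n → ℕ)) : Set (Fin n → ℕ) :=
  {q | ∃ p ∈ P₀, q ≤ p ∧ s q ≡ s p [MOD 2]}

/-- `⌊(δ_N N² / 24) (N' n / 2 + s(p)) ∏_{ℓ ∣ N} (1 - 1 / ℓ²)⌋`, with `δ_N = 2` for `N = 1, 2` and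
`δ_N = 1` for `N ≥ 3`. -/
def coeffBound {n : ℕ} (N N' : ℕ) (p : Fin n → ℕ) : ℕ :=
  ⌊(if N ≤ 2 then (2 : ℚ) else 1) * (N : ℚ) ^ 2 / 24 * ((N' : ℚ) * (n : ℚ) / 2 + (s p : ℚ)) *
    ∏ l ∈ N.primeFactors, (1 - 1 / (l : ℚ) ^ 2)⌋₊

/-- The set `ℑ` of the pairs `(p, m)` with `p ∈ P̂₀` and `0 ≤ m ≤ coeffBound N N' p`. -/
def indexSet {n : ℕ} (N N' : ℕ) (P₀ : Set (Fin n → ℕ)) : Set ((Fin n → ℕ) × ℕ) :=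
  {x | x.1 ∈ precClosure P₀ ∧ x.2 ≤ coeffBound N N' x.1}

/-! ### Lattices and theta series -/

variable {V : Type*} [AddCommGroup V] [Module ℝ V]

/-- The quadratic form `Q(v) = B(v, v) / 2`. -/
def Q (B : LinearMap.BilinForm ℝ V) (v : V) : ℝ := B v v / 2

/-- `N` is the level of `(L, B)`: the least positive integer such that `N · Q` is integral on the
dual lattice. -/
def IsLevel (B : LinearMap.BilinForm ℝ V) (L : Submodule ℤ V) (N : ℕ) : Prop :=
  IsLeast {m : ℕ | 0 < m ∧ ∀ v ∈ B.dualSubmodule L, ∃ j : ℤ, (m : ℝ) * Q B v = j} N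

/-- The discriminant group `L♯ / L` of `(L, B)`. -/
abbrev DiscGroup (B : LinearMap.BilinForm ℝ V) (L : Submodule ℤ V) : Type _ :=
  B.dualSubmodule L ⧸ L.submoduleOf (B.dualSubmodule L)

/-- The exponential `𝔢(τ Q(v) + B(v, z))`, for `v ∈ V` and `z` in the complexification of `V`, to
which `B` is extended bilinearly. -/
def thetaTerm (B : LinearMap.BilinForm ℝ V) (τ : ℍ) (z : ℂ ⊗[ℝ] V) (v : V) : ℂ :=
  e ((τ : ℂ) * (Q B v : ℂ) + B.baseChange ℂ ((1 : ℂ) ⊗ₜ[ℝ] v) z)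

/-- The theta series `θ_{α,β}(τ, z) = ∑_{v ∈ L} 𝔢(B(β, v)) 𝔢(τ Q(α + v) + B(α + v, z))`. -/
def theta (B : LinearMap.BilinForm ℝ V) (L : Submodule ℤ V) (α β : V)
    (x : ℍ × (ℂ ⊗[ℝ] V)) : ℂ :=
  ∑' v : L, e (B β v : ℂ) * thetaTerm B x.1 x.2 (α + v)

/-- The Jacobi theta series `ϑ_{L,t}(τ, z) = ∑_{v ∈ t + L} 𝔢(τ Q(v) + B(v, z))` of a class
`t ∈ L♯ / L`. -/
def jacobiThetaLattice (B : LinearMap.BilinForm ℝ V) (L : Submodule ℤ V) (t : DiscGroup B L)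
    (τ : ℍ) (z : ℂ ⊗[ℝ] V) : ℂ :=
  ∑' v : {v : B.dualSubmodule L // (Submodule.Quotient.mk v : DiscGroup B L) = t},
    thetaTerm B τ z (v : B.dualSubmodule L)

/-- The differential operator `∂^p = ∂^{s(p)} / ∂z₁^{p₁} ⋯ ∂zₙ^{pₙ}` in the coordinates of the
complexification of `V` with respect to the basis `b`. -/
def iterPartial {n : ℕ} (b : Module.Basis (Fin n) ℝ V) (p : Fin n → ℕ)
    (f : ℂ ⊗[ℝ] V → ℂ) : ℂ ⊗[ℝ] V → ℂ :=
  (List.finRange n).foldr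
    (fun i g => (fun h z => lineDeriv ℂ h z ((1 : ℂ) ⊗ₜ[ℝ] b i))^[p i] g) f

/-- The function `ℱ(τ) = det ((2πi)^{-s(pᵢ)} ∂^{pᵢ} ϑ_{L,tⱼ}(τ, z)|_{z = 0})` for an enumeration
`t₁, …, t_d` of `L♯ / L` and exponents `p₁, …, p_d`. -/
def thetaDet (B : LinearMap.BilinForm ℝ V) (L : Submodule ℤ V) {n : ℕ}
    (b : Module.Basis (Fin n) ℝ V) {d : ℕ} (p : Fin d → Fin n → ℕ) (t : Fin d ≃ DiscGroup B L)
    (τ : ℍ) : ℂ :=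
  (Matrix.of fun i j : Fin d =>
    1 / (2 * Real.pi * Complex.I) ^ s (p i) *
      iterPartial b (p i) (jacobiThetaLattice B L (t j) τ) 0).det

/-- The Gram matrix of `B` with respect to the basis `b`. -/
def gram (B : LinearMap.BilinForm ℝ V) {n : ℕ} (b : Module.Basis (Fin n) ℝ V) :
    Matrix (Fin n) (Fin n) ℝ :=
  Matrix.of fun i j => B (b i) (b j)

/-- The `(p, m)`-term of the sequence `Θ_{α,β}`: the sum over the (finitely many)
`(v₁, …, v_{N'}) ∈ L^{N'}` with `Q(α + v₁) + ⋯ + Q(α + v_{N'}) = m` of `𝔢(B(β, v₁ + ⋯ + v_{N'}))`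
times the value of `P_{N' n / 2, p, N' · G}` at `m` and the coordinates of
`((α + v₁) + ⋯ + (α + v_{N'})) / N'`, where `G` is the Gram matrix. -/
def thetaCoeff (B : LinearMap.BilinForm ℝ V) (L : Submodule ℤ V) {n : ℕ}
    (b : Module.Basis (Fin n) ℝ V) (N' : ℕ) (α β : V) (x : (Fin n → ℕ) × ℕ) : ℂ :=
  ∑ᶠ (v : Fin N' → L) (_ : ∑ i, Q B (α + v i) = (x.2 : ℝ)),
    e (B β (∑ i, (v i : V)) : ℂ) *
      (MvPolynomial.eval
        (Fin.cons (x.2 : ℝ) (b.repr ((N' : ℝ)⁻¹ • ∑ i, (α + (v i : V)))) : Fin (n + 1) → ℝ)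
        (P ((N' : ℝ) * (n : ℝ) / 2) x.1 ((N' : ℝ) • gram B b)) : ℝ)

end LatticeTheta

end

/-!
Linear relations between powers of theta series are decided by finitely many coefficients.

Put `f = ∑ aᵢ θ_{αᵢ,βᵢ}^{N'}`. This function of `(τ, z)` behaves like a Jacobi form under `Γ₁(N)`.
Poisson summation, applied to the classes modulo `c`, gives the transformation law of `θ_{0,0}`
under `Γ₀(N)` with a Gauss sum as a factor (`EvenLattice.theta0_moeb_pos`). It is not necessary to
evaluate the Gauss sum: the comparison of a matrix with its inverse shows that the automorphy factor
is a square root of a unimodular multiple of `(cτ + d)ⁿ` (`EvenLattice.hasFactor`). Passing to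
admissible characteristics introduces roots of unity, which are `N'`-th roots for matrices in
`Γ₁(N)`, so that they disappear in the `N'`-th powers (`EvenLattice.thetaChar_moeb`,
`EvenLattice.powSeries_moeb`).

Following Eichler and Zagier, the Taylor coefficients in `z` of such a function are combined with
derivatives in `τ` of the lower ones to give modular forms (`taylorPoly_series_moeb`). The
polynomials `P_{k,p,M}` are the coefficients of the polynomials that arise in this way, as functions
of the direction (`sum_eval_P`). Thus `(p, m) ↦ ∑ aᵢ Θ_{αᵢ,βᵢ}(p, m)` is, for fixed `p`, the
sequence of Fourier coefficients of a modular form of weight `N' n / 2 + s(p)`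
(`EvenLattice.norm_powPoly_series_moeb`, `sum_thetaCoeff`).

If `f = 0`, then all these coefficients vanish (`fiber_powPoly_eq_zero`). Conversely, if they vanish
on the index set, then each of the modular forms with exponent in `P̂₀` vanishes by a Sturm bound
(`sturm_bound`), which is proved by applying the maximum principle to a norm from `Γ₁(N)` to
`SL₂(ℤ)` divided by a power of `Δ`. The leading coefficient of `P_{k,p,M}` is not zero and its other
terms belong to exponents obtained from `p` by lowering, so an induction along `P̂₀` shows that the
derivatives `∂^p f` with `p ∈ P₀` vanish at `z = 0` (`fiber_monomial_eq_zero`). Finally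
`f = ∑ h_t ϑ_t` with holomorphic functions `h_t`, the sum being over the discriminant group
(`EvenLattice.exists_decomposition`). The `h_t` solve the homogeneous linear system with the matrix
`(∂^{pᵢ} ϑ_{tⱼ}(τ, 0))`, whose determinant does not vanish identically; hence `h_t = 0` and `f = 0`
(`EvenLattice.powSeries_eq_zero`).
-/

open scoped TensorProduct UpperHalfPlane MatrixGroups

noncomputable section

namespace LatticeTheta

/-! ### Absolutely convergent exponential series -/

lemma e_add (x y : ℂ) : e (x + y) = e x * e y := by
  simp only [e, mul_add, Complex.exp_add]

lemma e_zero : e 0 = 1 := by simp [e]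

lemma e_int (k : ℤ) : e k = 1 := by
  rw [e, Complex.exp_eq_one_iff]; exact ⟨k, by ring⟩

lemma e_nsmul (k : ℕ) (x : ℂ) : e (k * x) = e x ^ k := by
  rw [e, e, ← Complex.exp_nat_mul]; congr 1; ring

lemma norm_e (x : ℂ) : ‖e x‖ = Real.exp (-(2 * Real.pi * x.im)) := by
  rw [e, Complex.norm_exp]; congr 1; simp

lemma norm_e_real (x : ℝ) : ‖e x‖ = 1 := by simp [norm_e]

lemma norm_e_le (x : ℂ) : ‖e x‖ ≤ Real.exp (2 * Real.pi * ‖x‖) := by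
  rw [norm_e]
  apply Real.exp_le_exp.2
  have h1 := Complex.abs_im_le_norm x
  have h2 := neg_abs_le x.im
  have := Real.pi_pos
  nlinarith

lemma hasDerivAt_e (a b t : ℂ) :
    HasDerivAt (fun t : ℂ => e (a + t * b)) (2 * Real.pi * Complex.I * b * e (a + t * b)) t := by
  unfold e
  have h : HasDerivAt (fun t : ℂ => 2 * Real.pi * Complex.I * (a + t * b))
      (2 * Real.pi * Complex.I * (1 * b)) t :=
    (((hasDerivAt_id t).mul_const b).const_add a).const_mul _
  refine h.cexp.congr_deriv ?_
  ring

/-- The product of finitely many absolutely convergent series over the same index type. -/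
theorem summable_and_tsum_prod_pi {R X : Type*} [NormedCommRing R] [CompleteSpace R] :
    ∀ {k : ℕ} (f : Fin k → X → R) (_ : ∀ i, Summable fun x => ‖f i x‖),
      (Summable fun v : Fin k → X => ‖∏ i, f i (v i)‖) ∧
        ∑' v : Fin k → X, ∏ i, f i (v i) = ∏ i, ∑' x, f i x
  | 0, f, _ => by
    constructor
    · exact (hasSum_fintype _).summable
    · simp
  | k + 1, f, hf => by
    obtain ⟨h1, h2⟩ := summable_and_tsum_prod_pi (fun i : Fin k => f i.succ) fun i => hf i.succ
    have key : ∀ p : X × (Fin k → X), ∏ i, f i (Fin.consEquiv (fun _ => X) p i) =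
        f 0 p.1 * ∏ i : Fin k, f i.succ (p.2 i) := by
      intro p
      rw [Fin.prod_univ_succ]
      simp [Fin.consEquiv]
    have h3 := (hf 0).mul_norm h1
    constructor
    · rw [← (Fin.consEquiv fun _ => X).summable_iff]
      refine h3.congr fun p => ?_
      rw [Function.comp_apply, key]
    · rw [← (Fin.consEquiv fun _ => X).tsum_eq, Fin.prod_univ_succ, ← h2,
        tsum_mul_tsum_of_summable_norm (hf 0) h1]
      exact tsum_congr key

variable {X : Type*}

/-- A nonnegative exponent function `m` is tame if `∑ exp (-ε m)` grows at most polynomially in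
`1 / ε` as `ε → 0`. -/
def ExpTame (m : X → ℝ) : Prop :=
  (∀ x, 0 ≤ m x) ∧ ∃ C : ℝ, ∃ A : ℕ, ∀ ε : ℝ, 0 < ε → ε ≤ 1 →
    (Summable fun x => Real.exp (-ε * m x)) ∧ ∑' x, Real.exp (-ε * m x) ≤ C * (1 / ε) ^ A

/-- Coefficients of at most polynomial growth in the exponent `m`. -/
def PolyBd (m : X → ℝ) (c : X → ℂ) : Prop :=
  ∃ C : ℝ, ∃ k : ℕ, ∀ x, ‖c x‖ ≤ C * (1 + m x) ^ k

/-- Linear exponents that are of smaller order than the exponent `m`. -/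
def LittleBd (m : X → ℝ) (r : X → ℂ) : Prop :=
  ∀ ε : ℝ, 0 < ε → ∃ C : ℝ, ∀ x, ‖r x‖ ≤ ε * m x + C

namespace ExpTame

variable {m : X → ℝ}

lemma summable (h : ExpTame m) {ε : ℝ} (hε : 0 < ε) :
    Summable fun x => Real.exp (-ε * m x) := by
  obtain ⟨h0, C, A, hC⟩ := h
  refine Summable.of_nonneg_of_le (fun x => (Real.exp_pos _).le) (fun x => ?_)
    (hC (min ε 1) (by positivity) (min_le_right _ _)).1
  apply Real.exp_le_exp.2
  have := mul_le_mul_of_nonneg_right (min_le_left ε 1) (h0 x)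
  linarith

lemma comp_injective {Y : Type*} (h : ExpTame m) {φ : Y → X} (hφ : Function.Injective φ) :
    ExpTame (m ∘ φ) := by
  obtain ⟨h0, C, A, hC⟩ := h
  refine ⟨fun y => h0 _, C, A, fun ε h1 h2 => ?_⟩
  have hs := (hC ε h1 h2).1
  have hs' : Summable fun y => Real.exp (-ε * (m ∘ φ) y) := hs.comp_injective hφ
  refine ⟨hs', le_trans ?_ (hC ε h1 h2).2⟩
  exact Summable.tsum_le_tsum_of_inj φ hφ (fun _ _ => (Real.exp_pos _).le) (fun _ => le_rfl) hs' hs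

lemma mono (h : ExpTame m) {m' : X → ℝ} (h0' : ∀ x, 0 ≤ m' x) {a b : ℝ} (ha : 0 < a) (ha1 : a ≤ 1)
    (hle : ∀ x, a * m x ≤ m' x + b) : ExpTame m' := by
  obtain ⟨h0, C, A, hC⟩ := h
  refine ⟨h0', Real.exp |b| * (C * (1 / a) ^ A), A, fun ε h1 h2 => ?_⟩
  obtain ⟨hs, ht⟩ := hC (ε * a) (by positivity) (by nlinarith)
  have hle' : ∀ x, Real.exp (-ε * m' x) ≤ Real.exp |b| * Real.exp (-(ε * a) * m x) := by
    intro x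
    rw [← Real.exp_add]
    apply Real.exp_le_exp.2
    have := mul_le_mul_of_nonneg_left (hle x) h1.le
    have h3 : ε * b ≤ |b| := by nlinarith [le_abs_self b, abs_nonneg b]
    nlinarith
  have hs' : Summable fun x => Real.exp (-ε * m' x) :=
    Summable.of_nonneg_of_le (fun x => (Real.exp_pos _).le) hle' (hs.mul_left _)
  refine ⟨hs', (Summable.tsum_le_tsum hle' hs' (hs.mul_left _)).trans ?_⟩
  rw [tsum_mul_left]
  calc _ ≤ Real.exp |b| * (C * (1 / (ε * a)) ^ A) := by gcongr
    _ = _ := by rw [← one_div_mul_one_div, mul_pow]; ring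

lemma pi (h : ExpTame m) (k : ℕ) : ExpTame fun v : Fin k → X => ∑ i, m (v i) := by
  obtain ⟨h0, C, A, hC⟩ := h
  refine ⟨fun v => Finset.sum_nonneg fun i _ => h0 _, C ^ k, A * k, fun ε h1 h2 => ?_⟩
  obtain ⟨hs, ht⟩ := hC ε h1 h2
  obtain ⟨h3, h4⟩ := summable_and_tsum_prod_pi (k := k)
    (fun _ x => Real.exp (-ε * m x)) (fun _ => hs.norm)
  have key : ∀ v : Fin k → X, ∏ i, Real.exp (-ε * m (v i)) = Real.exp (-ε * ∑ i, m (v i)) := by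
    intro v; rw [← Real.exp_sum, Finset.mul_sum]
  simp_rw [key] at h3 h4
  refine ⟨h3.of_norm, ?_⟩
  rw [h4, Finset.prod_const, Finset.card_univ, Fintype.card_fin]
  calc _ ≤ (C * (1 / ε) ^ A) ^ k := by gcongr
    _ = _ := by rw [mul_pow, pow_mul]

lemma prodFintype {ι Y : Type*} [Fintype ι] {μ : ι → Y → ℝ} (h : ∀ i, ExpTame (μ i)) :
    ExpTame fun x : ι × Y => μ x.1 x.2 := by
  choose h0 C A hC using h
  refine ⟨fun x => h0 _ _, ∑ i, |C i|, ∑ i, A i, fun ε h1 h2 => ?_⟩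
  have hs : Summable fun x : ι × Y => Real.exp (-ε * μ x.1 x.2) := by
    rw [summable_prod_of_nonneg fun _ => (Real.exp_pos _).le]
    exact ⟨fun i => (hC i ε h1 h2).1, (hasSum_fintype _).summable⟩
  refine ⟨hs, ?_⟩
  rw [hs.tsum_prod, tsum_fintype, Finset.sum_mul]
  refine Finset.sum_le_sum fun i _ => ((hC i ε h1 h2).2.trans ?_)
  have : 1 ≤ 1 / ε := by rw [le_div_iff₀ h1]; linarith
  gcongr
  · exact le_abs_self _
  · exact Finset.single_le_sum (f := A) (fun _ _ => Nat.zero_le _) (Finset.mem_univ i)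

lemma finite_le (h : ExpTame m) (T : ℝ) : {x | m x ≤ T}.Finite := by
  have := (h.summable one_pos).tendsto_cofinite_zero
  have h2 := this.eventually (gt_mem_nhds (Real.exp_pos (-T)))
  rw [Filter.eventually_cofinite] at h2
  refine h2.subset fun x hx => ?_
  simp only [Set.mem_ofPred_eq, not_lt] at hx ⊢
  apply Real.exp_le_exp.2; linarith

end ExpTame

lemma expTame_int : ExpTame fun k : ℤ => |(k : ℝ)| := by
  refine ⟨fun k => abs_nonneg _, 4, 1, fun ε h1 h2 => ?_⟩
  have hr : Real.exp (-ε) < 1 := by rw [Real.exp_lt_one_iff]; linarith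
  have hN : HasSum (fun k : ℕ => Real.exp (-ε * |((k : ℤ) : ℝ)|)) (1 - Real.exp (-ε))⁻¹ := by
    have := hasSum_geometric_of_lt_one (Real.exp_pos (-ε)).le hr
    refine this.congr_fun fun k => ?_
    rw [← Real.exp_nat_mul]; simp [mul_comm]
  have hM : HasSum (fun k : ℕ => Real.exp (-ε * |((-((k : ℤ) + 1) : ℤ) : ℝ)|))
      (Real.exp (-ε) * (1 - Real.exp (-ε))⁻¹) := by
    have := (hasSum_geometric_of_lt_one (Real.exp_pos (-ε)).le hr).mul_left (Real.exp (-ε))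
    refine this.congr_fun fun k => ?_
    rw [← Real.exp_nat_mul, ← Real.exp_add]
    congr 1
    push_cast
    rw [abs_neg, abs_of_nonneg (by positivity)]; ring
  have hZ := HasSum.int_rec (f := fun k : ℕ => Real.exp (-ε * |((k : ℤ) : ℝ)|))
    (g := fun k : ℕ => Real.exp (-ε * |((-((k : ℤ) + 1) : ℤ) : ℝ)|)) hN hM
  have hfun : (fun k : ℤ => Real.exp (-ε * |(k : ℝ)|)) =
      fun z : ℤ => Int.rec (fun k : ℕ => Real.exp (-ε * |((k : ℤ) : ℝ)|))
        (fun k : ℕ => Real.exp (-ε * |((-((k : ℤ) + 1) : ℤ) : ℝ)|)) z := by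
    funext z
    cases z with
    | ofNat k => rfl
    | negSucc k => simp [Int.cast_negSucc]
  rw [← hfun] at hZ
  refine ⟨hZ.summable, ?_⟩
  rw [hZ.tsum_eq]
  have h3 : ε / 2 ≤ 1 - Real.exp (-ε) := by
    have h4 := Real.add_one_le_exp ε
    have h5 : Real.exp (-ε) ≤ (ε + 1)⁻¹ := by
      rw [Real.exp_neg]; exact inv_anti₀ (by linarith) h4
    have h6 : (ε + 1)⁻¹ ≤ 1 - ε / 2 := by
      rw [inv_le_iff_one_le_mul₀ (by linarith)]; nlinarith
    linarith
  have h4 : (1 - Real.exp (-ε))⁻¹ ≤ 2 / ε := by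
    rw [show 2 / ε = (ε / 2)⁻¹ by field_simp]
    exact inv_anti₀ (by linarith) h3
  have h5 : 0 ≤ (1 - Real.exp (-ε))⁻¹ := by
    rw [inv_nonneg]; linarith
  have : Real.exp (-ε) * (1 - Real.exp (-ε))⁻¹ ≤ 2 / ε := by nlinarith
  calc _ ≤ 2 / ε + 2 / ε := add_le_add h4 this
    _ = _ := by ring

lemma expTame_int_pi (n : ℕ) : ExpTame fun v : Fin n → ℤ => ∑ i, |(v i : ℝ)| :=
  expTame_int.pi n

namespace PolyBd

variable {m : X → ℝ} {c c' : X → ℂ}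

lemma mul (h : PolyBd m c) (h' : PolyBd m c') :
    PolyBd m (fun x => c x * c' x) := by
  obtain ⟨C, k, h⟩ := h
  obtain ⟨C', k', h'⟩ := h'
  refine ⟨C * C', k + k', fun x => ?_⟩
  rw [norm_mul, pow_add]
  calc _ ≤ (C * (1 + m x) ^ k) * (C' * (1 + m x) ^ k') :=
        mul_le_mul (h x) (h' x) (norm_nonneg _) ((norm_nonneg _).trans (h x))
    _ = _ := by ring

lemma const (a : ℂ) : PolyBd m fun _ => a := ⟨‖a‖, 0, fun x => by simp⟩

lemma of_bounded {C : ℝ} (h : ∀ x, ‖c x‖ ≤ C) : PolyBd m c := ⟨C, 0, fun x => by simpa using h x⟩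

lemma add (hm : ∀ x, 0 ≤ m x) (h : PolyBd m c) (h' : PolyBd m c') :
    PolyBd m (fun x => c x + c' x) := by
  obtain ⟨C, k, h⟩ := h
  obtain ⟨C', k', h'⟩ := h'
  refine ⟨|C| + |C'|, k + k', fun x => (norm_add_le _ _).trans ?_⟩
  have h1 : 1 ≤ 1 + m x := by linarith [hm x]
  rw [add_mul]
  refine add_le_add ((h x).trans ?_) ((h' x).trans ?_) <;> gcongr <;>
    first | exact le_abs_self _ | omega

lemma sum (hm : ∀ x, 0 ≤ m x) {ι : Type*} (s : Finset ι) {f : ι → X → ℂ}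
    (h : ∀ i ∈ s, PolyBd m (f i)) : PolyBd m (fun x => ∑ i ∈ s, f i x) := by
  classical
  induction s using Finset.induction_on with
  | empty => simpa using const 0
  | insert a s ha ih =>
    simp only [Finset.sum_insert ha]
    exact (h a (by simp)).add hm (ih fun i hi => h i (by simp [hi]))

lemma prod {ι : Type*} (s : Finset ι) {f : ι → X → ℂ}
    (h : ∀ i ∈ s, PolyBd m (f i)) : PolyBd m (fun x => ∏ i ∈ s, f i x) := by
  classical
  induction s using Finset.induction_on with
  | empty => simpa using const 1
  | insert a s ha ih =>
    simp only [Finset.prod_insert ha]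
    exact (h a (by simp)).mul (ih fun i hi => h i (by simp [hi]))

lemma pow (h : PolyBd m c) (k : ℕ) : PolyBd m (fun x => c x ^ k) := by
  simpa using prod (Finset.range k) (f := fun _ => c) fun _ _ => h

lemma exponent (hm : ∀ x, 0 ≤ m x) : PolyBd m (fun x => (m x : ℂ)) :=
  ⟨1, 1, fun x => by simp [abs_of_nonneg (hm x)]⟩

end PolyBd

namespace LittleBd

variable {m : X → ℝ} {r : X → ℂ}

lemma polyBd (h : LittleBd m r) (hm : ∀ x, 0 ≤ m x) : PolyBd m r := by
  obtain ⟨C, hC⟩ := h 1 one_pos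
  refine ⟨1 + |C|, 1, fun x => (hC x).trans ?_⟩
  have := hm x
  have h2 := le_abs_self C
  have h3 := abs_nonneg C
  nlinarith

lemma zero (hm : ∀ x, 0 ≤ m x) : LittleBd m fun _ => (0 : ℂ) := fun ε hε =>
  ⟨0, fun x => by have := hm x; simp; positivity⟩

lemma smul (h : LittleBd m r) (hm : ∀ x, 0 ≤ m x) (t : ℂ) : LittleBd m fun x => t * r x := by
  intro ε hε
  obtain ⟨C, hC⟩ := h (ε / (‖t‖ + 1)) (by positivity)
  refine ⟨‖t‖ * C, fun x => ?_⟩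
  rw [norm_mul]
  have h0 : ‖t‖ * (ε / (‖t‖ + 1)) ≤ ε := by
    rw [mul_div_assoc', div_le_iff₀ (by positivity)]; nlinarith [norm_nonneg t]
  calc _ ≤ ‖t‖ * (ε / (‖t‖ + 1) * m x + C) := by gcongr; exact hC x
    _ = (‖t‖ * (ε / (‖t‖ + 1))) * m x + ‖t‖ * C := by ring
    _ ≤ _ := by gcongr; exact hm x

end LittleBd

lemma one_add_pow_le_exp {m δ : ℝ} (hm : 0 ≤ m) (hδ : 0 < δ) (k : ℕ) :
    (1 + m) ^ k ≤ k.factorial / δ ^ k * Real.exp (δ * (1 + m)) := by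
  have := Real.pow_div_factorial_le_exp (δ * (1 + m)) (by positivity) k
  rw [div_le_iff₀ (by positivity), mul_pow] at this
  rw [div_mul_eq_mul_div, le_div_iff₀ (by positivity)]
  linarith

/-- The sums that dominate the exponential series: neither coefficients of polynomial growth nor
linear exponents of smaller order spoil the decay. -/
lemma summable_majorant {m : X → ℝ} (hm : ExpTame m) {c r : X → ℂ} (hc : PolyBd m c)
    (hr : LittleBd m r) {δ : ℝ} (hδ : 0 < δ) :
    Summable fun x => ‖c x‖ * Real.exp (-δ * m x + 2 * Real.pi * ‖r x‖) := by
  obtain ⟨C, k, hC⟩ := hc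
  have hpi := Real.pi_pos
  obtain ⟨D, hD⟩ := hr (δ / (8 * Real.pi)) (by positivity)
  refine Summable.of_nonneg_of_le (fun x => by positivity) (fun x => ?_)
    ((hm.summable (half_pos hδ)).mul_left
      (|C| * (k.factorial / (δ / 4) ^ k) * Real.exp (δ / 4 + 2 * Real.pi * D)))
  have h1 := one_add_pow_le_exp (hm.1 x) (show 0 < δ / 4 by positivity) k
  have h2 : ‖c x‖ ≤ |C| * (k.factorial / (δ / 4) ^ k * Real.exp (δ / 4 * (1 + m x))) := by
    refine (hC x).trans (mul_le_mul (le_abs_self C) h1 (by have := hm.1 x; positivity)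
      (abs_nonneg _))
  have h3 : 2 * Real.pi * ‖r x‖ ≤ δ / 4 * m x + 2 * Real.pi * D := by
    have := mul_le_mul_of_nonneg_left (hD x) (show 0 ≤ 2 * Real.pi by positivity)
    refine this.trans (le_of_eq ?_)
    field_simp
    ring
  calc _ ≤ (|C| * (k.factorial / (δ / 4) ^ k * Real.exp (δ / 4 * (1 + m x)))) *
        Real.exp (-δ * m x + (δ / 4 * m x + 2 * Real.pi * D)) := by gcongr
    _ = |C| * (k.factorial / (δ / 4) ^ k) * (Real.exp (δ / 4 * (1 + m x)) *
        Real.exp (-δ * m x + (δ / 4 * m x + 2 * Real.pi * D))) := by ring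
    _ = |C| * (k.factorial / (δ / 4) ^ k) * (Real.exp (δ / 4 + 2 * Real.pi * D) *
        Real.exp (-(δ / 2) * m x)) := by
          rw [← Real.exp_add, ← Real.exp_add]; congr 2; ring
    _ = _ := by ring

lemma norm_term_le (c : ℂ) (m : ℝ) (r τ : ℂ) :
    ‖c * e (τ * m + r)‖ ≤ ‖c‖ * Real.exp (-(2 * Real.pi * τ.im) * m + 2 * Real.pi * ‖r‖) := by
  rw [norm_mul, e_add, norm_mul, norm_e, Real.exp_add]
  have h1 : (τ * (m : ℂ)).im = τ.im * m := by simp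
  rw [h1]
  gcongr
  · exact le_of_eq (by ring)
  · exact norm_e_le r

lemma summable_expSeries {m : X → ℝ} (hm : ExpTame m) {c r : X → ℂ} (hc : PolyBd m c)
    (hr : LittleBd m r) {τ : ℂ} (hτ : 0 < τ.im) :
    Summable fun x => ‖c x * e (τ * m x + r x)‖ :=
  Summable.of_nonneg_of_le (fun x => norm_nonneg _) (fun x => norm_term_le _ _ _ _)
    (summable_majorant hm hc hr (by have := Real.pi_pos; positivity))

/-- The series `∑ c 𝔢(τ m + r)`. -/
def expSeries (c : X → ℂ) (m : X → ℝ) (r : X → ℂ) (τ : ℂ) : ℂ := ∑' x, c x * e (τ * m x + r x)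

lemma hasSum_expSeries {m : X → ℝ} (hm : ExpTame m) {c r : X → ℂ} (hc : PolyBd m c)
    (hr : LittleBd m r) {τ : ℂ} (hτ : 0 < τ.im) :
    HasSum (fun x => c x * e (τ * m x + r x)) (expSeries c m r τ) :=
  (summable_expSeries hm hc hr hτ).of_norm.hasSum

/-- Termwise differentiation in a direction `ℓ` of at most linear growth in `m`; it covers both
the derivative in `τ` (`ℓ = m`) and the directional derivatives in `z`. -/
lemma hasDerivAt_expSeries_dir {m : X → ℝ} (hm : ExpTame m) {c r ℓ : X → ℂ} (hc : PolyBd m c)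
    (hr : LittleBd m r) {D : ℝ} (hℓ : ∀ x, ‖ℓ x‖ ≤ D * (1 + m x)) {τ : ℂ} (hτ : 0 < τ.im) :
    HasDerivAt (fun t : ℂ => expSeries c m (fun x => r x + t * ℓ x) τ)
      (expSeries (fun x => c x * (2 * Real.pi * Complex.I * ℓ x)) m r τ) 0 := by
  have hpi := Real.pi_pos
  have hD : ∀ x, ‖ℓ x‖ ≤ (|D| + 1) * (1 + m x) := fun x => (hℓ x).trans (by
    have := hm.1 x
    gcongr
    linarith [le_abs_self D])
  set E := |D| + 1 with hE
  have hE0 : 0 < E := by positivity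
  have hℓp : PolyBd m ℓ := ⟨E, 1, by simpa using hD⟩
  set δ : ℝ := τ.im / (2 * E) with hδ
  have hδ0 : 0 < δ := by positivity
  have hc' : PolyBd m (fun x => c x * (2 * Real.pi * Complex.I * ℓ x)) :=
    hc.mul ((PolyBd.const _).mul hℓp)
  have hmaj := (summable_majorant hm hc' hr (show 0 < Real.pi * τ.im by positivity)).mul_right
    (Real.exp (Real.pi * τ.im))
  have hbd : ∀ x (t : ℂ), t ∈ Metric.ball (0 : ℂ) δ →
      2 * Real.pi * ‖r x + t * ℓ x‖ ≤ 2 * Real.pi * ‖r x‖ + Real.pi * τ.im * (1 + m x) := by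
    intro x t ht
    have h1 : ‖t‖ ≤ δ := by simpa using (mem_ball_zero_iff.1 ht).le
    have h2 : ‖t * ℓ x‖ ≤ δ * (E * (1 + m x)) := by
      rw [norm_mul]; exact mul_le_mul h1 (hD x) (norm_nonneg _) hδ0.le
    have h3 : δ * (E * (1 + m x)) = τ.im / 2 * (1 + m x) := by rw [hδ]; field_simp
    have h4 := norm_add_le (r x) (t * ℓ x)
    rw [h3] at h2
    have h5 := mul_le_mul_of_nonneg_left (h4.trans (add_le_add_right h2 _))
      (show 0 ≤ 2 * Real.pi by positivity)
    refine h5.trans (le_of_eq ?_)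
    ring
  have h := hasDerivAt_tsum_of_isPreconnected (𝕜 := ℂ) hmaj (t := Metric.ball (0 : ℂ) δ)
    (g := fun x t => c x * e (τ * m x + (r x + t * ℓ x)))
    (g' := fun x t => c x * (2 * Real.pi * Complex.I * ℓ x) * e (τ * m x + (r x + t * ℓ x)))
    (y₀ := 0) (y := 0) Metric.isOpen_ball (convex_ball _ _).isPreconnected
    (fun x t _ => by
      have := (hasDerivAt_e (τ * m x + r x) (ℓ x) t).const_mul (c x)
      simp only [← add_assoc]
      refine this.congr_deriv ?_
      ring)
    (fun x t ht => by
      refine (norm_term_le _ _ _ _).trans ?_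
      rw [mul_assoc ‖_‖, ← Real.exp_add]
      refine mul_le_mul_of_nonneg_left (Real.exp_le_exp.2 ?_) (norm_nonneg _)
      have := hbd x t ht
      nlinarith)
    (Metric.mem_ball_self hδ0)
    (by simpa using (summable_expSeries hm hc hr hτ).of_norm)
    (Metric.mem_ball_self hδ0)
  simpa [expSeries] using h

lemma hasDerivAt_expSeries {m : X → ℝ} (hm : ExpTame m) {c r : X → ℂ} (hc : PolyBd m c)
    (hr : LittleBd m r) {τ : ℂ} (hτ : 0 < τ.im) :
    HasDerivAt (expSeries c m r)
      (expSeries (fun x => c x * (2 * Real.pi * Complex.I * m x)) m r τ) τ := by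
  have h := hasDerivAt_expSeries_dir hm hc hr (ℓ := fun x => (m x : ℂ)) (D := 1)
    (fun x => by simp [abs_of_nonneg (hm.1 x)]) hτ
  have h2 : (fun t : ℂ => expSeries c m (fun x => r x + t * m x) τ) =
      fun t => expSeries c m r (τ + t) := by
    funext t; unfold expSeries; congr 1; funext x; congr 2; ring
  rw [h2] at h
  have h3 := HasDerivAt.comp τ (h₂ := fun t => expSeries c m r (τ + t)) (h := fun t => t - τ)
    (h₂' := _) (h' := 1) (by simpa using h) ((hasDerivAt_id τ).sub_const τ)
  simpa [Function.comp_def] using h3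

lemma differentiableOn_expSeries {m : X → ℝ} (hm : ExpTame m) {c r : X → ℂ} (hc : PolyBd m c)
    (hr : LittleBd m r) : DifferentiableOn ℂ (expSeries c m r) {τ | 0 < τ.im} := fun _ hτ =>
  (hasDerivAt_expSeries hm hc hr hτ).differentiableAt.differentiableWithinAt

/-- Moderate growth of an exponential series towards the real axis. -/
lemma norm_expSeries_le {m : X → ℝ} (hm : ExpTame m) {c : X → ℂ} (hc : PolyBd m c) :
    ∃ C : ℝ, ∃ A : ℕ, 0 ≤ C ∧ ∀ τ : ℂ, 0 < τ.im →
      ‖expSeries c m 0 τ‖ ≤ C * (1 + 1 / τ.im) ^ A := by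
  have hpi := Real.pi_pos
  obtain ⟨C, k, hC⟩ := hc
  obtain ⟨h0, D, A, hD⟩ := id hm
  refine ⟨|C| * (k.factorial * Real.exp 1) * |D|, k + A, by positivity, fun τ hτ => ?_⟩
  -- the exponential decay is split evenly between the coefficients and the series
  set ε : ℝ := min 1 τ.im with hε
  have hε0 : 0 < ε := by positivity
  have hε1 : ε ≤ 1 := min_le_left _ _
  have h1 : 1 / ε ≤ 1 + 1 / τ.im := by
    rcases le_total 1 τ.im with h | h
    · rw [hε, min_eq_left h]; have : 0 < 1 / τ.im := by positivity
      linarith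
    · rw [hε, min_eq_right h]; linarith
  obtain ⟨hs, ht⟩ := hD ε hε0 hε1
  have hterm : ∀ x, ‖c x * e (τ * m x + (0 : X → ℂ) x)‖ ≤
      (|C| * (k.factorial / ε ^ k * Real.exp 1)) * Real.exp (-ε * m x) := by
    intro x
    refine (norm_term_le _ _ _ _).trans ?_
    have h2 := one_add_pow_le_exp (h0 x) hε0 k
    have h3 : ‖c x‖ ≤ |C| * (k.factorial / ε ^ k * Real.exp (ε * (1 + m x))) :=
      (hC x).trans (mul_le_mul (le_abs_self C) h2 (by have := h0 x; positivity) (abs_nonneg _))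
    calc _ ≤ |C| * (k.factorial / ε ^ k * Real.exp (ε * (1 + m x))) *
          Real.exp (-(2 * Real.pi * τ.im) * m x) := by
            simp only [Pi.zero_apply, norm_zero, mul_zero, add_zero]; gcongr
      _ = |C| * (k.factorial / ε ^ k) * Real.exp (ε * (1 + m x) + -(2 * Real.pi * τ.im) * m x) := by
            rw [Real.exp_add]; ring
      _ ≤ |C| * (k.factorial / ε ^ k) * Real.exp (1 + -ε * m x) := by
            refine mul_le_mul_of_nonneg_left (Real.exp_le_exp.2 ?_) (by positivity)
            have h4 : 2 * ε ≤ 2 * Real.pi * τ.im := by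
              have : ε ≤ τ.im := min_le_right _ _
              nlinarith [Real.pi_gt_three]
            have := mul_le_mul_of_nonneg_right h4 (h0 x)
            linarith
      _ = _ := by rw [Real.exp_add]; ring
  calc _ ≤ ∑' x, ‖c x * e (τ * m x + (0 : X → ℂ) x)‖ :=
        norm_tsum_le_tsum_norm (summable_expSeries hm ⟨C, k, hC⟩ (LittleBd.zero hm.1) hτ)
    _ ≤ ∑' x, (|C| * (k.factorial / ε ^ k * Real.exp 1)) * Real.exp (-ε * m x) :=
        Summable.tsum_le_tsum hterm (summable_expSeries hm ⟨C, k, hC⟩ (LittleBd.zero hm.1) hτ)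
          (hs.mul_left _)
    _ = (|C| * (k.factorial / ε ^ k * Real.exp 1)) * ∑' x, Real.exp (-ε * m x) := tsum_mul_left
    _ ≤ (|C| * (k.factorial / ε ^ k * Real.exp 1)) * (|D| * (1 / ε) ^ A) := by
        gcongr; exact ht.trans (by gcongr; exact le_abs_self D)
    _ = |C| * (k.factorial * Real.exp 1) * |D| * (1 / ε) ^ (k + A) := by
        rw [pow_add, one_div, inv_pow, inv_pow, div_eq_mul_inv]; ring
    _ ≤ _ := by gcongr

/-- Decay of a series all of whose exponents are at least `M`. -/
lemma norm_expSeries_le_exp {m : X → ℝ} (hm : ExpTame m) {c : X → ℂ} (hc : PolyBd m c) {M : ℝ}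
    (hM : ∀ x, m x < M → c x = 0) :
    ∃ C : ℝ, 0 ≤ C ∧ ∀ τ : ℂ, 1 / 2 ≤ τ.im →
      ‖expSeries c m 0 τ‖ ≤ C * Real.exp (-(2 * Real.pi * M * τ.im)) := by
  have hpi := Real.pi_pos
  have hs := summable_majorant hm hc (LittleBd.zero hm.1) hpi
  refine ⟨Real.exp (Real.pi * M) * ∑' x, ‖c x‖ *
    Real.exp (-Real.pi * m x + 2 * Real.pi * ‖(0 : ℂ)‖),
    by positivity, fun τ hτ => ?_⟩
  have hτ0 : 0 < τ.im := by linarith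
  have h1 := summable_expSeries hm hc (LittleBd.zero hm.1) hτ0
  refine (norm_tsum_le_tsum_norm h1).trans ?_
  rw [mul_right_comm, ← tsum_mul_left]
  refine Summable.tsum_le_tsum (fun x => ?_) h1 (hs.mul_left _)
  refine (norm_term_le _ _ _ _).trans ?_
  by_cases hx : m x < M
  · simp [hM x hx]
  · push Not at hx
    rw [← Real.exp_add, mul_left_comm, ← Real.exp_add]
    refine mul_le_mul_of_nonneg_left (Real.exp_le_exp.2 ?_) (norm_nonneg _)
    simp only [norm_zero, mul_zero, add_zero]
    nlinarith [mul_nonneg (sub_nonneg.2 hx) (mul_nonneg hpi.le (show 0 ≤ 2 * τ.im - 1 by linarith))]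

/-- The Taylor expansion of an exponential series along a line in `z`. -/
lemma hasSum_taylor {m : X → ℝ} (hm : ExpTame m) {c r : X → ℂ} (hc : PolyBd m c)
    (hr : LittleBd m r) {τ : ℂ} (hτ : 0 < τ.im) (t : ℂ) :
    (Summable fun j : ℕ => ‖expSeries (fun x => c x * ((2 * Real.pi * Complex.I * r x) ^ j /
        j.factorial)) m 0 τ * t ^ j‖) ∧
    HasSum (fun j : ℕ => expSeries (fun x => c x * ((2 * Real.pi * Complex.I * r x) ^ j /
        j.factorial)) m 0 τ * t ^ j) (expSeries c m (fun x => t * r x) τ) := by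
  have hpi := Real.pi_pos
  set F : X × ℕ → ℂ := fun p => c p.1 * e (τ * m p.1) *
    ((2 * Real.pi * Complex.I * (t * r p.1)) ^ p.2 / (p.2.factorial : ℂ)) with hF
  have hexp : ∀ x, HasSum (fun j : ℕ => F (x, j)) (c x * e (τ * m x + t * r x)) := by
    intro x
    have h := (NormedSpace.expSeries_div_hasSum_exp (𝔸 := ℂ) (2 * Real.pi * Complex.I * (t * r x)))
    rw [← Complex.exp_eq_exp_ℂ] at h
    have h2 := h.mul_left (c x * e (τ * m x))
    rw [e_add, ← mul_assoc]
    exact h2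
  have hnorm : ∀ x, HasSum (fun j : ℕ => ‖F (x, j)‖)
      (‖c x * e (τ * m x)‖ * Real.exp ‖2 * Real.pi * Complex.I * (t * r x)‖) := by
    intro x
    have h := (NormedSpace.expSeries_div_hasSum_exp (𝔸 := ℝ) ‖2 * Real.pi * Complex.I * (t * r x)‖)
    rw [← Real.exp_eq_exp_ℝ] at h
    refine (h.mul_left _).congr_fun fun j => ?_
    simp [hF]
  have hs : Summable fun p => ‖F p‖ := by
    rw [summable_prod_of_nonneg fun _ => norm_nonneg _]
    refine ⟨fun x => (hnorm x).summable, ?_⟩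
    simp_rw [fun x => (hnorm x).tsum_eq]
    refine (summable_majorant hm hc (hr.smul hm.1 t)
      (show 0 < 2 * Real.pi * τ.im by positivity)).of_nonneg_of_le
      (fun x => by positivity) (fun x => ?_)
    have h1 := norm_term_le (c x) (m x) 0 τ
    have h2 : ‖2 * (Real.pi : ℂ) * Complex.I * (t * r x)‖ = 2 * Real.pi * ‖t * r x‖ := by
      simp [abs_of_pos hpi]
    rw [norm_zero, mul_zero, add_zero, add_zero] at h1
    rw [h2, Real.exp_add, ← mul_assoc]
    gcongr
  have hcol : ∀ j : ℕ, ∑' x, F (x, j) = expSeries (fun x => c x *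
      ((2 * Real.pi * Complex.I * r x) ^ j / j.factorial)) m 0 τ * t ^ j := by
    intro j
    rw [expSeries, ← tsum_mul_right]
    refine tsum_congr fun x => ?_
    simp only [hF, Pi.zero_apply, add_zero]
    rw [show 2 * (Real.pi : ℂ) * Complex.I * (t * r x) =
      (2 * Real.pi * Complex.I * r x) * t by ring,
      mul_pow]
    ring
  have hs' : Summable fun p : ℕ × X => ‖F (p.2, p.1)‖ := hs.prod_symm
  constructor
  · simp_rw [← hcol]
    refine ((summable_prod_of_nonneg fun _ => norm_nonneg _).1 hs').2.of_nonneg_of_le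
      (fun _ => norm_nonneg _) (fun j => ?_)
    exact norm_tsum_le_tsum_norm (hs'.prod_factor j)
  · simp_rw [← hcol]
    have h1 : HasSum F (expSeries c m (fun x => t * r x) τ) := by
      have := hs.of_norm.hasSum
      rwa [hs.of_norm.tsum_prod, tsum_congr fun x => (hexp x).tsum_eq] at this
    have h2 : HasSum (fun p : ℕ × X => F (p.2, p.1)) (expSeries c m (fun x => t * r x) τ) :=
      ((Equiv.prodComm ℕ X).hasSum_iff (f := F)).2 h1
    exact h2.prod_fiberwise fun j => (hs'.of_norm.prod_factor j).hasSum

/-! ### Uniqueness of coefficients -/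

/-- A power series that vanishes on a punctured disc is zero. -/
lemma coeff_eq_zero_of_hasSum_zero {a : ℕ → ℂ} {R : ℝ} (hR : 0 < R)
    (h : ∀ z : ℂ, z ≠ 0 → ‖z‖ < R → HasSum (fun j => a j * z ^ j) 0) (j : ℕ) : a j = 0 := by
  -- it suffices to know the constant term of each such series
  have key : ∀ b : ℕ → ℂ, (∀ z : ℂ, z ≠ 0 → ‖z‖ < R → HasSum (fun j => b j * z ^ j) 0) →
      b 0 = 0 := by
    intro b hb
    have hR2 : ((R / 2 : ℝ) : ℂ) ≠ 0 := by exact_mod_cast (half_pos hR).ne'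
    have hnR : ‖((R / 2 : ℝ) : ℂ)‖ = R / 2 := by
      rw [Complex.norm_real, Real.norm_of_nonneg (half_pos hR).le]
    have hs : Summable fun j => ‖b j * ((R / 2 : ℝ) : ℂ) ^ j‖ :=
      (hb _ hR2 (by rw [hnR]; linarith)).summable.norm
    have hcont : ContinuousOn (fun z : ℂ => ∑' j, b j * z ^ j) (Metric.ball 0 (R / 2)) := by
      refine continuousOn_tsum (fun j => by fun_prop) hs fun j z hz => ?_
      rw [norm_mul, norm_mul, norm_pow, norm_pow, hnR]
      have := (mem_ball_zero_iff.1 hz).le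
      gcongr
    have h0 := (hcont.continuousAt (Metric.ball_mem_nhds 0 (half_pos hR))).tendsto
    have hv : ∑' j, b j * (0 : ℂ) ^ j = b 0 := by
      rw [tsum_eq_single 0 fun j hj => by simp [hj]]; simp
    rw [hv] at h0
    have h1 : Filter.Tendsto (fun z : ℂ => ∑' j, b j * z ^ j) (nhdsWithin 0 {0}ᶜ) (nhds 0) := by
      refine Filter.Tendsto.congr' ?_ tendsto_const_nhds
      filter_upwards [self_mem_nhdsWithin, mem_nhdsWithin_of_mem_nhds
        (Metric.ball_mem_nhds (0 : ℂ) hR)] with z hz hz'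
      exact (hb z hz (mem_ball_zero_iff.1 hz')).tsum_eq.symm
    exact tendsto_nhds_unique (h0.mono_left nhdsWithin_le_nhds) h1
  suffices H : ∀ j, (∀ i < j, a i = 0) → a j = 0 from
    Nat.strong_induction_on j fun j ih => H j ih
  intro j hj
  have := key (fun i => a (i + j)) fun z hz hzR => by
    have h1 := h z hz hzR
    have h2 : HasSum (fun i => a (i + j) * z ^ (i + j)) 0 := by
      rw [hasSum_nat_add_iff (f := fun j => a j * z ^ j) j]
      rw [Finset.sum_eq_zero fun i hi => by rw [hj i (Finset.mem_range.1 hi), zero_mul]]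
      simpa using h1
    have h3 := h2.mul_right ((z ^ j)⁻¹)
    simp only [zero_mul] at h3
    refine h3.congr_fun fun i => ?_
    rw [pow_add]; field_simp
  simpa using this

/-- Grouping an exponential series with natural exponents by the exponent. -/
lemma hasSum_qExpansion {k : X → ℕ} (hm : ExpTame fun x => (k x : ℝ)) {c : X → ℂ}
    (hc : PolyBd (fun x => (k x : ℝ)) c) {τ : ℂ} (hτ : 0 < τ.im) :
    HasSum (fun j : ℕ => (∑' x : k ⁻¹' {j}, c x) * e τ ^ j)
      (expSeries c (fun x => (k x : ℝ)) 0 τ) := by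
  have h := (hasSum_expSeries hm hc (LittleBd.zero hm.1) hτ).tsum_fiberwise k
  refine h.congr_fun fun j => ?_
  rw [← tsum_mul_right]
  refine tsum_congr fun x => ?_
  have hx : k x = j := x.2
  rw [add_zero, mul_comm τ, hx, ← e_nsmul]
  simp

/-- If an exponential series with natural exponents vanishes, so do the sums of its coefficients
over the fibres of the exponent, since `𝔢(τ)` runs through the punctured unit disc. -/
lemma fiber_tsum_eq_zero {k : X → ℕ} (hm : ExpTame fun x => (k x : ℝ)) {c : X → ℂ}
    (hc : PolyBd (fun x => (k x : ℝ)) c)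
    (h : ∀ τ : ℂ, 0 < τ.im → expSeries c (fun x => (k x : ℝ)) 0 τ = 0) (j : ℕ) :
    ∑' x : k ⁻¹' {j}, c x = 0 := by
  refine coeff_eq_zero_of_hasSum_zero (a := fun j => ∑' x : k ⁻¹' {j}, c x) one_pos
    (fun q hq hq1 => ?_) j
  have hpi : (2 * Real.pi * Complex.I : ℂ) ≠ 0 := Complex.two_pi_I_ne_zero
  set τ : ℂ := Complex.log q / (2 * Real.pi * Complex.I) with hτd
  have heτ : e τ = q := by
    rw [e, hτd, mul_div_cancel₀ _ hpi, Complex.exp_log hq]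
  have hτ : 0 < τ.im := by
    have h1 : ‖e τ‖ < 1 := by rw [heτ]; exact hq1
    rw [norm_e, Real.exp_lt_one_iff] at h1
    have := Real.pi_pos
    by_contra hcon
    nlinarith
  have h2 := hasSum_qExpansion hm hc hτ
  rwa [h τ hτ, heτ] at h2

lemma expSeries_eq_zero_of_fiber {k : X → ℕ} (hm : ExpTame fun x => (k x : ℝ)) {c : X → ℂ}
    (hc : PolyBd (fun x => (k x : ℝ)) c) (h : ∀ j, ∑' x : k ⁻¹' {j}, c x = 0)
    {τ : ℂ} (hτ : 0 < τ.im) : expSeries c (fun x => (k x : ℝ)) 0 τ = 0 := by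
  have h1 := hasSum_qExpansion hm hc hτ
  simp only [h, zero_mul] at h1
  exact h1.unique hasSum_zero

/-- Vanishing of the first coefficients gives exponential decay. -/
lemma norm_expSeries_le_of_fiber {k : X → ℕ} (hm : ExpTame fun x => (k x : ℝ)) {c : X → ℂ}
    (hc : PolyBd (fun x => (k x : ℝ)) c) {M : ℕ} (h : ∀ j ≤ M, ∑' x : k ⁻¹' {j}, c x = 0) :
    ∃ C : ℝ, 0 ≤ C ∧ ∀ τ : ℂ, 1 / 2 ≤ τ.im → ‖expSeries c (fun x => (k x : ℝ)) 0 τ‖ ≤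
      C * Real.exp (-(2 * Real.pi * (M + 1) * τ.im)) := by
  classical
  -- dropping the terms with exponent at most `M` does not change the sum of the series
  set c' : X → ℂ := fun x => if M < k x then c x else 0 with hc'
  have hcb : PolyBd (fun x => (k x : ℝ)) c' := by
    obtain ⟨C, A, hC⟩ := hc
    refine ⟨C, A, fun x => ?_⟩
    by_cases hx : M < k x
    · simpa [hc', hx] using hC x
    · simpa [hc', hx] using (norm_nonneg _).trans (hC x)
  obtain ⟨C, hC0, hC⟩ := norm_expSeries_le_exp hm hcb (M := M + 1) fun x hx => by
    have : k x < M + 1 := by exact_mod_cast hx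
    simp [hc', show ¬ M < k x by omega]
  refine ⟨C, hC0, fun τ hτ => ?_⟩
  have hτ0 : 0 < τ.im := by linarith
  have h1 := hasSum_qExpansion hm hc hτ0
  have h2 := hasSum_qExpansion hm hcb hτ0
  have h3 : ∀ j, ∑' x : k ⁻¹' {j}, c' x = ∑' x : k ⁻¹' {j}, c x := by
    intro j
    by_cases hj : j ≤ M
    · rw [h j hj]
      convert tsum_zero with x
      have hx : k x = j := x.2
      simp [hc', hx, show ¬ M < j by omega]
    · refine tsum_congr fun x => ?_
      have hx : k x = j := x.2
      simp [hc', hx, show M < j by omega]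
  simp only [h3] at h2
  rw [h1.unique h2]
  exact hC τ hτ

/-! ### The number of cosets of `Γ₁(N)` -/

/-- The unimodular pairs of elements of a commutative ring. -/
abbrev UnimodularPair (R : Type*) [CommRing R] : Type _ := {x : R × R // IsCoprime x.1 x.2}

lemma isCoprime_prod_iff {R S : Type*} [CommRing R] [CommRing S] (x y : R × S) :
    IsCoprime x y ↔ IsCoprime x.1 y.1 ∧ IsCoprime x.2 y.2 := by
  constructor
  · rintro ⟨a, b, h⟩
    exact ⟨⟨a.1, b.1, congrArg Prod.fst h⟩, ⟨a.2, b.2, congrArg Prod.snd h⟩⟩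
  · rintro ⟨⟨a, b, h⟩, ⟨a', b', h'⟩⟩
    exact ⟨(a, a'), (b, b'), Prod.ext h h'⟩

lemma card_unimodularPair_congr {R S : Type*} [CommRing R] [CommRing S] (f : R ≃+* S) :
    Nat.card (UnimodularPair R) = Nat.card (UnimodularPair S) := by
  refine Nat.card_congr (Equiv.subtypeEquiv (Equiv.prodCongr f.toEquiv f.toEquiv) fun x => ?_)
  constructor
  · intro h; exact h.map f.toRingHom
  · intro h
    have := h.map f.symm.toRingHom
    simpa using this

lemma card_unimodularPair_prod (R S : Type*) [CommRing R] [CommRing S] :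
    Nat.card (UnimodularPair (R × S)) =
      Nat.card (UnimodularPair R) * Nat.card (UnimodularPair S) := by
  rw [← Nat.card_prod]
  refine Nat.card_congr
    { toFun := fun x => (⟨(x.1.1.1, x.1.2.1), ((isCoprime_prod_iff _ _).1 x.2).1⟩,
        ⟨(x.1.1.2, x.1.2.2), ((isCoprime_prod_iff _ _).1 x.2).2⟩)
      invFun := fun y => ⟨((y.1.1.1, y.2.1.1), (y.1.1.2, y.2.1.2)),
        (isCoprime_prod_iff _ _).2 ⟨y.1.2, y.2.2⟩⟩
      left_inv := fun x => rfl
      right_inv := fun y => rfl }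

/-- A pair is not unimodular precisely when both entries are divisible by `p`. -/
lemma card_unimodularPair_prime_pow {p n : ℕ} (hp : p.Prime) (hn : 0 < n) :
    (Nat.card (UnimodularPair (ZMod (p ^ n))) : ℚ) =
      ((p ^ n : ℕ) : ℚ) ^ 2 * (1 - 1 / (p : ℚ) ^ 2) := by
  classical
  have : Fact p.Prime := ⟨hp⟩
  have : NeZero (p ^ n) := ⟨pow_ne_zero _ hp.ne_zero⟩
  have hdvd : ∀ x : ZMod (p ^ n), ¬ IsUnit x → (p : ZMod (p ^ n)) ∣ x := by
    intro x hx
    rw [← ZMod.natCast_zmod_val x, ZMod.isUnit_natCast_iff_not_dvd_pow hp hn, not_not] at hx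
    obtain ⟨k, hk⟩ := hx
    exact ⟨k, by rw [← ZMod.natCast_zmod_val x, hk]; push_cast; rfl⟩
  have hiff : ∀ x : ZMod (p ^ n) × ZMod (p ^ n),
      ¬ IsCoprime x.1 x.2 ↔ ¬ IsUnit x.1 ∧ ¬ IsUnit x.2 := by
    intro x
    constructor
    · intro h
      refine ⟨fun ⟨u, hu⟩ => h ⟨(u⁻¹ : (ZMod (p ^ n))ˣ), 0, by simp [← hu]⟩,
        fun ⟨u, hu⟩ => h ⟨0, (u⁻¹ : (ZMod (p ^ n))ˣ), by simp [← hu]⟩⟩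
    · rintro ⟨h1, h2⟩ ⟨a, b, hab⟩
      have h3 : IsUnit (p : ZMod (p ^ n)) := by
        refine isUnit_of_dvd_one (hab ▸ dvd_add ?_ ?_)
        · exact (hdvd _ h1).mul_left a
        · exact (hdvd _ h2).mul_left b
      rw [ZMod.isUnit_natCast_iff_not_dvd_pow hp hn] at h3
      exact h3 dvd_rfl
  have hnon : Fintype.card {x : ZMod (p ^ n) // ¬ IsUnit x} = p ^ (n - 1) := by
    rw [Fintype.card_subtype_compl, ZMod.card]
    have : Fintype.card {x : ZMod (p ^ n) // IsUnit x} = Nat.totient (p ^ n) := by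
      rw [← ZMod.card_units_eq_totient]
      refine Fintype.card_congr
        { toFun := fun x => x.2.unit
          invFun := fun u => ⟨u, u.isUnit⟩
          left_inv := fun x => by simp
          right_inv := fun u => by ext; simp }
    rw [this, Nat.totient_prime_pow hp hn]
    obtain ⟨k, rfl⟩ : ∃ k, n = k + 1 := ⟨n - 1, by omega⟩
    obtain ⟨r, hr⟩ : ∃ r, p = r + 1 := ⟨p - 1, by have := hp.pos; omega⟩
    simp only [Nat.add_sub_cancel, pow_succ]
    rw [← Nat.mul_sub, show p - (p - 1) = 1 by omega, mul_one]
  have hcompl : Fintype.card {x : ZMod (p ^ n) × ZMod (p ^ n) // ¬ IsCoprime x.1 x.2} =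
      p ^ (n - 1) * p ^ (n - 1) := by
    rw [Fintype.card_congr ((Equiv.subtypeEquivRight hiff).trans
      (Equiv.subtypeProdEquivProd (p := fun x => ¬ IsUnit x) (q := fun x => ¬ IsUnit x))),
      Fintype.card_prod, hnon]
  have htot : Nat.card (UnimodularPair (ZMod (p ^ n))) + p ^ (n - 1) * p ^ (n - 1) =
      p ^ n * p ^ n := by
    rw [← hcompl, Nat.card_eq_fintype_card, ← Fintype.card_sum,
      Fintype.card_congr (Equiv.sumCompl fun x : ZMod (p ^ n) × ZMod (p ^ n) =>
        IsCoprime x.1 x.2), Fintype.card_prod, ZMod.card]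
  have h0 : (p : ℚ) ≠ 0 := by exact_mod_cast hp.ne_zero
  obtain ⟨k, rfl⟩ : ∃ k, n = k + 1 := ⟨n - 1, by omega⟩
  have htot' : (Nat.card (UnimodularPair (ZMod (p ^ (k + 1)))) : ℚ) + (p : ℚ) ^ k * (p : ℚ) ^ k =
      (p : ℚ) ^ (k + 1) * (p : ℚ) ^ (k + 1) := by exact_mod_cast htot
  rw [eq_sub_of_add_eq htot']
  push_cast
  field_simp
  ring

lemma card_unimodularPair_zmod (N : ℕ) (hN : 0 < N) :
    (Nat.card (UnimodularPair (ZMod N)) : ℚ) =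
      (N : ℚ) ^ 2 * ∏ l ∈ N.primeFactors, (1 - 1 / (l : ℚ) ^ 2) := by
  induction N using Nat.recOnPosPrimePosCoprime with
  | prime_pow p n hp hn =>
    rw [card_unimodularPair_prime_pow hp hn, Nat.primeFactors_prime_pow hn.ne' hp,
      Finset.prod_singleton]
  | zero => omega
  | one =>
    have : Nat.card (UnimodularPair (ZMod 1)) = 1 := by
      rw [Nat.card_eq_one_iff_unique]
      refine ⟨⟨fun a b => Subtype.ext (Subsingleton.elim _ _)⟩, ⟨⟨(0, 0), 0, 0, ?_⟩⟩⟩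
      exact Subsingleton.elim _ _
    simp [this]
  | coprime a b ha hb hab iha ihb =>
    rw [card_unimodularPair_congr (ZMod.chineseRemainder hab), card_unimodularPair_prod,
      hab.primeFactors_mul, Finset.prod_union hab.disjoint_primeFactors]
    push_cast
    rw [iha (by omega), ihb (by omega)]
    ring

lemma sl_mul_apply (g h : SL(2, ℤ)) (i j : Fin 2) :
    (g * h) i j = g i 0 * h 0 j + g i 1 * h 1 j := by
  rw [Matrix.SpecialLinearGroup.coe_mul, Matrix.mul_apply, Fin.sum_univ_two]

lemma sl_inv_apply (g : SL(2, ℤ)) : g⁻¹ 0 0 = g 1 1 ∧ g⁻¹ 0 1 = -g 0 1 ∧ g⁻¹ 1 0 = -g 1 0 ∧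
    g⁻¹ 1 1 = g 0 0 := by
  simp [Matrix.SpecialLinearGroup.SL2_inv_expl]

lemma sl_det (g : SL(2, ℤ)) : g 0 0 * g 1 1 - g 0 1 * g 1 0 = 1 := by
  have := g.det_coe
  rwa [Matrix.det_fin_two] at this

/-- A coset of `Γ₁(N)` is determined by the lower row of the inverse of a representative. -/
lemma card_quotient_gamma1_le (N : ℕ) (hN : 0 < N) :
    (Nat.card (SL(2, ℤ) ⧸ CongruenceSubgroup.Gamma1 N) : ℚ) ≤
      (N : ℚ) ^ 2 * ∏ l ∈ N.primeFactors, (1 - 1 / (l : ℚ) ^ 2) := by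
  have : NeZero N := ⟨hN.ne'⟩
  rw [← card_unimodularPair_zmod N hN]
  have hdet : ∀ g : SL(2, ℤ),
      ((g 0 0 : ℤ) : ZMod N) * (g 1 1 : ℤ) - (g 0 1 : ℤ) * (g 1 0 : ℤ) = 1 := by
    intro g
    exact_mod_cast congrArg (Int.cast : ℤ → ZMod N) (sl_det g)
  -- the lower row of `g⁻¹` is `(-c, a)`
  set φ : SL(2, ℤ) ⧸ CongruenceSubgroup.Gamma1 N → UnimodularPair (ZMod N) := fun q =>
    ⟨(((-(q.out 1 0) : ℤ) : ZMod N), ((q.out 0 0 : ℤ) : ZMod N)),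
      ⟨((q.out 0 1 : ℤ) : ZMod N), ((q.out 1 1 : ℤ) : ZMod N), by
        have := hdet q.out
        push_cast
        linear_combination this⟩⟩ with hφ
  have hinj : Function.Injective φ := by
    intro q q' h
    have h1 : ((q.out 1 0 : ℤ) : ZMod N) = ((q'.out 1 0 : ℤ) : ZMod N) := by
      have := congrArg (fun x => x.1.1) h
      simpa [hφ] using this
    have h2 : ((q.out 0 0 : ℤ) : ZMod N) = ((q'.out 0 0 : ℤ) : ZMod N) :=
      congrArg (fun x => x.1.2) h
    rw [← QuotientGroup.out_eq' q, ← QuotientGroup.out_eq' q', QuotientGroup.eq,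
      CongruenceSubgroup.Gamma1_mem]
    have hq := hdet q.out
    have hq' := hdet q'.out
    have e00 : ((q.out⁻¹ * q'.out) 0 0 : ℤ) = q.out 1 1 * q'.out 0 0 - q.out 0 1 * q'.out 1 0 := by
      rw [sl_mul_apply]; simp only [sl_inv_apply]; ring
    have e10 : ((q.out⁻¹ * q'.out) 1 0 : ℤ) = -q.out 1 0 * q'.out 0 0 + q.out 0 0 * q'.out 1 0 := by
      rw [sl_mul_apply]; simp only [sl_inv_apply]
    have e11 : ((q.out⁻¹ * q'.out) 1 1 : ℤ) = -q.out 1 0 * q'.out 0 1 + q.out 0 0 * q'.out 1 1 := by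
      rw [sl_mul_apply]; simp only [sl_inv_apply]
    rw [e00, e10, e11]
    push_cast
    rw [← h1, ← h2] at *
    refine ⟨by linear_combination hq, by linear_combination hq', by ring⟩
  have : Finite (UnimodularPair (ZMod N)) := Subtype.finite
  exact_mod_cast Nat.card_le_card_of_injective φ hinj

/-! ### Möbius transformations -/

/-- The automorphy factor `cτ + d`. -/
def autJ (γ : SL(2, ℤ)) (τ : ℂ) : ℂ := (γ 1 0 : ℂ) * τ + (γ 1 1 : ℂ)

/-- The Möbius transformation `(aτ + b) / (cτ + d)`, as a function on `ℂ`. -/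
def moeb (γ : SL(2, ℤ)) (τ : ℂ) : ℂ := ((γ 0 0 : ℂ) * τ + (γ 0 1 : ℂ)) / autJ γ τ

lemma sl_det_complex (g : SL(2, ℤ)) : (g 0 0 : ℂ) * g 1 1 - g 0 1 * g 1 0 = 1 := by
  exact_mod_cast congrArg (Int.cast : ℤ → ℂ) (sl_det g)

lemma coe_smul_eq_moeb (γ : SL(2, ℤ)) (τ : ℍ) : ((γ • τ : ℍ) : ℂ) = moeb γ τ := by
  rw [UpperHalfPlane.coe_specialLinearGroup_apply]
  simp [moeb, autJ]

lemma denom_eq_autJ (γ : SL(2, ℤ)) (τ : ℍ) : UpperHalfPlane.denom γ τ = autJ γ τ := by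
  rw [ModularGroup.denom_apply, autJ]

lemma autJ_ne_zero (γ : SL(2, ℤ)) {τ : ℂ} (hτ : 0 < τ.im) : autJ γ τ ≠ 0 := by
  have := UpperHalfPlane.denom_ne_zero γ ⟨τ, hτ⟩
  rwa [denom_eq_autJ] at this

lemma moeb_im (γ : SL(2, ℤ)) {τ : ℂ} (hτ : 0 < τ.im) :
    (moeb γ τ).im = τ.im / ‖autJ γ τ‖ ^ 2 := by
  have := ModularGroup.im_smul_eq_div_normSq γ ⟨τ, hτ⟩
  rw [denom_eq_autJ, Complex.normSq_eq_norm_sq, ← UpperHalfPlane.coe_im, coe_smul_eq_moeb] at this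
  exact this

lemma moeb_im_pos (γ : SL(2, ℤ)) {τ : ℂ} (hτ : 0 < τ.im) : 0 < (moeb γ τ).im := by
  rw [moeb_im γ hτ]
  have := norm_pos_iff.2 (autJ_ne_zero γ hτ)
  positivity

lemma autJ_mul (γ δ : SL(2, ℤ)) {τ : ℂ} (hτ : 0 < τ.im) :
    autJ (γ * δ) τ = autJ γ (moeb δ τ) * autJ δ τ := by
  have h := autJ_ne_zero δ hτ
  rw [autJ, autJ, moeb, sl_mul_apply, sl_mul_apply, add_mul, mul_assoc, div_mul_cancel₀ _ h, autJ]
  push_cast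
  ring

lemma moeb_mul (γ δ : SL(2, ℤ)) {τ : ℂ} (hτ : 0 < τ.im) :
    moeb (γ * δ) τ = moeb γ (moeb δ τ) := by
  have h := autJ_ne_zero δ hτ
  have h' := autJ_ne_zero γ (moeb_im_pos δ hτ)
  rw [moeb, moeb, autJ_mul γ δ hτ, div_eq_div_iff (mul_ne_zero h' h) h', moeb, sl_mul_apply,
    sl_mul_apply]
  push_cast
  have : ((γ 0 0 : ℂ) * (((δ 0 0 : ℂ) * τ + δ 0 1) / autJ δ τ) + γ 0 1) * autJ δ τ =
      (γ 0 0 * δ 0 0 + γ 0 1 * δ 1 0) * τ + (γ 0 0 * δ 0 1 + γ 0 1 * δ 1 1) := by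
    rw [add_mul, mul_assoc, div_mul_cancel₀ _ h, autJ]; ring
  rw [← this]; ring

lemma moeb_one (τ : ℂ) : moeb 1 τ = τ := by simp [moeb, autJ]

lemma hasDerivAt_autJ (γ : SL(2, ℤ)) (τ : ℂ) : HasDerivAt (autJ γ) (γ 1 0 : ℂ) τ := by
  have := ((hasDerivAt_id τ).const_mul (γ 1 0 : ℂ)).add_const (γ 1 1 : ℂ)
  rw [mul_one] at this
  exact this

lemma hasDerivAt_moeb (γ : SL(2, ℤ)) {τ : ℂ} (hτ : 0 < τ.im) :
    HasDerivAt (moeb γ) (1 / autJ γ τ ^ 2) τ := by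
  have h := autJ_ne_zero γ hτ
  have h1 : HasDerivAt (fun τ : ℂ => (γ 0 0 : ℂ) * τ + γ 0 1) (γ 0 0 : ℂ) τ := by
    simpa using ((hasDerivAt_id τ).const_mul (γ 0 0 : ℂ)).add_const (γ 0 1 : ℂ)
  refine (h1.div (hasDerivAt_autJ γ τ) h).congr_deriv ?_
  congr 1
  rw [autJ]
  linear_combination sl_det_complex γ

lemma isOpen_upper : IsOpen {τ : ℂ | 0 < τ.im} := isOpen_lt continuous_const Complex.continuous_im

lemma isPreconnected_upper : IsPreconnected {τ : ℂ | 0 < τ.im} :=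
  (convex_halfSpace_im_gt 0).isPreconnected

/-! ### The Sturm bound -/

/-- The discriminant `Δ` as a function on `ℂ`. -/
def discr (τ : ℂ) : ℂ := ModularForm.eta τ ^ 24

lemma discr_ne_zero {τ : ℂ} (hτ : 0 < τ.im) : discr τ ≠ 0 :=
  ModularForm.discriminant_ne_zero ⟨τ, hτ⟩

lemma discr_moeb (γ : SL(2, ℤ)) {τ : ℂ} (hτ : 0 < τ.im) :
    discr (moeb γ τ) = autJ γ τ ^ 12 * discr τ := by
  have h := congrFun (SlashInvariantForm.slash_action_generators_SL2Z
    ModularForm.discriminant_S_invariant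
    ModularForm.discriminant_T_invariant γ) ⟨τ, hτ⟩
  rw [ModularForm.SL_slash_apply, denom_eq_autJ] at h
  have h1 : discr (moeb γ τ) = ModularForm.discriminant (γ • (⟨τ, hτ⟩ : ℍ)) := by
    rw [ModularForm.discriminant, coe_smul_eq_moeb]; rfl
  have h2 : discr τ = ModularForm.discriminant (⟨τ, hτ⟩ : ℍ) := rfl
  have h0 := autJ_ne_zero γ hτ
  rw [h1, h2, ← h]
  simp only [zpow_neg]
  rw [mul_comm _ (_)⁻¹, ← mul_assoc, show autJ γ ((⟨τ, hτ⟩ : ℍ) : ℂ) = autJ γ τ from rfl,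
    show (autJ γ τ ^ (12 : ℤ)) = autJ γ τ ^ 12 from zpow_ofNat _ _,
    mul_inv_cancel₀ (pow_ne_zero _ h0),
    one_mul]

lemma differentiableOn_discr : DifferentiableOn ℂ discr {τ | 0 < τ.im} := fun _ hτ =>
  ((ModularForm.differentiableAt_eta_of_mem_upperHalfPlaneSet hτ).pow 24).differentiableWithinAt

/-- The discriminant vanishes at most to first order at the cusp. -/
lemma exists_exp_le_discr : ∃ C Y : ℝ, 0 < C ∧ 0 < Y ∧ ∀ τ : ℂ, Y ≤ τ.im →
    Real.exp (-(2 * Real.pi * τ.im)) ≤ C * ‖discr τ‖ := by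
  obtain ⟨C, hC, h⟩ := ModularForm.exp_isBigO_discriminant.exists_pos
  rw [Asymptotics.IsBigOWith, UpperHalfPlane.atImInfty, Filter.eventually_comap,
    Filter.eventually_atTop] at h
  obtain ⟨Y, hY⟩ := h
  refine ⟨C, max Y 1, hC, by positivity, fun τ hτ => ?_⟩
  have h0 : 0 < τ.im := lt_of_lt_of_le (by positivity) hτ
  have := hY τ.im ((le_max_left _ _).trans hτ) ⟨τ, h0⟩ rfl
  rw [Real.norm_of_nonneg (Real.exp_pos _).le] at this
  convert this using 2
  · simp
  · rfl

/-- If a finite product of analytic functions on a connected open set vanishes identically, so does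
one of the factors. -/
lemma exists_eq_zero_of_prod_eq_zero {ι : Type*} (s : Finset ι) {U : Set ℂ} (hU : IsOpen U)
    (hc : IsPreconnected U) (hne : U.Nonempty) {F : ι → ℂ → ℂ}
    (hF : ∀ i ∈ s, DifferentiableOn ℂ (F i) U)
    (h : ∀ z ∈ U, ∏ i ∈ s, F i z = 0) : ∃ i ∈ s, ∀ z ∈ U, F i z = 0 := by
  classical
  induction s using Finset.induction_on with
  | empty => obtain ⟨z, hz⟩ := hne; simpa using h z hz
  | insert a s ha ih =>
    simp only [Finset.prod_insert ha] at h
    have h1 : DifferentiableOn ℂ (fun z => ∏ i ∈ s, F i z) U :=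
      DifferentiableOn.fun_finsetProd fun i hi => hF i (Finset.mem_insert_of_mem hi)
    rcases AnalyticOnNhd.eq_zero_or_eq_zero_of_mul_eq_zero
      ((hF a (Finset.mem_insert_self _ _)).analyticOnNhd hU) (h1.analyticOnNhd hU) h hc with h2 | h2
    · exact ⟨a, Finset.mem_insert_self _ _, h2⟩
    · obtain ⟨i, hi, h3⟩ := ih (fun i hi => hF i (Finset.mem_insert_of_mem hi)) h2
      exact ⟨i, Finset.mem_insert_of_mem hi, h3⟩

/-- The standard fundamental domain is contained in the half strip `|x| ≤ 1 / 2`, `1 / 2 ≤ y`. -/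
lemma exists_moeb_mem_strip {τ : ℂ} (hτ : 0 < τ.im) :
    ∃ γ : SL(2, ℤ), |(moeb γ τ).re| ≤ 1 / 2 ∧ 1 / 2 ≤ (moeb γ τ).im := by
  obtain ⟨γ, hγ⟩ := ModularGroup.exists_smul_mem_fd ⟨τ, hτ⟩
  refine ⟨γ, ?_, ?_⟩
  · have := hγ.2
    rwa [← UpperHalfPlane.coe_re, coe_smul_eq_moeb] at this
  · have h1 := ModularGroup.three_le_four_mul_im_sq_of_mem_fd hγ
    have h2 := (γ • (⟨τ, hτ⟩ : ℍ)).im_pos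
    rw [← UpperHalfPlane.coe_im, coe_smul_eq_moeb] at h1 h2
    by_contra hcon
    push Not at hcon
    nlinarith

/-- A holomorphic function on the upper half plane whose absolute value is `SL₂(ℤ)`-invariant and
tends to `0` at the cusp is zero, by the maximum modulus principle. -/
lemma eq_zero_of_norm_invariant {R : ℂ → ℂ} (hR : DifferentiableOn ℂ R {τ | 0 < τ.im})
    (hinv : ∀ (γ : SL(2, ℤ)) (τ : ℂ), 0 < τ.im → ‖R (moeb γ τ)‖ = ‖R τ‖)
    (hlim : ∀ ε > 0, ∃ Y : ℝ, ∀ τ : ℂ, |τ.re| ≤ 1 / 2 → Y ≤ τ.im → ‖R τ‖ < ε)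
    {τ₀ : ℂ} (hτ₀ : 0 < τ₀.im) : R τ₀ = 0 := by
  by_contra hne
  obtain ⟨Y, hY⟩ := hlim _ (norm_pos_iff.2 hne)
  set K : Set ℂ := Set.Icc (-(1 / 2)) (1 / 2) ×ℂ Set.Icc (1 / 2) (max Y 1) with hK
  have hKc : IsCompact K := isCompact_Icc.reProdIm isCompact_Icc
  have hKU : K ⊆ {τ | 0 < τ.im} := fun z hz => by
    have : 1 / 2 ≤ z.im := hz.2.1
    show 0 < z.im
    linarith
  have hKne : K.Nonempty := ⟨Complex.I, by
    refine ⟨⟨by norm_num, by norm_num⟩, ⟨by norm_num, by simp⟩⟩⟩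
  obtain ⟨c, hcK, hcmax⟩ := hKc.exists_isMaxOn hKne (hR.continuousOn.mono hKU).norm
  have hred : ∀ τ : ℂ, 0 < τ.im → ‖R τ₀‖ ≤ ‖R τ‖ → ‖R τ‖ ≤ ‖R c‖ := by
    intro τ hτ hle
    obtain ⟨γ, h1, h2⟩ := exists_moeb_mem_strip hτ
    rw [← hinv γ τ hτ] at hle ⊢
    refine hcmax ⟨abs_le.1 h1, h2, ?_⟩
    by_contra hcon
    have : max Y 1 < (moeb γ τ).im := not_le.1 hcon
    have := hY _ h1 ((le_max_left _ _).trans this.le)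
    linarith
  have h0 := hred τ₀ hτ₀ le_rfl
  have hmax : IsMaxOn (norm ∘ R) {τ | 0 < τ.im} c := by
    intro τ hτ
    simp only [Function.comp_apply, Set.mem_ofPred_eq]
    rcases le_total ‖R τ₀‖ ‖R τ‖ with h | h
    · exact hred τ hτ h
    · exact h.trans h0
  have hconst := Complex.norm_eqOn_of_isPreconnected_of_isMaxOn isPreconnected_upper isOpen_upper
    hR (hKU hcK) hmax
  have hz : 0 < ((max Y 1 : ℝ) * Complex.I).im := by simp
  have h1 := hconst hz
  simp only [Function.comp_apply, Function.const_apply] at h1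
  have h2 := hY ((max Y 1 : ℝ) * Complex.I) (by simp) (by simp)
  linarith

/-- The function `g(γτ)² / (cτ + d)^κ`. -/
def slashSq (g : ℂ → ℂ) (κ : ℕ) (γ : SL(2, ℤ)) (τ : ℂ) : ℂ := g (moeb γ τ) ^ 2 / autJ γ τ ^ κ

lemma slashSq_moeb (g : ℂ → ℂ) (κ : ℕ) (γ δ : SL(2, ℤ)) {τ : ℂ} (hτ : 0 < τ.im) :
    slashSq g κ γ (moeb δ τ) = slashSq g κ (γ * δ) τ * autJ δ τ ^ κ := by
  have h1 := autJ_ne_zero γ (moeb_im_pos δ hτ)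
  have h2 := autJ_ne_zero δ hτ
  rw [slashSq, slashSq, moeb_mul γ δ hτ, autJ_mul γ δ hτ, mul_pow]
  field_simp

lemma norm_slashSq_mul {g : ℂ → ℂ} {κ : ℕ} {η : SL(2, ℤ)}
    (hη : ∀ τ : ℂ, 0 < τ.im → ‖g (moeb η τ)‖ ^ 2 = ‖autJ η τ‖ ^ κ * ‖g τ‖ ^ 2)
    (γ : SL(2, ℤ)) {τ : ℂ} (hτ : 0 < τ.im) : ‖slashSq g κ (η * γ) τ‖ = ‖slashSq g κ γ τ‖ := by
  have h1 := norm_ne_zero_iff.2 (autJ_ne_zero η (moeb_im_pos γ hτ))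
  have h2 := norm_ne_zero_iff.2 (autJ_ne_zero γ hτ)
  rw [slashSq, slashSq, moeb_mul η γ hτ, autJ_mul η γ hτ]
  simp only [norm_div, norm_pow, norm_mul, mul_pow, hη _ (moeb_im_pos γ hτ)]
  field_simp

lemma differentiableOn_slashSq {g : ℂ → ℂ} (hg : DifferentiableOn ℂ g {τ | 0 < τ.im}) (κ : ℕ)
    (γ : SL(2, ℤ)) : DifferentiableOn ℂ (slashSq g κ γ) {τ | 0 < τ.im} := by
  intro τ hτ
  have h1 : DifferentiableAt ℂ g (moeb γ τ) :=
    hg.differentiableAt (isOpen_upper.mem_nhds (moeb_im_pos γ hτ))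
  have h2 : DifferentiableAt ℂ (fun τ => g (moeb γ τ)) τ :=
    DifferentiableAt.comp τ h1 (hasDerivAt_moeb γ hτ).differentiableAt
  exact ((h2.pow 2).div ((hasDerivAt_autJ γ τ).differentiableAt.pow κ)
    (pow_ne_zero _ (autJ_ne_zero γ hτ))).differentiableWithinAt

/-- At each cusp a function of moderate growth has at most polynomial growth. -/
lemma norm_slashSq_le {g : ℂ → ℂ} {C : ℝ} {A : ℕ} (hC : 0 ≤ C)
    (hg : ∀ τ : ℂ, 0 < τ.im → ‖g τ‖ ≤ C * (1 + 1 / τ.im) ^ A) (κ : ℕ) (γ : SL(2, ℤ)) :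
    ∃ D : ℝ, 0 ≤ D ∧ ∀ τ : ℂ, |τ.re| ≤ 1 / 2 → 1 / 2 ≤ τ.im →
      ‖slashSq g κ γ τ‖ ≤ D * τ.im ^ (2 * A) := by
  -- on the strip, `1 / 2 ≤ |cτ + d| ≤ B y`
  set B : ℝ := 2 * |(γ 1 0 : ℝ)| + 2 * |(γ 1 1 : ℝ)| with hB
  refine ⟨C ^ 2 * (2 + B ^ 2) ^ (2 * A) * 2 ^ κ, by positivity, fun τ h1 h2 => ?_⟩
  have hτ : 0 < τ.im := by linarith
  have hJ0 := norm_pos_iff.2 (autJ_ne_zero γ hτ)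
  have hup : ‖autJ γ τ‖ ≤ B * τ.im := by
    have h3 : ‖τ‖ ≤ 2 * τ.im := by
      refine (Complex.norm_le_abs_re_add_abs_im τ).trans ?_
      rw [abs_of_pos hτ]; linarith
    calc ‖autJ γ τ‖ ≤ |(γ 1 0 : ℝ)| * ‖τ‖ + |(γ 1 1 : ℝ)| := by
          refine (norm_add_le _ _).trans ?_
          rw [norm_mul, Complex.norm_intCast, Complex.norm_intCast]
      _ ≤ |(γ 1 0 : ℝ)| * (2 * τ.im) + |(γ 1 1 : ℝ)| * (2 * τ.im) := by
          have := abs_nonneg (γ 1 1 : ℝ)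
          gcongr
          nlinarith
      _ = _ := by rw [hB]; ring
  have hlow : 1 / 2 ≤ ‖autJ γ τ‖ := by
    by_cases hc : γ 1 0 = 0
    · have hd : γ 1 1 ≠ 0 := by
        intro hd
        have := sl_det γ
        rw [hc, hd] at this
        simp at this
      have h3 : (1 : ℝ) ≤ |(γ 1 1 : ℝ)| := by exact_mod_cast Int.one_le_abs hd
      rw [autJ, hc]
      simp only [Int.cast_zero, zero_mul, zero_add, Complex.norm_intCast]
      linarith
    · have h3 : (1 : ℝ) ≤ |(γ 1 0 : ℝ)| := by exact_mod_cast Int.one_le_abs hc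
      have h4 := Complex.abs_im_le_norm (autJ γ τ)
      have h5 : (autJ γ τ).im = (γ 1 0 : ℝ) * τ.im := by simp [autJ]
      rw [h5, abs_mul, abs_of_pos hτ] at h4
      nlinarith
  have h3 := hg _ (moeb_im_pos γ hτ)
  have h4 : 1 + 1 / (moeb γ τ).im ≤ (2 + B ^ 2) * τ.im := by
    rw [moeb_im γ hτ, one_div_div]
    have : ‖autJ γ τ‖ ^ 2 / τ.im ≤ B ^ 2 * τ.im := by
      rw [div_le_iff₀ hτ]
      calc _ ≤ (B * τ.im) ^ 2 := by gcongr
        _ = _ := by ring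
    linarith
  have h5 : 0 ≤ 1 + 1 / (moeb γ τ).im := by have := moeb_im_pos γ hτ; positivity
  rw [slashSq, norm_div, norm_pow, norm_pow, div_le_iff₀ (by positivity)]
  have h6 : (1 : ℝ) ≤ 2 ^ κ * ‖autJ γ τ‖ ^ κ := by
    rw [← mul_pow]; exact one_le_pow₀ (by linarith)
  calc ‖g (moeb γ τ)‖ ^ 2 ≤ (C * ((2 + B ^ 2) * τ.im) ^ A) ^ 2 := by
        gcongr; exact h3.trans (by gcongr)
    _ = (C ^ 2 * (2 + B ^ 2) ^ (2 * A) * τ.im ^ (2 * A)) * 1 := by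
        rw [mul_pow, ← pow_mul, mul_pow, mul_comm A 2]; ring
    _ ≤ (C ^ 2 * (2 + B ^ 2) ^ (2 * A) * τ.im ^ (2 * A)) * (2 ^ κ * ‖autJ γ τ‖ ^ κ) := by
        gcongr
    _ = _ := by ring

lemma tendsto_pow_mul_exp_neg (D : ℝ) (A : ℕ) {c : ℝ} (hc : 0 < c) :
    Filter.Tendsto (fun y : ℝ => D * (y ^ A * Real.exp (-(c * y)))) Filter.atTop (nhds 0) := by
  have h := (Real.tendsto_pow_mul_exp_neg_atTop_nhds_zero A).comp
    (Filter.tendsto_id.const_mul_atTop hc)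
  have h2 := (h.const_mul (D * (c ^ A)⁻¹))
  rw [mul_zero] at h2
  refine h2.congr fun y => ?_
  simp only [Function.comp_apply, id, mul_pow]
  field_simp

/-- The decay of `G ^ 12 / d ^ k`, for `G` decaying like `exp (-4π (M + 1) s y)` and `d` bounded
below by a multiple of `exp (-2π y)`. -/
lemma pow_twelve_le {P C y d G : ℝ} {a s k M : ℕ} (hG0 : 0 ≤ G) (hy : 0 ≤ y)
    (h : Real.exp (-(2 * Real.pi * y)) ≤ C * d)
    (hG : G ≤ P * y ^ a * Real.exp (-(4 * Real.pi * (M + 1) * s * y))) :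
    G ^ 12 ≤ P ^ 12 * C ^ k * (y ^ (a * 12) *
      Real.exp (-((48 * Real.pi * (M + 1) * s - 2 * Real.pi * (k : ℕ)) * y))) * d ^ k := by
  have hP : 0 ≤ P ^ 12 := Even.pow_nonneg (by decide) P
  calc G ^ 12 ≤ (P * y ^ a * Real.exp (-(4 * Real.pi * (M + 1) * s * y))) ^ 12 := by gcongr
    _ = P ^ 12 * y ^ (a * 12) *
        (Real.exp (-((48 * Real.pi * (M + 1) * s - 2 * Real.pi * (k : ℕ)) * y)) *
          Real.exp (-(2 * Real.pi * y)) ^ k) := by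
        rw [mul_pow, mul_pow, ← pow_mul, ← Real.exp_nat_mul, ← Real.exp_nat_mul, ← Real.exp_add]
        congr 2
        push_cast; ring
    _ ≤ P ^ 12 * y ^ (a * 12) *
        (Real.exp (-((48 * Real.pi * (M + 1) * s - 2 * Real.pi * (k : ℕ)) * y)) * (C * d) ^ k) := by
        gcongr
    _ = _ := by rw [mul_pow]; ring

/-- **Sturm bound** for `Γ₁(N)`: a holomorphic function of moderate growth whose absolute value
transforms with weight `κ / 2` under `Γ₁(N)` vanishes, if it decays like `exp (-2π (M + 1) y)` at
the cusp `∞` for a large enough `M`. Only absolute values enter, so that multiplier systems and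
half-integral weights need no separate treatment. -/
theorem sturm_bound {N : ℕ} (hN : 0 < N) {g : ℂ → ℂ} {κ : ℕ} {C : ℝ} {A M : ℕ}
    (hg : DifferentiableOn ℂ g {τ | 0 < τ.im})
    (hmod : ∀ η ∈ CongruenceSubgroup.Gamma1 N, ∀ τ : ℂ, 0 < τ.im →
      ‖g (moeb η τ)‖ ^ 2 = ‖autJ η τ‖ ^ κ * ‖g τ‖ ^ 2)
    (hC : 0 ≤ C) (hgrowth : ∀ τ : ℂ, 0 < τ.im → ‖g τ‖ ≤ C * (1 + 1 / τ.im) ^ A)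
    {C' : ℝ} (hdecay : ∀ τ : ℂ, 1 / 2 ≤ τ.im →
      ‖g τ‖ ≤ C' * Real.exp (-(2 * Real.pi * (M + 1) * τ.im)))
    (hM : (if N ≤ 2 then (2 : ℚ) else 1) * (N : ℚ) ^ 2 / 24 * (κ / 2) *
      ∏ l ∈ N.primeFactors, (1 - 1 / (l : ℚ) ^ 2) < M + 1)
    {τ : ℂ} (hτ : 0 < τ.im) : g τ = 0 := by
  classical
  have hpi := Real.pi_pos
  have : NeZero N := ⟨hN.ne'⟩
  set Γ := CongruenceSubgroup.Gamma1 N with hΓ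
  have : Fintype (SL(2, ℤ) ⧸ Γ) := Subgroup.fintypeQuotientOfFiniteIndex
  set idx := Fintype.card (SL(2, ℤ) ⧸ Γ) with hidx
  -- the cosets of `±1`, which coincide precisely when `N ≤ 2`
  set S : Finset (SL(2, ℤ) ⧸ Γ) := {((1 : SL(2, ℤ)) : SL(2, ℤ) ⧸ Γ),
    ((-1 : SL(2, ℤ)) : SL(2, ℤ) ⧸ Γ)}
    with hS
  have hScard : κ * idx < 24 * S.card * (M + 1) := by
    have h1 := card_quotient_gamma1_le N hN
    rw [Nat.card_eq_fintype_card, ← hidx] at h1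
    have h2 : (2 : ℚ) ≤ (if N ≤ 2 then (2 : ℚ) else 1) * S.card := by
      by_cases hN2 : N ≤ 2
      · have : (1 : ℚ) ≤ S.card := by
          exact_mod_cast Finset.card_pos.2 ⟨_, Finset.mem_insert_self _ _⟩
        simp only [hN2, if_true]; linarith
      · have hne : ((1 : SL(2, ℤ)) : SL(2, ℤ) ⧸ Γ) ≠ ((-1 : SL(2, ℤ)) : SL(2, ℤ) ⧸ Γ) := by
          intro h
          rw [QuotientGroup.eq, hΓ, CongruenceSubgroup.Gamma1_mem] at h
          have h3 := h.1
          simp only [inv_one, one_mul, Matrix.SpecialLinearGroup.coe_neg,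
            Matrix.SpecialLinearGroup.coe_one, Matrix.neg_apply, Matrix.one_apply_eq] at h3
          have h4 : ((2 : ℕ) : ZMod N) = 0 := by push_cast at h3 ⊢; linear_combination -h3
          rw [ZMod.natCast_eq_zero_iff] at h4
          exact hN2 (Nat.le_of_dvd (by norm_num) h4)
        rw [hS, Finset.card_pair hne]
        simp [hN2]
    have h3 : (κ : ℚ) * idx < 24 * S.card * (M + 1) := by
      have hS0 : (0 : ℚ) < S.card := by
        exact_mod_cast Finset.card_pos.2 ⟨_, Finset.mem_insert_self _ _⟩
      have h5 : (0 : ℚ) ≤ κ * (N ^ 2 * ∏ l ∈ N.primeFactors, (1 - 1 / (l : ℚ) ^ 2)) :=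
        mul_nonneg (by positivity) (le_trans (by positivity) h1)
      have h6 := mul_lt_mul_of_pos_left hM (show (0 : ℚ) < 24 * S.card by positivity)
      have h7 := mul_le_mul_of_nonneg_right h2 h5
      have h8 := mul_le_mul_of_nonneg_left h1 (show (0 : ℚ) ≤ κ by positivity)
      linarith
    exact_mod_cast h3
  -- bounds for the individual factors on the strip
  have hfac : ∀ q : SL(2, ℤ) ⧸ Γ, ∃ D : ℝ, 0 ≤ D ∧ ∃ a : ℕ, ∀ τ : ℂ, |τ.re| ≤ 1 / 2 → 1 / 2 ≤ τ.im →
      ‖slashSq g κ (q.out⁻¹) τ‖ ≤ D * τ.im ^ a *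
        Real.exp (-(4 * Real.pi * (M + 1) * (if q ∈ S then 1 else 0) * τ.im)) := by
    intro q
    by_cases hq : q ∈ S
    · refine ⟨C' ^ 2, by positivity, 0, fun τ h1 h2 => ?_⟩
      have hτ : 0 < τ.im := by linarith
      obtain ⟨σ, hσ1, η, hη, hq'⟩ :
          ∃ σ : SL(2, ℤ), (σ = 1 ∨ σ = -1) ∧ ∃ η ∈ Γ, q.out⁻¹ = η * σ := by
        rw [hS, Finset.mem_insert, Finset.mem_singleton] at hq
        rcases hq with rfl | rfl
        · refine ⟨1, Or.inl rfl, _, ?_, (mul_one _).symm⟩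
          have := QuotientGroup.out_eq' ((1 : SL(2, ℤ)) : SL(2, ℤ) ⧸ Γ)
          rw [QuotientGroup.eq] at this
          simpa using this
        · refine ⟨-1, Or.inr rfl, -(Quotient.out ((-1 : SL(2, ℤ)) : SL(2, ℤ) ⧸ Γ))⁻¹, ?_, by simp⟩
          have := QuotientGroup.out_eq' ((-1 : SL(2, ℤ)) : SL(2, ℤ) ⧸ Γ)
          rw [QuotientGroup.eq] at this
          simpa using this
      have h3 : ‖slashSq g κ σ τ‖ = ‖g τ‖ ^ 2 := by
        rcases hσ1 with rfl | rfl
        · simp [slashSq, moeb, autJ]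
        · simp [slashSq, moeb, autJ]
      rw [hq', norm_slashSq_mul (hmod η hη) σ hτ, h3]
      simp only [hq, if_true, pow_zero, mul_one]
      calc _ ≤ (C' * Real.exp (-(2 * Real.pi * (M + 1) * τ.im))) ^ 2 := by gcongr; exact hdecay τ h2
        _ = _ := by rw [mul_pow, ← Real.exp_nat_mul]; congr 2; push_cast; ring
    · obtain ⟨D, hD0, hD⟩ := norm_slashSq_le hC hgrowth κ (q.out⁻¹)
      exact ⟨D, hD0, 2 * A, fun τ h1 h2 => by simpa [hq] using hD τ h1 h2⟩
  choose D hD0 a hD using hfac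
  -- the norm of `g ^ 24` from `Γ₁(N)` to `SL₂(ℤ)` has weight `12 κ idx`; division by a power of `Δ`
  -- makes it of weight `0`
  set R : ℂ → ℂ := fun τ => (∏ q : SL(2, ℤ) ⧸ Γ, slashSq g κ (q.out⁻¹) τ) ^ 12 /
    discr τ ^ (κ * idx) with hR
  have hRdiff : DifferentiableOn ℂ R {τ | 0 < τ.im} :=
    ((DifferentiableOn.fun_finsetProd fun q _ =>
      differentiableOn_slashSq hg κ _).fun_pow 12).fun_div
      (differentiableOn_discr.fun_pow _) fun τ hτ => pow_ne_zero _ (discr_ne_zero hτ)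
  have hRinv : ∀ (δ : SL(2, ℤ)) (τ : ℂ), 0 < τ.im → ‖R (moeb δ τ)‖ = ‖R τ‖ := by
    intro δ τ hτ
    have hJ := norm_ne_zero_iff.2 (autJ_ne_zero δ hτ)
    have hd := norm_ne_zero_iff.2 (discr_ne_zero hτ)
    have h1 : ∏ q : SL(2, ℤ) ⧸ Γ, ‖slashSq g κ (q.out⁻¹) (moeb δ τ)‖ =
        (∏ q : SL(2, ℤ) ⧸ Γ, ‖slashSq g κ (q.out⁻¹) τ‖) * ‖autJ δ τ‖ ^ (κ * idx) := by
      have h2 : ∀ q : SL(2, ℤ) ⧸ Γ, ‖slashSq g κ (q.out⁻¹) (moeb δ τ)‖ =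
          ‖slashSq g κ ((MulAction.toPerm δ⁻¹ q).out⁻¹) τ‖ * ‖autJ δ τ‖ ^ κ := by
        intro q
        rw [slashSq_moeb g κ _ δ hτ, norm_mul, norm_pow]
        congr 1
        obtain ⟨η, hη⟩ := QuotientGroup.mk_out_eq_mul Γ (δ⁻¹ * q.out)
        have h3 : (MulAction.toPerm δ⁻¹ q) = ((δ⁻¹ * q.out : SL(2, ℤ)) : SL(2, ℤ) ⧸ Γ) := by
          conv_lhs => rw [← QuotientGroup.out_eq' q]
          rfl
        rw [h3, hη, mul_inv_rev, mul_inv_rev, inv_inv,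
          norm_slashSq_mul (hmod _ (inv_mem η.2)) _ hτ]
      rw [Finset.prod_congr rfl fun q _ => h2 q, Finset.prod_mul_distrib, Finset.prod_const,
        Finset.card_univ, ← hidx, ← pow_mul,
        Equiv.prod_comp (MulAction.toPerm δ⁻¹) fun q : SL(2, ℤ) ⧸ Γ => ‖slashSq g κ (q.out⁻¹) τ‖]
    simp only [hR, norm_div, norm_pow, norm_prod, h1, discr_moeb δ hτ, norm_mul, mul_pow]
    rw [← pow_mul, ← pow_mul, mul_comm (κ * idx) 12]
    field_simp
  obtain ⟨C₁, Y₁, hC₁, hY₁, hlow⟩ := exists_exp_le_discr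
  -- the rate of decay of `R` at the cusp, which the hypothesis on `M` makes positive
  set c : ℝ := 48 * Real.pi * (M + 1) * S.card - 2 * Real.pi * (κ * idx) with hc
  have hc0 : 0 < c := by
    have : ((κ * idx : ℕ) : ℝ) < ((24 * S.card * (M + 1) : ℕ) : ℝ) := by exact_mod_cast hScard
    push_cast at this
    rw [hc]; nlinarith
  have hRbd : ∀ τ : ℂ, |τ.re| ≤ 1 / 2 → 1 / 2 ≤ τ.im → Y₁ ≤ τ.im →
      ‖R τ‖ ≤ ((∏ q, D q) ^ 12 * C₁ ^ (κ * idx)) *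
        (τ.im ^ ((∑ q, a q) * 12) * Real.exp (-(c * τ.im))) := by
    intro τ h1 h2 h3
    have hτ : 0 < τ.im := by linarith
    have hd := norm_pos_iff.2 (discr_ne_zero hτ)
    have h4 : ∏ q : SL(2, ℤ) ⧸ Γ, ‖slashSq g κ (q.out⁻¹) τ‖ ≤ (∏ q, D q) * τ.im ^ (∑ q, a q) *
        Real.exp (-(4 * Real.pi * (M + 1) * S.card * τ.im)) := by
      refine (Finset.prod_le_prod (fun _ _ => norm_nonneg _) fun q _ => hD q τ h1 h2).trans
        (le_of_eq ?_)
      rw [Finset.prod_mul_distrib, Finset.prod_mul_distrib, Finset.prod_pow_eq_pow_sum,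
        ← Real.exp_sum]
      congr 2
      rw [Finset.sum_neg_distrib, ← Finset.sum_mul, ← Finset.mul_sum]
      simp
    have h5 := hlow τ h3
    simp only [hR, norm_div, norm_pow, norm_prod]
    rw [div_le_iff₀ (by positivity)]
    have hDp : 0 ≤ ∏ q, D q := Finset.prod_nonneg fun q _ => hD0 q
    have h6 := pow_twelve_le (Finset.prod_nonneg fun q _ => norm_nonneg _) hτ.le h5 h4
      (k := κ * idx)
    rw [hc, ← Nat.cast_mul κ idx]
    exact h6
  have hlim : ∀ ε > 0, ∃ Y : ℝ, ∀ τ : ℂ, |τ.re| ≤ 1 / 2 → Y ≤ τ.im → ‖R τ‖ < ε := by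
    intro ε hε
    have h1 := tendsto_pow_mul_exp_neg ((∏ q, D q) ^ 12 * C₁ ^ (κ * idx)) ((∑ q, a q) * 12) hc0
    obtain ⟨Y, hY⟩ := Filter.eventually_atTop.1 (h1.eventually (gt_mem_nhds hε))
    refine ⟨max Y (max (1 / 2) Y₁), fun τ h2 h3 => ?_⟩
    have h4 := (le_max_right Y _).trans h3
    exact (hRbd τ h2 ((le_max_left _ _).trans h4) ((le_max_right _ _).trans h4)).trans_lt
      (hY _ ((le_max_left _ _).trans h3))
  have hprod : ∀ z ∈ {τ : ℂ | 0 < τ.im}, ∏ q : SL(2, ℤ) ⧸ Γ, slashSq g κ (q.out⁻¹) z = 0 := by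
    intro z hz
    have h1 := eq_zero_of_norm_invariant hRdiff hRinv hlim hz
    rw [hR, div_eq_zero_iff] at h1
    rcases h1 with h1 | h1
    · exact pow_eq_zero_iff (by norm_num) |>.1 h1
    · exact absurd h1 (pow_ne_zero _ (discr_ne_zero hz))
  obtain ⟨q, -, hq⟩ := exists_eq_zero_of_prod_eq_zero Finset.univ isOpen_upper isPreconnected_upper
    ⟨τ, hτ⟩ (fun q _ => differentiableOn_slashSq hg κ _) hprod
  -- moving the coset of `q` to the trivial one, the vanishing factor becomes `g`
  have h1 := hq (moeb q.out τ) (moeb_im_pos _ hτ)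
  rw [slashSq_moeb g κ _ _ hτ, inv_mul_cancel, mul_eq_zero, slashSq, moeb_one] at h1
  rcases h1 with h1 | h1
  · simpa [autJ] using h1
  · exact absurd h1 (pow_ne_zero _ (autJ_ne_zero _ hτ))

/-! ### Poisson summation on `ℤⁿ` -/

section Poisson

open MeasureTheory

variable {n : ℕ}

/-- The point of `ℝⁿ` with integral coordinates `v`. -/
def intVec (v : Fin n → ℤ) : Fin n → ℝ := fun i => (v i : ℝ)

lemma summable_exp_intVec {δ : ℝ} (hδ : 0 < δ) :
    Summable fun v : Fin n → ℤ => Real.exp (-δ * ∑ i, |(v i : ℝ)|) :=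
  (expTame_int_pi n).summable hδ

/-- The summands of a periodization are dominated uniformly on bounded sets. -/
lemma norm_translate_le {f : (Fin n → ℝ) → ℂ} {K δ : ℝ} (hδ : 0 < δ) (hK : 0 ≤ K)
    (hb : ∀ x, ‖f x‖ ≤ K * Real.exp (-δ * ∑ i, |x i|)) {R : ℝ} {x : Fin n → ℝ}
    (hx : ∀ i, |x i| ≤ R) (v : Fin n → ℤ) :
    ‖f (x + intVec v)‖ ≤ K * Real.exp (δ * (n * R)) * Real.exp (-δ * ∑ i, |(v i : ℝ)|) := by
  refine (hb _).trans ?_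
  rw [mul_assoc, ← Real.exp_add]
  gcongr
  have h1 : ∑ i, |(v i : ℝ)| ≤ ∑ i, |(x + intVec v) i| + n * R := by
    have : (n : ℝ) * R = ∑ _i : Fin n, R := by simp
    rw [this, ← Finset.sum_add_distrib]
    refine Finset.sum_le_sum fun i _ => ?_
    have h2 : (v i : ℝ) = (x + intVec v) i - x i := by simp [intVec]
    have h3 := abs_sub ((x + intVec v) i) (x i)
    rw [← h2] at h3
    linarith [hx i]
  nlinarith

lemma continuous_periodization {f : (Fin n → ℝ) → ℂ} (hf : Continuous f) {K δ : ℝ} (hδ : 0 < δ)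
    (hK : 0 ≤ K) (hb : ∀ x, ‖f x‖ ≤ K * Real.exp (-δ * ∑ i, |x i|)) :
    Continuous fun x : Fin n → ℝ => ∑' v : Fin n → ℤ, f (x + intVec v) := by
  rw [continuous_iff_continuousAt]
  intro x₀
  have hon : ContinuousOn (fun x : Fin n → ℝ => ∑' v : Fin n → ℤ, f (x + intVec v))
      (Metric.ball x₀ 1) := by
    refine continuousOn_tsum (u := fun v : Fin n → ℤ => K * Real.exp (δ * (n * (‖x₀‖ + 1))) *
      Real.exp (-δ * ∑ i, |(v i : ℝ)|)) (fun v => ?_)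
      ((summable_exp_intVec hδ).mul_left _) (fun v x hx => ?_)
    · exact (hf.comp (continuous_id.add continuous_const)).continuousOn
    · refine norm_translate_le hδ hK hb (fun i => ?_) v
      rw [mem_ball_iff_norm] at hx
      have h1 := norm_le_pi_norm x i
      rw [Real.norm_eq_abs] at h1
      have h2 := norm_le_norm_add_norm_sub' x x₀
      linarith
  exact hon.continuousAt (Metric.ball_mem_nhds _ one_pos)

lemma periodization_add_int (f : (Fin n → ℝ) → ℂ) (x : Fin n → ℝ) (w : Fin n → ℤ) :
    ∑' v : Fin n → ℤ, f (x + intVec w + intVec v) = ∑' v : Fin n → ℤ, f (x + intVec v) := by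
  rw [← (Equiv.addLeft w).tsum_eq fun v => f (x + intVec v)]
  congr 1; funext v; congr 1; funext i
  simp [intVec]; ring

/-- The integral of a periodization over the unit cube is the integral over `ℝⁿ`, since the
translates of the cube by integral vectors tile `ℝⁿ`. -/
lemma integral_cube_translates {h : (Fin n → ℝ) → ℂ} (hh : Continuous h) (hi : Integrable h)
    {K δ : ℝ} (hδ : 0 < δ) (hK : 0 ≤ K) (hb : ∀ x, ‖h x‖ ≤ K * Real.exp (-δ * ∑ i, |x i|)) :
    ∫ x in {x : Fin n → ℝ | ∀ i, x i ∈ Set.Ioc (0 : ℝ) (0 + 1)},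
      ∑' v : Fin n → ℤ, h (x + intVec v) = ∫ x, h x := by
  set cube : Set (Fin n → ℝ) := {x | ∀ i, x i ∈ Set.Ioc (0 : ℝ) (0 + 1)} with hcube
  have hpi : cube = Set.univ.pi fun _ : Fin n => Set.Ioc (0 : ℝ) (0 + 1) := by
    ext x; simp [hcube]
  have hmeas : MeasurableSet cube := by
    rw [hpi]; exact MeasurableSet.univ_pi fun _ => measurableSet_Ioc
  have hfin : volume cube ≠ ⊤ := by
    rw [hpi, Real.volume_pi_Ioc]; simp
  have : IsFiniteMeasure (volume.restrict cube) := ⟨by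
    rw [Measure.restrict_apply_univ]; exact hfin.lt_top⟩
  let tr (v : Fin n → ℤ) : Set (Fin n → ℝ) := {x | ∀ i, ⌈x i⌉ - 1 = v i}
  have htr_meas (v) : MeasurableSet (tr v) := by
    have : tr v = ⋂ i, {x : Fin n → ℝ | ⌈x i⌉ - 1 = v i} := by ext x; simp [tr]
    rw [this]
    refine MeasurableSet.iInter fun i => ?_
    have h2 : {x : Fin n → ℝ | ⌈x i⌉ - 1 = v i} = (fun x : Fin n → ℝ => ⌈x i⌉) ⁻¹' {v i + 1} := by
      ext x; simp [sub_eq_iff_eq_add]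
    rw [h2]
    exact (Int.measurable_ceil.comp (measurable_pi_apply i)) (MeasurableSet.singleton _)
  have htr (v) : (fun x => x + intVec v) ⁻¹' (tr v) = cube := by
    ext x
    simp only [Set.mem_preimage, tr, hcube, Set.mem_ofPred_eq, Pi.add_apply, intVec,
      Int.ceil_add_intCast, Set.mem_Ioc]
    refine forall_congr' fun i => ?_
    rw [show (⌈x i⌉ + v i - 1 = v i) ↔ ⌈x i⌉ = 1 by omega, Int.ceil_eq_iff]
    norm_num
  have hunion : ⋃ v, tr v = Set.univ := by
    ext x; simp only [Set.mem_iUnion, Set.mem_univ, iff_true, tr]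
    exact ⟨fun i => ⌈x i⌉ - 1, fun i => rfl⟩
  have h1 : HasSum (fun v => ∫ x in cube, h (x + intVec v)) (∫ x, h x) := by
    have := hasSum_integral_iUnion (f := h) (μ := volume) (s := tr) htr_meas ?_ ?_
    · rw [hunion, setIntegral_univ] at this
      refine this.congr_fun fun v => ?_
      have hmp := measurePreserving_add_right (volume : Measure (Fin n → ℝ)) (intVec v)
      rw [← hmp.setIntegral_preimage_emb (measurableEmbedding_addRight _) h (tr v), htr]
    · intro v w hvw
      rw [Function.onFun, Set.disjoint_left]
      intro x hx hx'
      exact hvw (funext fun i => (hx i).symm.trans (hx' i))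
    · exact hi.integrableOn
  have h2 : HasSum (fun v => ∫ x in cube, h (x + intVec v))
      (∫ x in cube, ∑' v : Fin n → ℤ, h (x + intVec v)) := by
    have hbd : ∀ x ∈ cube, ∀ v : Fin n → ℤ, ‖h (x + intVec v)‖ ≤
        K * Real.exp (δ * (n * 1)) * Real.exp (-δ * ∑ i, |(v i : ℝ)|) := by
      intro x hx v
      refine norm_translate_le hδ hK hb (fun i => ?_) v
      have := hx i
      rw [abs_le]; constructor <;> linarith [this.1, this.2]
    have hsum := (summable_exp_intVec (n := n) hδ).mul_left (K * Real.exp (δ * (n * 1)))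
    refine hasSum_integral_of_dominated_convergence
      (fun (v : Fin n → ℤ) _ => K * Real.exp (δ * (n * 1)) * Real.exp (-δ * ∑ i, |(v i : ℝ)|))
      (fun v => ?_) (fun v => ?_) (Filter.Eventually.of_forall fun _ => hsum) ?_ ?_
    · exact (hh.comp (continuous_id.add continuous_const)).aestronglyMeasurable
    · exact (ae_restrict_mem hmeas).mono fun x hx => hbd x hx v
    · exact integrable_const _
    · exact (ae_restrict_mem hmeas).mono fun x hx =>
        (Summable.of_norm_bounded hsum (hbd x hx)).hasSum
  exact h2.unique h1

/-- Poisson summation for a continuous, exponentially decreasing function on `ℝⁿ`. -/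
theorem hasSum_poisson {f : (Fin n → ℝ) → ℂ} (hf : Continuous f) (hi : Integrable f) {K δ : ℝ}
    (hδ : 0 < δ) (hK : 0 ≤ K) (hb : ∀ x, ‖f x‖ ≤ K * Real.exp (-δ * ∑ i, |x i|))
    (hs : Summable fun m : Fin n → ℤ => ∫ x, f x * e (∑ i, (m i : ℂ) * x i)) (x : Fin n → ℝ) :
    HasSum (fun m : Fin n → ℤ => (∫ y, f y * e (∑ i, (m i : ℂ) * y i)) *
      e (-∑ i, (m i : ℂ) * x i)) (∑' v : Fin n → ℤ, f (x + intVec v)) := by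
  set S : (Fin n → ℝ) → ℂ := fun x => ∑' v : Fin n → ℤ, f (x + intVec v) with hS
  -- the periodization `S` as a function on the torus; its Fourier coefficients are the integrals
  -- of `f` against characters, and `S` is the sum of its Fourier series
  let Sb : UnitAddTorus (Fin n) → ℂ := fun t => S fun i => (t i).out
  have hSb (x : Fin n → ℝ) : Sb (fun i => (x i : UnitAddCircle)) = S x := by
    have h1 (i) : ∃ k : ℤ, ((x i : UnitAddCircle)).out = x i + k := by
      have h2 : ((((x i : UnitAddCircle)).out : ℝ) : UnitAddCircle) = (x i : UnitAddCircle) :=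
        Quotient.out_eq _
      rw [← sub_eq_zero, ← AddCircle.coe_sub, AddCircle.coe_eq_zero_iff] at h2
      obtain ⟨k, hk⟩ := h2
      exact ⟨k, by simp at hk; linarith⟩
    choose k hk using h1
    have h3 : (fun i => ((x i : UnitAddCircle)).out) = x + intVec k := funext hk
    change S (fun i => ((x i : UnitAddCircle)).out) = S x
    rw [h3]
    exact periodization_add_int f x k
  have hcont : Continuous Sb := by
    have hq : IsOpenQuotientMap
        (Pi.map (fun (_ : Fin n) (y : ℝ) => (y : UnitAddCircle))) :=
      IsOpenQuotientMap.piMap fun _ => QuotientAddGroup.isOpenQuotientMap_mk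
    rw [← hq.continuous_comp_iff]
    have : Sb ∘ Pi.map (fun (_ : Fin n) (y : ℝ) => (y : UnitAddCircle)) = S := by
      funext x; exact hSb x
    rw [this]
    exact continuous_periodization hf hδ hK hb
  have hfour (m : Fin n → ℤ) (x : Fin n → ℝ) :
      UnitAddTorus.mFourier m (fun i => (x i : UnitAddCircle)) = e (∑ i, (m i : ℂ) * x i) := by
    change ∏ i, fourier (m i) (x i : UnitAddCircle) = _
    simp_rw [fourier_coe_apply]
    rw [← Complex.exp_sum, e, Finset.mul_sum]
    congr 1
    refine Finset.sum_congr rfl fun i _ => ?_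
    push_cast; ring
  have hcoeff (m : Fin n → ℤ) :
      UnitAddTorus.mFourierCoeff Sb (-m) = ∫ y, f y * e (∑ i, (m i : ℂ) * y i) := by
    rw [UnitAddTorus.mFourierCoeff_eq_integral Sb (-m) 0, neg_neg]
    simp only [hSb, hfour, smul_eq_mul, Pi.zero_apply]
    have hper (x : Fin n → ℝ) (v : Fin n → ℤ) :
        e (∑ i, (m i : ℂ) * ((x + intVec v) i : ℝ)) = e (∑ i, (m i : ℂ) * x i) := by
      have : ∑ i, (m i : ℂ) * ((x + intVec v) i : ℝ) =
          ∑ i, (m i : ℂ) * x i + ((∑ i, m i * v i : ℤ) : ℂ) := by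
        push_cast
        rw [← Finset.sum_add_distrib]
        refine Finset.sum_congr rfl fun i _ => ?_
        simp [intVec]; ring
      rw [this, e_add, e_int, mul_one]
    have hecont : Continuous fun y : Fin n → ℝ => e (∑ i, (m i : ℂ) * y i) := by
      unfold e; fun_prop
    have hnorm (y : Fin n → ℝ) : ‖e (∑ i, (m i : ℂ) * y i)‖ = 1 := by
      have : ∑ i, (m i : ℂ) * y i = ((∑ i, (m i : ℝ) * y i : ℝ) : ℂ) := by push_cast; rfl
      rw [this, norm_e_real]
    rw [← integral_cube_translates (h := fun y => f y * e (∑ i, (m i : ℂ) * y i))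
      (hf.mul hecont) ?_ hδ hK ?_]
    · congr 1
      funext x
      simp only [hper, hS]
      rw [tsum_mul_right, mul_comm]
    · refine hi.mul_bdd (c := 1) hecont.aestronglyMeasurable ?_
      exact Filter.Eventually.of_forall fun y => (hnorm y).le
    · intro y; rw [norm_mul, hnorm, mul_one]; exact hb y
  have hsum : Summable (UnitAddTorus.mFourierCoeff Sb) := by
    rw [← (Equiv.neg (Fin n → ℤ)).summable_iff]
    refine hs.congr fun m => ?_
    exact (hcoeff m).symm
  have h := UnitAddTorus.hasSum_mFourier_series_apply_of_summable (f := ⟨Sb, hcont⟩) hsum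
    (fun i => (x i : UnitAddCircle))
  rw [← (Equiv.neg (Fin n → ℤ)).hasSum_iff] at h
  change HasSum _ (Sb _) at h
  rw [hSb] at h
  refine h.congr_fun fun m => ?_
  simp only [Function.comp, Equiv.neg_apply]
  change _ = UnitAddTorus.mFourierCoeff Sb (-m) • _
  rw [hcoeff, hfour, smul_eq_mul]
  congr 2
  simp

end Poisson

/-! ### Positive definite forms and the inversion formula -/

section Form

variable {V : Type*} [AddCommGroup V] [Module ℝ V] {B : LinearMap.BilinForm ℝ V}

lemma baseChange_one_tmul (v : V) (a : ℂ) (w : V) :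
    B.baseChange ℂ ((1 : ℂ) ⊗ₜ[ℝ] v) (a ⊗ₜ[ℝ] w) = a * (B v w : ℂ) := by
  rw [LinearMap.BilinForm.baseChange_tmul, one_mul, Complex.real_smul, mul_comm]

lemma baseChange_symm (hsymm : B.IsSymm) (x y : ℂ ⊗[ℝ] V) :
    B.baseChange ℂ x y = B.baseChange ℂ y x := by
  induction x using TensorProduct.induction_on with
  | zero => simp
  | add x x' h h' => rw [map_add, map_add, LinearMap.add_apply, h, h']
  | tmul a v =>
    induction y using TensorProduct.induction_on with
    | zero => simp
    | add y y' h h' => rw [map_add, map_add, LinearMap.add_apply, h, h']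
    | tmul a' v' =>
      rw [LinearMap.BilinForm.baseChange_tmul, LinearMap.BilinForm.baseChange_tmul, hsymm.eq,
        mul_comm]

/-- The complex quadratic form `z ↦ B(z, z) / 2` on the complexification. -/
def QC (B : LinearMap.BilinForm ℝ V) (z : ℂ ⊗[ℝ] V) : ℂ := B.baseChange ℂ z z / 2

lemma QC_one_tmul (v : V) : QC B ((1 : ℂ) ⊗ₜ[ℝ] v) = (Q B v : ℂ) := by
  rw [QC, baseChange_one_tmul, Q]; push_cast; ring

lemma QC_smul (a : ℂ) (z : ℂ ⊗[ℝ] V) : QC B (a • z) = a ^ 2 * QC B z := by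
  simp only [QC, map_smul, LinearMap.smul_apply, smul_eq_mul]; ring

lemma QC_neg (z : ℂ ⊗[ℝ] V) : QC B (-z) = QC B z := by simp [QC]

lemma QC_add (hsymm : B.IsSymm) (z w : ℂ ⊗[ℝ] V) :
    QC B (z + w) = QC B z + QC B w + B.baseChange ℂ w z := by
  simp only [QC, map_add, LinearMap.add_apply]
  rw [baseChange_symm hsymm z w]; ring

lemma Q_add (hsymm : B.IsSymm) (v w : V) : Q B (v + w) = Q B v + Q B w + B v w := by
  simp only [Q, map_add, LinearMap.add_apply]
  rw [hsymm.eq w v]; ring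

lemma Q_smul (a : ℝ) (v : V) : Q B (a • v) = a ^ 2 * Q B v := by
  simp [Q]; ring

lemma Q_neg (v : V) : Q B (-v) = Q B v := by simp [Q]

lemma Q_nonneg (hpos : ∀ x : V, x ≠ 0 → 0 < B x x) (v : V) : 0 ≤ Q B v := by
  by_cases h : v = 0
  · simp [h, Q]
  · exact (half_pos (hpos v h)).le

/-- The Cauchy–Schwarz inequality. -/
lemma sq_le_of_posDef (hsymm : B.IsSymm) (hpos : ∀ x : V, x ≠ 0 → 0 < B x x) (v w : V) :
    B v w ^ 2 ≤ B v v * B w w := by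
  by_cases hw : w = 0
  · simp [hw]
  have h1 := hpos w hw
  have h2 := Q_nonneg hpos (B w w • v - B v w • w)
  have h3 : Q B (B w w • v - B v w • w) = B w w * (B v v * B w w - B v w ^ 2) / 2 := by
    simp only [Q, map_sub, map_smul, LinearMap.sub_apply, LinearMap.smul_apply, smul_eq_mul]
    rw [hsymm.eq w v]; simp; ring
  rw [h3] at h2
  have h4 : 0 ≤ B w w * (B v v * B w w - B v w ^ 2) := by linarith
  have := nonneg_of_mul_nonneg_right h4 h1
  linarith

/-- Linear forms are of smaller order than `Q`. -/
lemma abs_le_eps_Q (hsymm : B.IsSymm) (hpos : ∀ x : V, x ≠ 0 → 0 < B x x) (w : V) {ε : ℝ}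
    (hε : 0 < ε) (v : V) : |B v w| ≤ ε * Q B v + B w w / ε := by
  have h := sq_le_of_posDef hsymm hpos v w
  have h1 := Q_nonneg hpos v
  have h2 := Q_nonneg hpos w
  rw [Q] at h1 h2
  have h3 : 0 ≤ ε * Q B v + B w w / ε := by
    have : 0 ≤ B w w := by linarith
    rw [Q]; positivity
  refine abs_le_of_sq_le_sq' ?_ h3 |> abs_le.2
  have h4 : ε * Q B v * (B w w / ε) = Q B v * B w w := by field_simp
  have h5 : B v v = 2 * Q B v := by rw [Q]; ring
  rw [h5] at h
  nlinarith [sq_nonneg (ε * Q B v - B w w / ε)]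

lemma baseChange_le_eps_Q (hsymm : B.IsSymm) (hpos : ∀ x : V, x ≠ 0 → 0 < B x x)
    (z : ℂ ⊗[ℝ] V) : ∀ ε : ℝ, 0 < ε → ∃ C : ℝ, ∀ v : V,
      ‖B.baseChange ℂ ((1 : ℂ) ⊗ₜ[ℝ] v) z‖ ≤ ε * Q B v + C := by
  induction z using TensorProduct.induction_on with
  | zero => intro ε hε; exact ⟨0, fun v => by
      have := Q_nonneg hpos v
      simp; positivity⟩
  | tmul a w =>
    intro ε hε
    refine ⟨‖a‖ * (B w w / (ε / (‖a‖ + 1))), fun v => ?_⟩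
    rw [baseChange_one_tmul, norm_mul, Complex.norm_real, Real.norm_eq_abs]
    have h1 := abs_le_eps_Q hsymm hpos w (ε := ε / (‖a‖ + 1)) (by positivity) v
    have h2 : ‖a‖ * (ε / (‖a‖ + 1)) ≤ ε := by
      rw [mul_div_assoc', div_le_iff₀ (by positivity)]; nlinarith [norm_nonneg a]
    have h3 := Q_nonneg hpos v
    calc _ ≤ ‖a‖ * (ε / (‖a‖ + 1) * Q B v + B w w / (ε / (‖a‖ + 1))) := by gcongr
      _ = (‖a‖ * (ε / (‖a‖ + 1))) * Q B v + ‖a‖ * (B w w / (ε / (‖a‖ + 1))) := by ring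
      _ ≤ _ := by gcongr
  | add x y hx hy =>
    intro ε hε
    obtain ⟨C, hC⟩ := hx (ε / 2) (by positivity)
    obtain ⟨C', hC'⟩ := hy (ε / 2) (by positivity)
    refine ⟨C + C', fun v => ?_⟩
    rw [map_add]
    exact (norm_add_le _ _).trans (by linarith [hC v, hC' v])

lemma nondegenerate_of_posDef (hpos : ∀ x : V, x ≠ 0 → 0 < B x x) : B.Nondegenerate := by
  constructor
  · intro x hx; by_contra h; exact (hpos x h).ne' (hx x)
  · intro x hx; by_contra h; exact (hpos x h).ne' (hx x)

end Form

section Coordinates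

variable {V : Type*} [AddCommGroup V] [Module ℝ V] {B : LinearMap.BilinForm ℝ V} {n : ℕ}

/-- The vector with the real coordinates `x` in the basis `b`. -/
abbrev vec (b : Module.Basis (Fin n) ℝ V) (x : Fin n → ℝ) : V := b.equivFun.symm x

lemma vec_eq (b : Module.Basis (Fin n) ℝ V) (x : Fin n → ℝ) : vec b x = ∑ i, x i • b i :=
  b.equivFun_symm_apply x

lemma mem_span_iff_vec (b : Module.Basis (Fin n) ℝ V) (v : V) :
    v ∈ Submodule.span ℤ (Set.range b) ↔ ∃ k : Fin n → ℤ, v = vec b (intVec k) := by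
  rw [b.mem_span_iff_repr_mem ℤ]
  constructor
  · intro h
    choose k hk using h
    refine ⟨k, ?_⟩
    rw [LinearEquiv.eq_symm_apply]
    funext i
    rw [Module.Basis.equivFun_apply, ← hk i]
    simp [intVec]
  · rintro ⟨k, rfl⟩ i
    refine ⟨k i, ?_⟩
    rw [← Module.Basis.equivFun_apply, LinearEquiv.apply_symm_apply]
    simp [intVec]

lemma B_vec_left (b : Module.Basis (Fin n) ℝ V) (x : Fin n → ℝ) (w : V) :
    B (vec b x) w = ∑ i, x i * B (b i) w := by
  rw [vec_eq]; simp

lemma baseChange_vec_left (b : Module.Basis (Fin n) ℝ V) (x : Fin n → ℝ) (z : ℂ ⊗[ℝ] V) :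
    B.baseChange ℂ ((1 : ℂ) ⊗ₜ[ℝ] vec b x) z =
      ∑ i, (x i : ℂ) * B.baseChange ℂ ((1 : ℂ) ⊗ₜ[ℝ] b i) z := by
  rw [vec_eq, TensorProduct.tmul_sum, map_sum, LinearMap.sum_apply]
  refine Finset.sum_congr rfl fun i _ => ?_
  rw [TensorProduct.tmul_smul, ← algebraMap_smul ℂ (x i), map_smul, LinearMap.smul_apply,
    smul_eq_mul]
  rfl

/-- The coordinates of a vector are controlled by the form. -/
lemma sum_abs_le_eps_Q (hsymm : B.IsSymm) (hpos : ∀ x : V, x ≠ 0 → 0 < B x x)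
    (b : Module.Basis (Fin n) ℝ V) {ε : ℝ} (hε : 0 < ε) :
    ∃ C : ℝ, ∀ v : V, ∑ i, |b.repr v i| ≤ ε * Q B v + C := by
  have hB := nondegenerate_of_posDef hpos
  have h1 (i : Fin n) (v : V) : b.repr v i = B v (B.dualBasis hB b i) := by
    rw [hsymm.eq]
    conv_rhs => rw [← b.sum_repr v, map_sum]
    simp [LinearMap.BilinForm.apply_dualBasis_left, -Module.Basis.sum_repr]
  refine ⟨∑ i, B (B.dualBasis hB b i) (B.dualBasis hB b i) / (ε / (n + 1)), fun v => ?_⟩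
  have h2 : ∀ i ∈ Finset.univ, |b.repr v i| ≤ ε / (n + 1) * Q B v +
      B (B.dualBasis hB b i) (B.dualBasis hB b i) / (ε / (n + 1)) := fun i _ => by
    rw [h1]; exact abs_le_eps_Q hsymm hpos _ (by positivity) v
  refine (Finset.sum_le_sum h2).trans ?_
  rw [Finset.sum_add_distrib, Finset.sum_const, Finset.card_univ, Fintype.card_fin, nsmul_eq_mul]
  have h3 : (n : ℝ) * (ε / (n + 1)) ≤ ε := by
    rw [mul_div_assoc', div_le_iff₀ (by positivity)]; nlinarith
  have h4 := Q_nonneg hpos v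
  nlinarith

/-- The values of `Q` on a coset of a lattice grow fast enough for the theta series to converge. -/
lemma expTame_coset (hsymm : B.IsSymm) (hpos : ∀ x : V, x ≠ 0 → 0 < B x x)
    (b : Module.Basis (Fin n) ℝ V) (α : V) :
    ExpTame fun v : Fin n → ℤ => Q B (α + vec b (intVec v)) := by
  obtain ⟨C, hC⟩ := sum_abs_le_eps_Q hsymm hpos b one_pos
  refine (expTame_int_pi n).mono (fun v => Q_nonneg hpos _) one_pos le_rfl
    (b := C + ∑ i, |b.repr α i|) fun v => ?_
  have h1 : ∑ i, |(v i : ℝ)| ≤ ∑ i, |b.repr (α + vec b (intVec v)) i| + ∑ i, |b.repr α i| := by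
    rw [← Finset.sum_add_distrib]
    refine Finset.sum_le_sum fun i _ => ?_
    have h2 : (v i : ℝ) = b.repr (α + vec b (intVec v)) i - b.repr α i := by
      rw [map_add, Finsupp.add_apply, ← Module.Basis.equivFun_apply b (vec b _),
        LinearEquiv.apply_symm_apply]
      simp [intVec]
    rw [h2]
    exact abs_sub _ _
  linarith [hC (α + vec b (intVec v))]

lemma littleBd_coset (hsymm : B.IsSymm) (hpos : ∀ x : V, x ≠ 0 → 0 < B x x) {X : Type*}
    (φ : X → V) (z : ℂ ⊗[ℝ] V) :
    LittleBd (fun x => Q B (φ x)) fun x => B.baseChange ℂ ((1 : ℂ) ⊗ₜ[ℝ] φ x) z := fun ε hε => by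
  obtain ⟨C, hC⟩ := baseChange_le_eps_Q hsymm hpos z ε hε
  exact ⟨C, fun x => hC _⟩

lemma exists_orthonormal_basis (hsymm : B.IsSymm) (hpos : ∀ x : V, x ≠ 0 → 0 < B x x)
    (b : Module.Basis (Fin n) ℝ V) :
    ∃ o : Module.Basis (Fin n) ℝ V, ∀ i j, B (o i) (o j) = if i = j then 1 else 0 := by
  have : FiniteDimensional ℝ V := b.finiteDimensional_of_finite
  obtain ⟨v', hv'⟩ := LinearMap.BilinForm.exists_orthogonal_basis (B := B) ⟨hsymm.eq⟩
  have hn : Module.finrank ℝ V = n := by simp [Module.finrank_eq_card_basis b]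
  obtain ⟨v, hv⟩ : ∃ v : Module.Basis (Fin n) ℝ V, ∀ i j, i ≠ j → B (v i) (v j) = 0 := by
    subst hn
    exact ⟨v', fun i j h => hv' h⟩
  have hp : ∀ i, 0 < B (v i) (v i) := fun i => hpos _ (v.ne_zero i)
  have hu : ∀ i, IsUnit ((√(B (v i) (v i)))⁻¹) := fun i =>
    (inv_ne_zero (Real.sqrt_pos.2 (hp i)).ne').isUnit
  refine ⟨v.isUnitSMul hu, fun i j => ?_⟩
  rw [Module.Basis.isUnitSMul_apply, Module.Basis.isUnitSMul_apply]
  split_ifs with h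
  · subst h
    have h2 := Real.mul_self_sqrt (hp i).le
    simp only [map_smul, LinearMap.smul_apply, smul_eq_mul]
    rw [← mul_assoc, ← mul_inv, h2, inv_mul_cancel₀ (hp i).ne']
  · have h4 : B (v i) (v j) = 0 := hv i j h
    simp [h4]

lemma eq_sum_orthonormal {o : Module.Basis (Fin n) ℝ V}
    (ho : ∀ i j, B (o i) (o j) = if i = j then 1 else 0) (z : ℂ ⊗[ℝ] V) :
    z = ∑ i, B.baseChange ℂ ((1 : ℂ) ⊗ₜ[ℝ] o i) z • ((1 : ℂ) ⊗ₜ[ℝ] o i) := by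
  induction z using TensorProduct.induction_on with
  | zero => simp
  | add x y hx hy =>
    conv_lhs => rw [hx, hy]
    simp only [map_add, add_smul, Finset.sum_add_distrib]
  | tmul a v =>
    have h1 : v = ∑ i, B (o i) v • o i := by
      conv_lhs => rw [← o.sum_repr v]
      refine Finset.sum_congr rfl fun i _ => ?_
      congr 1
      conv_rhs => rw [← o.sum_repr v, map_sum]
      simp [ho, -Module.Basis.sum_repr]
    conv_lhs => rw [h1, TensorProduct.tmul_sum]
    refine Finset.sum_congr rfl fun i _ => ?_
    rw [baseChange_one_tmul, TensorProduct.smul_tmul', smul_eq_mul, mul_one,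
      TensorProduct.tmul_smul, TensorProduct.smul_tmul', Complex.real_smul, mul_comm]

lemma baseChange_self_orthonormal {o : Module.Basis (Fin n) ℝ V}
    (ho : ∀ i j, B (o i) (o j) = if i = j then 1 else 0) (z : ℂ ⊗[ℝ] V) :
    B.baseChange ℂ z z = ∑ i, B.baseChange ℂ ((1 : ℂ) ⊗ₜ[ℝ] o i) z ^ 2 := by
  have h : B.baseChange ℂ z z = B.baseChange ℂ
      (∑ i, B.baseChange ℂ ((1 : ℂ) ⊗ₜ[ℝ] o i) z • ((1 : ℂ) ⊗ₜ[ℝ] o i)) z := by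
    rw [← eq_sum_orthonormal ho z]
  rw [h, map_sum, LinearMap.sum_apply]
  refine Finset.sum_congr rfl fun i _ => ?_
  rw [map_smul, LinearMap.smul_apply, smul_eq_mul, sq]

end Coordinates

section Inversion

open MeasureTheory

variable {V : Type*} [AddCommGroup V] [Module ℝ V] {B : LinearMap.BilinForm ℝ V} {n : ℕ}

lemma continuous_gaussian (b : Module.Basis (Fin n) ℝ V) (τ : ℂ) (ζ : ℂ ⊗[ℝ] V) :
    Continuous fun x : Fin n → ℝ =>
      e (τ * Q B (vec b x) + B.baseChange ℂ ((1 : ℂ) ⊗ₜ[ℝ] vec b x) ζ) := by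
  have h (x : Fin n → ℝ) : Q B (vec b x) = (∑ i, x i * ∑ j, x j * B (b i) (b j)) / 2 := by
    rw [Q, B_vec_left]
    congr 1
    refine Finset.sum_congr rfl fun i _ => ?_
    congr 1
    rw [vec_eq]; simp
  simp_rw [h, baseChange_vec_left]
  unfold e
  fun_prop

/-- The Gaussian integral of the theta terms; the positive constant `C` is the inverse covolume. -/
lemma gaussian_integral (hsymm : B.IsSymm) (hpos : ∀ x : V, x ≠ 0 → 0 < B x x)
    (b : Module.Basis (Fin n) ℝ V) : ∃ C : ℝ, 0 < C ∧ ∀ τ : ℂ, 0 < τ.im → ∀ ζ : ℂ ⊗[ℝ] V,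
      (Integrable fun x : Fin n → ℝ =>
        e (τ * Q B (vec b x) + B.baseChange ℂ ((1 : ℂ) ⊗ₜ[ℝ] vec b x) ζ)) ∧
      ∫ x : Fin n → ℝ, e (τ * Q B (vec b x) + B.baseChange ℂ ((1 : ℂ) ⊗ₜ[ℝ] vec b x) ζ) =
        C * (Complex.I / τ) ^ ((n : ℂ) / 2) * e (-(QC B ζ / τ)) := by
  obtain ⟨o, ho⟩ := exists_orthonormal_basis hsymm hpos b
  -- coordinates in an orthonormal basis reduce the claim to the standard Gaussian integral
  let T : (Fin n → ℝ) ≃ₗ[ℝ] (Fin n → ℝ) := b.equivFun.symm.trans o.equivFun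
  have hT (x) : vec o (T x) = vec b x := by simp [T, vec]
  have hdet : LinearMap.det (T : (Fin n → ℝ) →ₗ[ℝ] (Fin n → ℝ)) ≠ 0 :=
    (LinearEquiv.isUnit_det' T).ne_zero
  have hTm : MeasurableEmbedding T := T.toContinuousLinearEquiv.toHomeomorph.measurableEmbedding
  set D := |(LinearMap.det (T : (Fin n → ℝ) →ₗ[ℝ] (Fin n → ℝ)))⁻¹| with hD
  have hD0 : 0 < D := abs_pos.2 (inv_ne_zero hdet)
  have hmap : Measure.map T volume = ENNReal.ofReal D • volume :=
    Real.map_linearMap_volume_pi_eq_smul_volume_pi hdet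
  refine ⟨D, hD0, fun τ hτ ζ => ?_⟩
  set β : ℂ := -(Complex.I * Real.pi * τ) with hβ
  have hβre : 0 < β.re := by
    have := Real.pi_pos
    simp [hβ]; positivity
  let c : Fin n → ℂ := fun i => 2 * Real.pi * Complex.I * B.baseChange ℂ ((1 : ℂ) ⊗ₜ[ℝ] o i) ζ
  let F : (Fin n → ℝ) → ℂ := fun y => Complex.exp (-β * ∑ i, (y i : ℂ) ^ 2 + ∑ i, c i * y i)
  have hF (x : Fin n → ℝ) :
      e (τ * Q B (vec b x) + B.baseChange ℂ ((1 : ℂ) ⊗ₜ[ℝ] vec b x) ζ) = F (T x) := by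
    rw [← hT]
    generalize T x = y
    have h1 : Q B (vec o y) = (∑ i, y i ^ 2) / 2 := by
      rw [Q, vec_eq]
      congr 1
      simp [ho, sq]
    rw [h1, baseChange_vec_left, e]
    simp only [F, c]
    congr 1
    rw [mul_add, Finset.mul_sum, Finset.mul_sum]
    congr 1
    · simp only [hβ]; push_cast; ring_nf; simp [Finset.mul_sum]
    · exact Finset.sum_congr rfl fun i _ => by ring
  have hFi : Integrable F := GaussianFourier.integrable_cexp_neg_mul_sum_add hβre c
  simp_rw [hF]
  constructor
  · have : Integrable F (Measure.map T volume) := by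
      rw [hmap]; exact hFi.smul_measure ENNReal.ofReal_ne_top
    exact hTm.integrable_map_iff.1 this
  · rw [← hTm.integral_map, hmap, integral_smul_measure,
      GaussianFourier.integral_cexp_neg_mul_sum_add hβre, ENNReal.toReal_ofReal hD0.le,
      Fintype.card_fin, Complex.real_smul, mul_assoc]
    have hτ0 : τ ≠ 0 := by rintro rfl; simp at hτ
    have hpi : (Real.pi : ℂ) ≠ 0 := Complex.ofReal_ne_zero.2 Real.pi_ne_zero
    have hI := Complex.I_ne_zero
    congr 2
    · congr 1
      rw [hβ]
      field_simp
      simp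
    · rw [e, QC, baseChange_self_orthonormal ho]
      congr 1
      simp only [c, mul_pow, ← Finset.mul_sum, hβ]
      field_simp
      ring_nf

lemma gaussian_norm_le (hsymm : B.IsSymm) (hpos : ∀ x : V, x ≠ 0 → 0 < B x x)
    (b : Module.Basis (Fin n) ℝ V) {τ : ℂ} (hτ : 0 < τ.im) (ζ : ℂ ⊗[ℝ] V) :
    ∃ K : ℝ, 0 ≤ K ∧ ∀ x : Fin n → ℝ,
      ‖e (τ * Q B (vec b x) + B.baseChange ℂ ((1 : ℂ) ⊗ₜ[ℝ] vec b x) ζ)‖ ≤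
        K * Real.exp (-1 * ∑ i, |x i|) := by
  have hpi := Real.pi_pos
  obtain ⟨C, hC⟩ := sum_abs_le_eps_Q hsymm hpos b (ε := Real.pi * τ.im) (by positivity)
  obtain ⟨C', hC'⟩ := baseChange_le_eps_Q hsymm hpos ζ (τ.im / 2) (by positivity)
  refine ⟨Real.exp (C + 2 * Real.pi * C'), (Real.exp_pos _).le, fun x => ?_⟩
  rw [norm_e, ← Real.exp_add]
  apply Real.exp_le_exp.2
  have h1 := hC (vec b x)
  have h2 := hC' (vec b x)
  have h3 : ∑ i, |b.repr (vec b x) i| = ∑ i, |x i| := by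
    simp only [← Module.Basis.equivFun_apply, vec, LinearEquiv.apply_symm_apply]
  have h4 := Complex.abs_im_le_norm (B.baseChange ℂ ((1 : ℂ) ⊗ₜ[ℝ] vec b x) ζ)
  have h5 := neg_abs_le (B.baseChange ℂ ((1 : ℂ) ⊗ₜ[ℝ] vec b x) ζ).im
  rw [h3] at h1
  have h6 : (τ * (Q B (vec b x) : ℂ) + B.baseChange ℂ ((1 : ℂ) ⊗ₜ[ℝ] vec b x) ζ).im =
      τ.im * Q B (vec b x) + (B.baseChange ℂ ((1 : ℂ) ⊗ₜ[ℝ] vec b x) ζ).im := by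
    simp
  rw [h6]
  nlinarith

lemma neg_inv_im {τ : ℂ} (hτ : 0 < τ.im) : 0 < (-1 / τ).im := by
  have hτ0 : τ ≠ 0 := by rintro rfl; simp at hτ
  rw [neg_div, one_div, Complex.neg_im, Complex.inv_im, neg_div, neg_neg]
  exact div_pos hτ (Complex.normSq_pos.2 hτ0)

/-- The inversion formula for a shifted theta series; `u` runs through the dual lattice. -/
lemma theta_inversion (hsymm : B.IsSymm) (hpos : ∀ x : V, x ≠ 0 → 0 < B x x)
    (b b' : Module.Basis (Fin n) ℝ V) (hb' : ∀ i j, B (b' i) (b j) = if j = i then 1 else 0) :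
    ∃ C : ℝ, 0 < C ∧ ∀ τ : ℂ, 0 < τ.im → ∀ (ζ : ℂ ⊗[ℝ] V) (x : Fin n → ℝ),
      HasSum (fun m : Fin n → ℤ => C * (Complex.I / τ) ^ ((n : ℂ) / 2) *
        e (-(QC B (ζ + (1 : ℂ) ⊗ₜ[ℝ] vec b' (intVec m)) / τ)) *
          e (-(B (vec b' (intVec m)) (vec b x) : ℂ)))
      (∑' v : Fin n → ℤ, e (τ * Q B (vec b (x + intVec v)) +
        B.baseChange ℂ ((1 : ℂ) ⊗ₜ[ℝ] vec b (x + intVec v)) ζ)) := by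
  obtain ⟨C, hC0, hC⟩ := gaussian_integral hsymm hpos b
  refine ⟨C, hC0, fun τ hτ ζ x => ?_⟩
  have hτ0 : τ ≠ 0 := by rintro rfl; simp at hτ
  obtain ⟨K, hK, hbd⟩ := gaussian_norm_le hsymm hpos b hτ ζ
  have hpair (m : Fin n → ℤ) (x : Fin n → ℝ) :
      (B (vec b' (intVec m)) (vec b x) : ℂ) = ∑ i, (m i : ℂ) * x i := by
    have : B (vec b' (intVec m)) (vec b x) = ∑ i, (m i : ℝ) * x i := by
      rw [B_vec_left, vec_eq]
      simp [hb', intVec]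
    rw [this]; push_cast; rfl
  have hint (m : Fin n → ℤ) : ∫ x : Fin n → ℝ, e (τ * Q B (vec b x) +
      B.baseChange ℂ ((1 : ℂ) ⊗ₜ[ℝ] vec b x) ζ) * e (∑ i, (m i : ℂ) * x i) =
      C * (Complex.I / τ) ^ ((n : ℂ) / 2) *
        e (-(QC B (ζ + (1 : ℂ) ⊗ₜ[ℝ] vec b' (intVec m)) / τ)) := by
    rw [← (hC τ hτ _).2]
    congr 1; funext x
    rw [← e_add, map_add, baseChange_one_tmul, one_mul, hsymm.eq, hpair, add_assoc]
  have h := hasSum_poisson (continuous_gaussian b τ ζ) (hC τ hτ ζ).1 one_pos hK hbd ?_ x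
  · refine h.congr_fun fun m => ?_
    rw [hint, hpair]
  · simp_rw [hint]
    refine Summable.mul_left _ ?_
    have hm := expTame_coset hsymm hpos b' 0
    simp only [zero_add] at hm
    have h1 := (summable_expSeries hm (PolyBd.const 1)
      ((littleBd_coset hsymm hpos (fun v => vec b' (intVec v)) ζ).smul hm.1 (-1 / τ))
      (neg_inv_im hτ)).of_norm.mul_left (e (-(QC B ζ / τ)))
    refine h1.congr fun m => ?_
    rw [one_mul, ← e_add, QC_add hsymm, QC_one_tmul]
    congr 1
    field_simp
    ring

end Inversion

/-! ### Sums over residue classes -/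

/-- The integers, as a subring of `ℝ`. -/
abbrev IntR : Subring ℝ := (Int.castRingHom ℝ).range

lemma int_mem_IntR (k : ℤ) : (k : ℝ) ∈ IntR := ⟨k, rfl⟩

lemma mem_IntR {x : ℝ} : x ∈ IntR ↔ ∃ k : ℤ, x = k :=
  ⟨fun ⟨k, hk⟩ => ⟨k, hk.symm⟩, fun ⟨k, hk⟩ => ⟨k, hk.symm⟩⟩

lemma e_eq_of_sub_mem {x y : ℝ} (h : x - y ∈ IntR) : e x = e y := by
  obtain ⟨k, hk⟩ := h
  have : (x : ℂ) = y + (k : ℤ) := by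
    have h2 : x = y + k := by simp at hk; linarith
    rw [h2]; push_cast; rfl
  rw [this, e_add, e_int, mul_one]

lemma e_eq_one_of_mem {x : ℝ} (h : x ∈ IntR) : e x = 1 := by
  have := e_eq_of_sub_mem (x := x) (y := 0) (by simpa using h)
  rw [this, Complex.ofReal_zero, e_zero]

lemma mem_of_e_eq_one {x : ℝ} (h : e x = 1) : x ∈ IntR := by
  rw [e, Complex.exp_eq_one_iff] at h
  obtain ⟨k, hk⟩ := h
  have h2 : (2 * Real.pi * Complex.I : ℂ) ≠ 0 := Complex.two_pi_I_ne_zero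
  have h3 : (x : ℂ) = k := mul_left_cancel₀ h2 (by rw [hk]; ring)
  exact ⟨k, by exact_mod_cast h3.symm⟩

section Residues

variable {n : ℕ} (c : ℕ)

/-- The representatives with coordinates in `{0, …, c - 1}` of the classes modulo `c`. -/
def residueRep (ρ : Fin n → ZMod c) : Fin n → ℤ := fun i => ((ρ i).cast : ℤ)

variable {c}

lemma eq_of_residue {g : (Fin n → ℤ) → ℂ} (hg : ∀ v w : Fin n → ℤ, g (v + (c : ℤ) • w) = g v)
    {v v' : Fin n → ℤ} (h : ∀ i, ((v i : ℤ) : ZMod c) = v' i) : g v = g v' := by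
  have h1 (i) : ∃ k : ℤ, v i = v' i + c * k := by
    obtain ⟨k, hk⟩ := (ZMod.intCast_eq_intCast_iff_dvd_sub _ _ _).1 (h i).symm
    exact ⟨k, by linarith⟩
  choose k hk using h1
  have : v = v' + (c : ℤ) • k := funext fun i => by simp [hk]
  rw [this, hg]

variable (c) [NeZero c]

/-- The sum of a function over the representatives of the classes modulo `c`. -/
def residueSum (g : (Fin n → ℤ) → ℂ) : ℂ := ∑ ρ : Fin n → ZMod c, g (residueRep c ρ)

variable {c}

/-- A permutation of the classes modulo `c` does not change the sum of a periodic function. -/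
lemma residueSum_comp {g : (Fin n → ℤ) → ℂ} (hg : ∀ v w : Fin n → ℤ, g (v + (c : ℤ) • w) = g v)
    (E : (Fin n → ZMod c) ≃ (Fin n → ZMod c)) (φ : (Fin n → ℤ) → (Fin n → ℤ))
    (hφ : ∀ ρ i, ((φ (residueRep c ρ) i : ℤ) : ZMod c) = E ρ i) :
    residueSum c (fun v => g (φ v)) = residueSum c g := by
  unfold residueSum
  rw [← E.sum_comp fun ρ => g (residueRep c ρ)]
  refine Finset.sum_congr rfl fun ρ _ => eq_of_residue hg fun i => ?_
  rw [hφ]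
  simp [residueRep]

lemma residueSum_add {g : (Fin n → ℤ) → ℂ} (hg : ∀ v w : Fin n → ℤ, g (v + (c : ℤ) • w) = g v)
    (s : Fin n → ℤ) : residueSum c (fun v => g (v + s)) = residueSum c g :=
  residueSum_comp hg (Equiv.addRight fun i => (s i : ZMod c)) (fun v => v + s)
    fun ρ i => by simp [residueRep]

lemma residueSum_mul {g : (Fin n → ℤ) → ℂ} (hg : ∀ v w : Fin n → ℤ, g (v + (c : ℤ) • w) = g v)
    {a d : ℤ} (had : ((a * d : ℤ) : ZMod c) = 1) :
    residueSum c (fun v => g (a • v)) = residueSum c g := by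
  push_cast at had
  refine residueSum_comp hg
    ⟨fun ρ i => a * ρ i, fun ρ i => d * ρ i, fun ρ => ?_, fun ρ => ?_⟩ (fun v => a • v)
    fun ρ i => by simp [residueRep]
  · funext i; simp only; rw [← mul_assoc, mul_comm (d : ZMod c), had, one_mul]
  · funext i; simp only; rw [← mul_assoc, had, one_mul]

/-- Splitting a sum over `ℤⁿ` into the classes modulo `c`. -/
lemma tsum_eq_sum_residues {F : (Fin n → ℤ) → ℂ} (hF : Summable F) :
    ∑' v, F v = ∑ ρ : Fin n → ZMod c, ∑' w : Fin n → ℤ, F (residueRep c ρ + (c : ℤ) • w) := by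
  have hc : (c : ℤ) ≠ 0 := by exact_mod_cast NeZero.ne c
  have hbij : Function.Bijective fun x : (Fin n → ZMod c) × (Fin n → ℤ) =>
      residueRep c x.1 + (c : ℤ) • x.2 := by
    constructor
    · rintro ⟨ρ, w⟩ ⟨ρ', w'⟩ h
      have h1 (i) : (residueRep c ρ + (c : ℤ) • w) i = (residueRep c ρ' + (c : ℤ) • w') i :=
        congrFun h i
      have h2 : ρ = ρ' := funext fun i => by
        have := congrArg (Int.cast : ℤ → ZMod c) (h1 i)
        simpa [residueRep] using this
      subst h2
      refine Prod.ext rfl (funext fun i => ?_)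
      have := h1 i
      simpa [NeZero.ne c] using this
    · intro v
      have h1 (i) : ∃ k : ℤ, v i = residueRep c (fun i => (v i : ZMod c)) i + c * k := by
        have : ((residueRep c (fun i => (v i : ZMod c)) i : ℤ) : ZMod c) = v i := by
          simp [residueRep]
        obtain ⟨k, hk⟩ := (ZMod.intCast_eq_intCast_iff_dvd_sub _ _ _).1 this
        exact ⟨k, by linarith⟩
      choose k hk using h1
      exact ⟨(fun i => (v i : ZMod c), k), funext fun i => by simp [← hk]⟩
  let E := Equiv.ofBijective _ hbij
  have h1 : Summable (F ∘ E) := E.summable_iff.2 hF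
  rw [← E.tsum_eq, show ∑' x, F (E x) = ∑' x, (F ∘ E) x from rfl, h1.tsum_prod, tsum_fintype]
  rfl

end Residues

/-! ### The theta series of the lattice under `Γ₀(N)` -/

section Transformation

variable {V : Type*} [AddCommGroup V] [Module ℝ V] {B : LinearMap.BilinForm ℝ V} {n : ℕ}

/-- The lattice vector with the integral coordinates `v` in the basis `b`. -/
abbrev lam (b : Module.Basis (Fin n) ℝ V) (v : Fin n → ℤ) : V := vec b (intVec v)

lemma lam_add (b : Module.Basis (Fin n) ℝ V) (v w : Fin n → ℤ) :
    lam b (v + w) = lam b v + lam b w := by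
  rw [lam, lam, lam, vec, ← map_add]
  congr 1
  funext i
  simp [intVec]

lemma lam_smul (b : Module.Basis (Fin n) ℝ V) (k : ℤ) (v : Fin n → ℤ) :
    lam b (k • v) = (k : ℝ) • lam b v := by
  rw [lam, lam, vec, ← map_smul]
  congr 1
  funext i
  simp [intVec]

lemma lam_injective (b : Module.Basis (Fin n) ℝ V) : Function.Injective (lam b) := by
  intro v w h
  have := b.equivFun.symm.injective h
  funext i
  have h2 := congrFun this i
  simpa [intVec] using h2

lemma lam_single (b : Module.Basis (Fin n) ℝ V) (i : Fin n) : lam b (Pi.single i 1) = b i := by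
  rw [lam, vec_eq]
  simp [intVec, Pi.single_apply]

/-- The lattice theta series `θ_{0,0}(τ, z)`, summed over integral coordinates. -/
def theta0 (B : LinearMap.BilinForm ℝ V) (b : Module.Basis (Fin n) ℝ V) (τ : ℂ)
    (z : ℂ ⊗[ℝ] V) : ℂ :=
  expSeries (fun _ : Fin n → ℤ => 1) (fun v => Q B (lam b v))
    (fun v => B.baseChange ℂ ((1 : ℂ) ⊗ₜ[ℝ] lam b v) z) τ

lemma hasSum_theta0 (hsymm : B.IsSymm) (hpos : ∀ x : V, x ≠ 0 → 0 < B x x)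
    (b : Module.Basis (Fin n) ℝ V) {τ : ℂ} (hτ : 0 < τ.im) (z : ℂ ⊗[ℝ] V) :
    HasSum (fun v : Fin n → ℤ => e (τ * Q B (lam b v) +
      B.baseChange ℂ ((1 : ℂ) ⊗ₜ[ℝ] lam b v) z)) (theta0 B b τ z) := by
  have hm := expTame_coset hsymm hpos b 0
  simp only [zero_add] at hm
  have := hasSum_expSeries hm (PolyBd.const 1)
    (littleBd_coset hsymm hpos (fun v => lam b v) z) hτ
  simp only [one_mul] at this
  exact this

lemma theta0_neg (b : Module.Basis (Fin n) ℝ V) (τ : ℂ) (z : ℂ ⊗[ℝ] V) :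
    theta0 B b τ (-z) = theta0 B b τ z := by
  unfold theta0 expSeries
  rw [← (Equiv.neg (Fin n → ℤ)).tsum_eq]
  congr 1; funext v
  have : lam b (-v) = -lam b v := by
    have := lam_smul b (-1) v; simpa using this
  simp only [Equiv.neg_apply, this, Q_neg, TensorProduct.tmul_neg]
  simp

/-- The data of an even lattice `⊕ ℤ bᵢ` with dual basis `b'` and a multiple `N` of its level. -/
structure EvenLattice (B : LinearMap.BilinForm ℝ V) (b b' : Module.Basis (Fin n) ℝ V) (N : ℕ) :
    Prop where
  symm : B.IsSymm
  pos : ∀ x : V, x ≠ 0 → 0 < B x x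
  dual : ∀ i j, B (b' i) (b j) = if j = i then 1 else 0
  even : ∀ v : Fin n → ℤ, Q B (lam b v) ∈ IntR
  level : ∀ m : Fin n → ℤ, (N : ℝ) * Q B (lam b' m) ∈ IntR

namespace EvenLattice

variable {b b' : Module.Basis (Fin n) ℝ V} {N : ℕ}

lemma B_lam_lam (h : EvenLattice B b b' N) (v w : Fin n → ℤ) : B (lam b v) (lam b w) ∈ IntR := by
  have h1 := Q_add h.symm (lam b v) (lam b w)
  rw [← lam_add] at h1
  have h2 : B (lam b v) (lam b w) = Q B (lam b (v + w)) - Q B (lam b v) - Q B (lam b w) := by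
    linarith
  rw [h2]
  exact sub_mem (sub_mem (h.even _) (h.even _)) (h.even _)

lemma B_dual_lam (h : EvenLattice B b b' N) (m v : Fin n → ℤ) : B (lam b' m) (lam b v) ∈ IntR := by
  have : B (lam b' m) (lam b v) = ∑ i, (m i : ℝ) * v i := by
    rw [B_vec_left, lam, vec_eq]
    simp [h.dual, intVec]
  rw [this]
  exact sum_mem fun i _ => mul_mem (int_mem_IntR _) (int_mem_IntR _)

/-- The polarization of the level condition. -/
lemma level_B (h : EvenLattice B b b' N) (m m' : Fin n → ℤ) :
    (N : ℝ) * B (lam b' m) (lam b' m') ∈ IntR := by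
  have h1 := Q_add h.symm (lam b' m) (lam b' m')
  rw [← lam_add] at h1
  have h2 : (N : ℝ) * B (lam b' m) (lam b' m') = N * Q B (lam b' (m + m')) - N * Q B (lam b' m) -
      N * Q B (lam b' m') := by
    rw [h1]; ring
  rw [h2]
  exact sub_mem (sub_mem (h.level _) (h.level _)) (h.level _)

lemma repr_b (h : EvenLattice B b b' N) (w : V) (i : Fin n) : b.repr w i = B (b' i) w := by
  conv_rhs => rw [← b.sum_repr w, map_sum]
  simp [h.dual, -Module.Basis.sum_repr]

lemma repr_b' (h : EvenLattice B b b' N) (w : V) (i : Fin n) : b'.repr w i = B w (b i) := by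
  conv_rhs => rw [← b'.sum_repr w]
  simp [h.dual, -Module.Basis.sum_repr]

/-- The lattice is the dual of its dual: it consists of the vectors that pair integrally with the
dual basis. -/
lemma exists_lam (h : EvenLattice B b b' N) (w : V) (hw : ∀ i, B (b' i) w ∈ IntR) :
    ∃ v, w = lam b v := by
  choose v hv using hw
  refine ⟨v, ?_⟩
  rw [LinearEquiv.eq_symm_apply]
  funext i
  rw [Module.Basis.equivFun_apply, h.repr_b, ← hv]
  simp [intVec]

/-- The dual lattice consists of the vectors that pair integrally with the basis of the lattice. -/
lemma exists_lam' (h : EvenLattice B b b' N) (w : V) (hw : ∀ i, B w (b i) ∈ IntR) :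
    ∃ v, w = lam b' v := by
  choose v hv using hw
  refine ⟨v, ?_⟩
  rw [LinearEquiv.eq_symm_apply]
  funext i
  rw [Module.Basis.equivFun_apply, h.repr_b', ← hv]
  simp [intVec]

end EvenLattice

end Transformation

section Transformation

variable {V : Type*} [AddCommGroup V] [Module ℝ V] {B : LinearMap.BilinForm ℝ V} {n : ℕ}

/-- The quadratic Gauss sum `∑ 𝔢(a Q(ρ) / c)` over the lattice modulo `c`. -/
def gaussSum (B : LinearMap.BilinForm ℝ V) (b : Module.Basis (Fin n) ℝ V) (a : ℤ) (c : ℕ)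
    [NeZero c] : ℂ :=
  residueSum c fun v => e ((a * Q B (lam b v) / c : ℝ) : ℂ)

namespace EvenLattice

variable {b b' : Module.Basis (Fin n) ℝ V} {N : ℕ}

/-- The summands of the Gauss sums with a linear term are periodic. -/
lemma gauss_periodic (h : EvenLattice B b b' N) (a : ℤ) (c : ℕ) [NeZero c] (m : Fin n → ℤ)
    (v w : Fin n → ℤ) :
    e (((a * Q B (lam b (v + (c : ℤ) • w)) - B (lam b' m) (lam b (v + (c : ℤ) • w))) / c : ℝ) : ℂ) =
      e (((a * Q B (lam b v) - B (lam b' m) (lam b v)) / c : ℝ) : ℂ) := by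
  apply e_eq_of_sub_mem
  have hc : (c : ℝ) ≠ 0 := by exact_mod_cast NeZero.ne c
  have h1 : (a * Q B (lam b (v + (c : ℤ) • w)) - B (lam b' m) (lam b (v + (c : ℤ) • w))) / c -
      (a * Q B (lam b v) - B (lam b' m) (lam b v)) / c =
      (a : ℝ) * (((c : ℤ) : ℝ) * Q B (lam b w)) + a * B (lam b v) (lam b w) -
        B (lam b' m) (lam b w) := by
    rw [lam_add, lam_smul, Q_add h.symm, Q_smul]
    simp only [map_add, map_smul, smul_eq_mul, Int.cast_natCast]
    field_simp
    ring
  rw [h1]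
  exact sub_mem (add_mem (mul_mem (int_mem_IntR _) (mul_mem (int_mem_IntR _) (h.even _)))
    (mul_mem (int_mem_IntR _) (h.B_lam_lam _ _))) (h.B_dual_lam _ _)

lemma gauss_periodic_zero (h : EvenLattice B b b' N) (a : ℤ) (c : ℕ) [NeZero c]
    (v w : Fin n → ℤ) :
    e ((a * Q B (lam b (v + (c : ℤ) • w)) / c : ℝ) : ℂ) =
      e ((a * Q B (lam b v) / c : ℝ) : ℂ) := by
  have := h.gauss_periodic a c 0 v w
  have h0 : lam b' 0 = 0 := by
    have := lam_smul b' 0 0; simpa using this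
  simpa [h0] using this

/-- Completing the square in a Gauss sum with a linear term from the lattice. -/
lemma gauss_of_mem (h : EvenLattice B b b' N) {a b₀ d : ℤ} {c : ℕ} [NeZero c]
    (hdet : a * d - b₀ * c = 1) {m w : Fin n → ℤ} (hm : lam b' m = lam b w) :
    e ((d * Q B (lam b' m) / c : ℝ) : ℂ) *
      residueSum c (fun v => e (((a * Q B (lam b v) - B (lam b' m) (lam b v)) / c : ℝ) : ℂ)) =
      gaussSum B b a c := by
  rw [← residueSum_add (fun v w => h.gauss_periodic a c m v w) (d • w), residueSum,
    Finset.mul_sum, gaussSum, residueSum]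
  refine Finset.sum_congr rfl fun ρ _ => ?_
  rw [← e_add, ← Complex.ofReal_add]
  apply e_eq_of_sub_mem
  have hc : (c : ℝ) ≠ 0 := by exact_mod_cast NeZero.ne c
  have hdet' : (a : ℝ) * d = 1 + b₀ * c := by
    have : a * d = 1 + b₀ * c := by linarith
    exact_mod_cast this
  generalize residueRep c ρ = v
  have h1 : (d * Q B (lam b' m) / c + (a * Q B (lam b (v + d • w)) -
      B (lam b' m) (lam b (v + d • w))) / c) - a * Q B (lam b v) / c =
      (b₀ : ℝ) * B (lam b v) (lam b w) + b₀ * (d * Q B (lam b w)) := by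
    have hw : B (lam b w) (lam b w) = 2 * Q B (lam b w) := by rw [Q]; ring
    rw [hm, lam_add, lam_smul, Q_add h.symm, Q_smul]
    simp only [map_add, map_smul, smul_eq_mul]
    rw [h.symm.eq (lam b w) (lam b v), hw]
    field_simp
    linear_combination (B (lam b v) (lam b w) + d * Q B (lam b w)) * hdet'
  rw [h1]
  exact add_mem (mul_mem (int_mem_IntR _) (h.B_lam_lam _ _))
    (mul_mem (int_mem_IntR _) (mul_mem (int_mem_IntR _) (h.even _)))

/-- A Gauss sum with a linear term outside the lattice vanishes if `N ∣ c`. -/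
lemma gauss_of_not_mem (h : EvenLattice B b b' N) (a : ℤ) {c : ℕ} [NeZero c] (hNc : N ∣ c)
    {m : Fin n → ℤ} (hm : ∀ w, lam b' m ≠ lam b w) :
    residueSum c (fun v => e (((a * Q B (lam b v) - B (lam b' m) (lam b v)) / c : ℝ) : ℂ)) = 0 := by
  obtain ⟨i, hi⟩ : ∃ i, B (b' i) (lam b' m) ∉ IntR := by
    by_contra hcon
    push Not at hcon
    obtain ⟨w, hw⟩ := h.exists_lam _ hcon
    exact hm w hw
  obtain ⟨q, rfl⟩ := hNc
  have hlev (m') : ((N * q : ℕ) : ℝ) * B (b' i) (lam b' m') ∈ IntR := by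
    have h1 := h.level_B (Pi.single i 1) m'
    rw [lam_single] at h1
    have h2 : ((N * q : ℕ) : ℝ) * B (b' i) (lam b' m') =
        ((q : ℤ) : ℝ) * (N * B (b' i) (lam b' m')) := by push_cast; ring
    rw [h2]
    exact mul_mem (int_mem_IntR _) h1
  obtain ⟨s, hs⟩ : ∃ s, ((N * q : ℕ) : ℝ) • b' i = lam b s := by
    refine h.exists_lam _ fun j => ?_
    have := hlev (Pi.single j 1)
    rw [lam_single] at this
    rw [map_smul, smul_eq_mul, h.symm.eq]
    exact this
  have hc : ((N * q : ℕ) : ℝ) ≠ 0 := by exact_mod_cast NeZero.ne (N * q)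
  set c := N * q with hcdef
  set G := residueSum c
    (fun v => e (((a * Q B (lam b v) - B (lam b' m) (lam b v)) / c : ℝ) : ℂ)) with hG
  -- the translation by `c b'ᵢ`, which lies in the lattice, multiplies the sum by a root of unity
  -- other than `1`
  have h1 : G = G * e ((-B (b' i) (lam b' m) : ℝ) : ℂ) := by
    conv_lhs => rw [hG, ← residueSum_add (fun v w => h.gauss_periodic a c m v w) s]
    rw [hG, residueSum, residueSum, Finset.sum_mul]
    refine Finset.sum_congr rfl fun ρ _ => ?_
    rw [← e_add, ← Complex.ofReal_add]
    apply e_eq_of_sub_mem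
    generalize residueRep c ρ = v
    have h2 : (a * Q B (lam b (v + s)) - B (lam b' m) (lam b (v + s))) / c -
        ((a * Q B (lam b v) - B (lam b' m) (lam b v)) / c + -B (b' i) (lam b' m)) =
        (a : ℝ) * B (b' i) (lam b v) + a * ((q : ℤ) * (N * Q B (b' i))) := by
      rw [lam_add, ← hs, Q_add h.symm, Q_smul]
      simp only [map_add, map_smul, smul_eq_mul]
      rw [h.symm.eq (lam b' m) (b' i), h.symm.eq (lam b v) (b' i)]
      have : ((c : ℕ) : ℝ) = N * q := by rw [hcdef]; push_cast; ring
      field_simp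
      rw [this]
      push_cast
      ring
    rw [h2]
    have h3 := h.B_dual_lam (Pi.single i 1) v
    have h4 := h.level (Pi.single i 1)
    rw [lam_single] at h3 h4
    exact add_mem (mul_mem (int_mem_IntR _) h3)
      (mul_mem (int_mem_IntR _) (mul_mem (int_mem_IntR _) h4))
  have h2 : e ((-B (b' i) (lam b' m) : ℝ) : ℂ) ≠ 1 := by
    intro h3
    have := neg_mem (mem_of_e_eq_one h3)
    rw [neg_neg] at this
    exact hi this
  have h3 : G * (1 - e ((-B (b' i) (lam b' m) : ℝ) : ℂ)) = 0 := by linear_combination h1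
  exact (mul_eq_zero.1 h3).resolve_right (sub_ne_zero.2 (Ne.symm h2))

/-- The Gauss sum is unchanged when `a` is replaced by its inverse modulo `c`. -/
lemma gaussSum_inv (h : EvenLattice B b b' N) {a b₀ d : ℤ} {c : ℕ} [NeZero c]
    (hdet : a * d - b₀ * c = 1) : gaussSum B b d c = gaussSum B b a c := by
  have had : ((a * d : ℤ) : ZMod c) = 1 := by
    have : a * d = 1 + b₀ * c := by linarith
    rw [this]; push_cast; simp
  rw [gaussSum, ← residueSum_mul (fun v w => h.gauss_periodic_zero d c v w) had, gaussSum]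
  unfold residueSum
  refine Finset.sum_congr rfl fun ρ _ => ?_
  apply e_eq_of_sub_mem
  generalize residueRep c ρ = v
  have hc : (c : ℝ) ≠ 0 := by exact_mod_cast NeZero.ne c
  have hdet' : (a : ℝ) * d = 1 + b₀ * c := by
    have : a * d = 1 + b₀ * c := by linarith
    exact_mod_cast this
  have h1 : d * Q B (lam b (a • v)) / c - a * Q B (lam b v) / c =
      (a : ℝ) * (b₀ * Q B (lam b v)) := by
    rw [lam_smul, Q_smul]
    field_simp
    linear_combination a * Q B (lam b v) * hdet'
  rw [h1]
  exact mul_mem (int_mem_IntR _) (mul_mem (int_mem_IntR _) (h.even _))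

lemma gaussSum_neg (a : ℤ) (c : ℕ) [NeZero c] :
    gaussSum B b (-a) c = (starRingEnd ℂ) (gaussSum B b a c) := by
  unfold gaussSum residueSum
  rw [map_sum]
  refine Finset.sum_congr rfl fun ρ _ => ?_
  simp only [e]
  rw [← Complex.exp_conj]
  congr 1
  have h2 : (starRingEnd ℂ) 2 = 2 := Complex.conj_ofNat 2
  simp [h2]
  ring

/-- The transformation law for `c > 0`, `N ∣ c`. -/
theorem theta0_moeb_pos (h : EvenLattice B b b' N) : ∃ C : ℝ, 0 < C ∧
    ∀ (γ : SL(2, ℤ)) (c : ℕ) [NeZero c], γ 1 0 = c → N ∣ c → ∀ (τ : ℂ), 0 < τ.im →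
      ∀ z : ℂ ⊗[ℝ] V, theta0 B b (moeb γ τ) ((autJ γ τ)⁻¹ • z) =
        C * (Complex.I / (-(c / autJ γ τ))) ^ ((n : ℂ) / 2) * gaussSum B b (γ 0 0) c *
          e (c * QC B z / autJ γ τ) * theta0 B b τ z := by
  obtain ⟨C, hC0, hC⟩ := theta_inversion h.symm h.pos b b' h.dual
  refine ⟨C, hC0, fun γ c _ hγ hNc τ hτ z => ?_⟩
  set J := autJ γ τ with hJ
  have hJ0 : J ≠ 0 := autJ_ne_zero γ hτ
  have hc : (c : ℂ) ≠ 0 := by exact_mod_cast NeZero.ne c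
  have hcr : (c : ℝ) ≠ 0 := by exact_mod_cast NeZero.ne c
  have hdet : γ 0 0 * γ 1 1 - γ 0 1 * c = 1 := by
    have := γ.det_coe
    rw [Matrix.det_fin_two, hγ] at this
    exact this
  set a := γ 0 0
  set d := γ 1 1 with hd
  have hJeq : J = c * τ + d := by rw [hJ, autJ, hγ]; push_cast; rfl
  set τ' : ℂ := -(c / J) with hτ'
  have hτ'im : 0 < τ'.im := by
    have h1 := neg_inv_im (τ := J / c) (by
      rw [Complex.div_natCast_im, hJeq]
      have : (0 : ℝ) < c := by exact_mod_cast Nat.pos_of_ne_zero (NeZero.ne c)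
      simp
      positivity)
    have h2 : τ' = -1 / (J / c) := by rw [hτ']; field_simp
    rw [h2]; exact h1
  set D := (C : ℂ) * (Complex.I / τ') ^ ((n : ℂ) / 2) with hD
  set ζ : ℂ ⊗[ℝ] V := (c / J : ℂ) • z with hζ
  -- as `a / c` contributes a function of the class modulo `c`, the theta series splits into `cⁿ`
  -- shifted theta series at `-c / J = c² · (-1 / (c J))`, to which the inversion formula applies
  have hmoeb : moeb γ τ = a / c - 1 / (c * J) := by
    have hdet' : (a : ℂ) * d = 1 + γ 0 1 * c := by
      have : a * d = 1 + γ 0 1 * c := by linarith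
      exact_mod_cast this
    rw [moeb, ← hJ, div_sub_div _ _ hc (mul_ne_zero hc hJ0), div_eq_div_iff hJ0
      (mul_ne_zero hc (mul_ne_zero hc hJ0))]
    change (a * τ + γ 0 1) * _ = _
    rw [hJeq]
    linear_combination (-(c : ℂ) * (c * τ + d)) * hdet'
  have hterm (ρ w : Fin n → ℤ) :
      e (moeb γ τ * Q B (lam b (ρ + (c : ℤ) • w)) +
        B.baseChange ℂ ((1 : ℂ) ⊗ₜ[ℝ] lam b (ρ + (c : ℤ) • w)) (J⁻¹ • z)) =
      e ((a * Q B (lam b ρ) / c : ℝ) : ℂ) *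
        e (τ' * Q B (vec b ((c : ℝ)⁻¹ • intVec ρ + intVec w)) +
          B.baseChange ℂ ((1 : ℂ) ⊗ₜ[ℝ] vec b ((c : ℝ)⁻¹ • intVec ρ + intVec w)) ζ) := by
    have h1 : lam b (ρ + (c : ℤ) • w) = (c : ℝ) • vec b ((c : ℝ)⁻¹ • intVec ρ + intVec w) := by
      rw [lam, vec, vec, ← map_smul]
      congr 1; funext i
      simp [intVec]
      field_simp
    rw [← h.gauss_periodic_zero a c ρ w, ← e_add]
    congr 1
    rw [h1, Q_smul, TensorProduct.tmul_smul, ← algebraMap_smul ℂ (c : ℝ), hmoeb, hζ]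
    simp only [map_smul, LinearMap.smul_apply, smul_eq_mul, hτ', Complex.coe_algebraMap,
      Complex.ofReal_natCast]
    push_cast
    field_simp
    ring
  have hW (m : Fin n → ℤ) :
      ∑ ρ : Fin n → ZMod c, e ((a * Q B (lam b (residueRep c ρ)) / c : ℝ) : ℂ) *
        (D * e (-(QC B (ζ + (1 : ℂ) ⊗ₜ[ℝ] vec b' (intVec m)) / τ')) *
          e (-(B (vec b' (intVec m)) (vec b ((c : ℝ)⁻¹ • intVec (residueRep c ρ))) : ℂ))) =
      (D * e (c * QC B z / J)) * ((e ((d * Q B (lam b' m) / c : ℝ) : ℂ) *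
        residueSum c (fun v => e (((a * Q B (lam b v) - B (lam b' m) (lam b v)) / c : ℝ) : ℂ))) *
        e (τ * Q B (lam b' m) + B.baseChange ℂ ((1 : ℂ) ⊗ₜ[ℝ] lam b' m) z)) := by
    have h1 : -(QC B (ζ + (1 : ℂ) ⊗ₜ[ℝ] vec b' (intVec m)) / τ') =
        c * QC B z / J + ((d * Q B (lam b' m) / c : ℝ) +
          (τ * Q B (lam b' m) + B.baseChange ℂ ((1 : ℂ) ⊗ₜ[ℝ] lam b' m) z)) := by
      rw [QC_add h.symm, QC_one_tmul, hζ, QC_smul]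
      simp only [map_smul, smul_eq_mul, hτ']
      push_cast
      field_simp
      rw [hJeq]
      ring
    rw [h1, e_add, e_add, residueSum, Finset.mul_sum, Finset.sum_mul, Finset.mul_sum]
    refine Finset.sum_congr rfl fun ρ _ => ?_
    have h2 : e (((a * Q B (lam b (residueRep c ρ)) - B (lam b' m) (lam b (residueRep c ρ))) / c
        : ℝ) : ℂ) = e ((a * Q B (lam b (residueRep c ρ)) / c : ℝ) : ℂ) *
        e (-(B (vec b' (intVec m)) (vec b ((c : ℝ)⁻¹ • intVec (residueRep c ρ))) : ℂ)) := by
      rw [← e_add]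
      congr 1
      rw [vec, vec, map_smul, map_smul]
      push_cast
      simp only [smul_eq_mul]
      push_cast
      field_simp
      ring
    rw [h2]
    ring
  have hsum := hasSum_theta0 h.symm h.pos b (moeb_im_pos γ hτ) (J⁻¹ • z)
  have hlhs : theta0 B b (moeb γ τ) (J⁻¹ • z) =
      ∑ ρ : Fin n → ZMod c, e ((a * Q B (lam b (residueRep c ρ)) / c : ℝ) : ℂ) *
        ∑' w : Fin n → ℤ, e (τ' * Q B (vec b ((c : ℝ)⁻¹ • intVec (residueRep c ρ) + intVec w)) +
          B.baseChange ℂ ((1 : ℂ) ⊗ₜ[ℝ]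
            vec b ((c : ℝ)⁻¹ • intVec (residueRep c ρ) + intVec w)) ζ) := by
    rw [← hsum.tsum_eq, tsum_eq_sum_residues (c := c) hsum.summable]
    refine Finset.sum_congr rfl fun ρ _ => ?_
    simp_rw [hterm]
    rw [tsum_mul_left]
  have h1 := hasSum_sum (s := Finset.univ) fun (ρ : Fin n → ZMod c) _ =>
    (hC τ' hτ'im ζ ((c : ℝ)⁻¹ • intVec (residueRep c ρ))).mul_left
      (e ((a * Q B (lam b (residueRep c ρ)) / c : ℝ) : ℂ))
  rw [← hlhs] at h1
  simp only [← hD, hW] at h1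
  -- only the dual vectors that lie in the lattice contribute
  have hex (v : Fin n → ℤ) : ∃ m, lam b v = lam b' m := by
    refine h.exists_lam' _ fun i => ?_
    have := h.B_lam_lam v (Pi.single i 1)
    rwa [lam_single] at this
  choose μ hμ using hex
  have hinj : Function.Injective μ := by
    intro v w hvw
    apply lam_injective b
    rw [hμ, hμ, hvw]
  rw [← hinj.hasSum_iff] at h1
  · have h2 := (hasSum_theta0 h.symm h.pos b hτ z).mul_left
      (D * e (c * QC B z / J) * gaussSum B b a c)
    have h3 := h1.unique (h2.congr_fun fun v => ?_)
    · rw [h3]; ring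
    · simp only [Function.comp]
      rw [h.gauss_of_mem hdet (hμ v).symm, ← hμ]
      ring
  · intro m hm
    rw [h.gauss_of_not_mem a hNc fun w hw => hm ⟨w, ?_⟩]
    · ring
    · apply lam_injective b'
      rw [← hμ, hw]

end EvenLattice

end Transformation

section Transformation

variable {V : Type*} [AddCommGroup V] [Module ℝ V] {B : LinearMap.BilinForm ℝ V} {n : ℕ}

/-- At `τ = i`, `z = 0` all terms of the theta series are positive. -/
lemma theta0_I_ne_zero (hsymm : B.IsSymm) (hpos : ∀ x : V, x ≠ 0 → 0 < B x x)
    (b : Module.Basis (Fin n) ℝ V) : theta0 B b Complex.I 0 ≠ 0 := by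
  have h := hasSum_theta0 hsymm hpos b (τ := Complex.I) (by simp) 0
  have h1 (v : Fin n → ℤ) : e (Complex.I * Q B (lam b v) +
      B.baseChange ℂ ((1 : ℂ) ⊗ₜ[ℝ] lam b v) 0) =
      ((Real.exp (-(2 * Real.pi * Q B (lam b v))) : ℝ) : ℂ) := by
    rw [e, Complex.ofReal_exp, map_zero, add_zero]
    congr 1
    push_cast
    linear_combination (2 * Real.pi * Q B (lam b v) : ℂ) * Complex.I_mul_I
  simp_rw [h1] at h
  rw [← h.tsum_eq, ← Complex.ofReal_tsum, Complex.ofReal_ne_zero]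
  have h2 := h.summable
  rw [Complex.summable_ofReal] at h2
  exact (h2.tsum_pos (fun _ => (Real.exp_pos _).le) 0 (Real.exp_pos _)).ne'

namespace EvenLattice

variable {b b' : Module.Basis (Fin n) ℝ V} {N : ℕ}

/-- The transformation law of `θ_{0,0}` under `Γ₀(N)`, with an automorphy factor `r` that is a
holomorphic square root of a unimodular multiple of the `n`-th power of the usual one. -/
def HasFactor (B : LinearMap.BilinForm ℝ V) (b : Module.Basis (Fin n) ℝ V) (γ : SL(2, ℤ)) : Prop :=
  ∃ (r : ℂ → ℂ) (u : ℂ), ‖u‖ = 1 ∧ DifferentiableOn ℂ r {τ | 0 < τ.im} ∧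
    (∀ τ, 0 < τ.im → r τ ^ 2 = u * autJ γ τ ^ n) ∧
    ∀ τ, 0 < τ.im → ∀ z : ℂ ⊗[ℝ] V, theta0 B b (moeb γ τ) ((autJ γ τ)⁻¹ • z) =
      r τ * e (γ 1 0 * QC B z / autJ γ τ) * theta0 B b τ z

/-- For `c = 0` the matrix is a translation up to sign, and the theta series is periodic and
even. -/
lemma hasFactor_zero (h : EvenLattice B b b' N) {γ : SL(2, ℤ)} (hγ : γ 1 0 = 0) :
    HasFactor B b γ := by
  have hdet : γ 0 0 * γ 1 1 = 1 := by
    have := γ.det_coe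
    rw [Matrix.det_fin_two, hγ, mul_zero, sub_zero] at this
    exact this
  have hJ (τ : ℂ) : autJ γ τ = γ 1 1 := by simp [autJ, hγ]
  have hd : γ 1 1 = 1 ∨ γ 1 1 = -1 := Int.isUnit_iff.1 (IsUnit.of_mul_eq_one_right _ hdet)
  have hshift (τ : ℂ) (k : ℤ) (z : ℂ ⊗[ℝ] V) : theta0 B b (τ + k) z = theta0 B b τ z := by
    unfold theta0 expSeries
    congr 1; funext v
    obtain ⟨j, hj⟩ := mem_IntR.1 (h.even v)
    simp only [hj]
    have : (τ + k) * ((j : ℝ) : ℂ) + B.baseChange ℂ ((1 : ℂ) ⊗ₜ[ℝ] lam b v) z =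
        τ * ((j : ℝ) : ℂ) + B.baseChange ℂ ((1 : ℂ) ⊗ₜ[ℝ] lam b v) z + ((k * j : ℤ) : ℂ) := by
      push_cast; ring
    rw [this, e_add _ (((k * j : ℤ) : ℂ)), e_int, mul_one]
  refine ⟨fun _ => 1, ((γ 1 1 : ℂ) ^ n)⁻¹, ?_, differentiableOn_const _, fun τ _ => ?_,
    fun τ _ z => ?_⟩
  · rcases hd with hd | hd <;> simp [hd]
  · rw [hJ, inv_mul_cancel₀]; · simp
    rcases hd with hd | hd <;> simp [hd]
  · rw [hJ, hγ, Int.cast_zero, zero_mul, zero_div, e_zero]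
    rcases hd with hd | hd
    · have h1 : γ 0 0 = 1 := by rw [hd] at hdet; linarith
      have : moeb γ τ = τ + (γ 0 1 : ℤ) := by
        rw [moeb, hJ, hd, h1]; simp
      rw [this, hshift, hd]; simp
    · have h1 : γ 0 0 = -1 := by rw [hd] at hdet; linarith
      have : moeb γ τ = τ + (-γ 0 1 : ℤ) := by
        rw [moeb, hJ, hd, h1]; push_cast; ring
      rw [this, hshift, hd]
      have h2 : ((-1 : ℤ) : ℂ)⁻¹ • z = -z := by simp
      rw [h2, theta0_neg]; simp

/-- For `c > 0` the law is that of `theta0_moeb_pos`. The absolute value of the Gauss sum need not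
be computed: it is determined by comparing `γ` with `-γ⁻¹`. -/
lemma hasFactor_pos (h : EvenLattice B b b' N) {γ : SL(2, ℤ)} {c : ℕ} [NeZero c] (hγ : γ 1 0 = c)
    (hNc : N ∣ c) : HasFactor B b γ := by
  obtain ⟨C, hC0, hC⟩ := h.theta0_moeb_pos
  have hc : (c : ℂ) ≠ 0 := by exact_mod_cast NeZero.ne c
  have hc0 : (0 : ℝ) < c := by exact_mod_cast Nat.pos_of_ne_zero (NeZero.ne c)
  obtain ⟨r, hr_def⟩ : ∃ r : SL(2, ℤ) → ℂ → ℂ, ∀ δ τ, r δ τ =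
      C * (Complex.I / (-(c / autJ δ τ))) ^ ((n : ℂ) / 2) * gaussSum B b (δ 0 0) c :=
    ⟨_, fun _ _ => rfl⟩
  obtain ⟨u, hu_def⟩ : ∃ u : SL(2, ℤ) → ℂ, ∀ δ, u δ =
      (C * gaussSum B b (δ 0 0) c) ^ 2 * (-Complex.I / c) ^ n := ⟨_, fun _ => rfl⟩
  have hbase (δ : SL(2, ℤ)) {τ : ℂ} (hτ : 0 < τ.im) :
      Complex.I / (-(c / autJ δ τ)) = -Complex.I / c * autJ δ τ := by
    have := autJ_ne_zero δ hτ
    field_simp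
  have hr (δ : SL(2, ℤ)) {τ : ℂ} (hτ : 0 < τ.im) : r δ τ ^ 2 = u δ * autJ δ τ ^ n := by
    have h1 : ((Complex.I / (-(c / autJ δ τ))) ^ ((n : ℂ) / 2)) ^ 2 =
        (-Complex.I / c * autJ δ τ) ^ n := by
      rw [← Complex.cpow_nat_mul, hbase δ hτ, ← Complex.cpow_natCast]
      congr 1; push_cast; ring
    rw [hr_def, hu_def]
    rw [mul_pow, mul_pow, h1, mul_pow, mul_pow]; ring
  have hdet : γ 0 0 * γ 1 1 - γ 0 1 * c = 1 := by
    have := γ.det_coe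
    rw [Matrix.det_fin_two, hγ] at this
    exact this
  -- the matrix `-γ⁻¹` has the same lower left entry and a conjugate Gauss sum
  let γ' : SL(2, ℤ) := ⟨!![-γ 1 1, γ 0 1; c, -γ 0 0], by
    rw [Matrix.det_fin_two_of]; linarith⟩
  have hγ'γ : γ' * γ = -1 := by
    ext i j
    rw [sl_mul_apply]
    fin_cases i <;> fin_cases j <;>
      simp [γ', hγ] <;> linarith
  have hu' : ‖u γ'‖ = ‖u γ‖ := by
    have h1 : ‖gaussSum B b (γ' 0 0) c‖ = ‖gaussSum B b (γ 0 0) c‖ := by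
      have : γ' 0 0 = -γ 1 1 := rfl
      rw [this, gaussSum_neg, RCLike.norm_conj, h.gaussSum_inv hdet]
    simp only [hu_def, norm_mul, norm_pow, h1]
  have hu : ‖u γ‖ = 1 := by
    have hI : (0 : ℝ) < Complex.I.im := by simp
    have hI' := moeb_im_pos γ hI
    -- apply the law for `γ` at `i` and the one for `-γ⁻¹` at `γ i`, with `z = 0`
    have e1 := hC γ c hγ hNc Complex.I hI 0
    have e2 := hC γ' c rfl hNc _ hI' 0
    have hmm : moeb γ' (moeb γ Complex.I) = Complex.I := by
      rw [← moeb_mul γ' γ hI, hγ'γ]; simp [moeb, autJ]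
    have hjj : autJ γ' (moeb γ Complex.I) * autJ γ Complex.I = -1 := by
      rw [← autJ_mul γ' γ hI, hγ'γ]; simp [autJ]
    have hQ0 : QC B (0 : ℂ ⊗[ℝ] V) = 0 := by simp [QC]
    rw [smul_zero, hQ0, mul_zero, zero_div, e_zero, mul_one] at e1 e2
    rw [hmm, e1] at e2
    rw [← hr_def, ← hr_def] at e2
    rw [← mul_assoc] at e2
    have e3 : r γ' (moeb γ Complex.I) * r γ Complex.I = 1 :=
      (mul_right_cancel₀ (theta0_I_ne_zero h.symm h.pos b) (by rw [one_mul]; exact e2)).symm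
    have e4 : u γ' * u γ * (-1) ^ n = 1 := by
      rw [← hjj]
      calc _ = (u γ' * autJ γ' (moeb γ Complex.I) ^ n) * (u γ * autJ γ Complex.I ^ n) := by ring
        _ = (r γ' (moeb γ Complex.I) * r γ Complex.I) ^ 2 := by
          rw [← hr γ' hI', ← hr γ hI, mul_pow]
        _ = 1 := by rw [e3, one_pow]
    have e5 := congrArg norm e4
    rw [norm_mul, norm_mul, hu', norm_pow, norm_neg, norm_one, one_pow, mul_one] at e5
    nlinarith [norm_nonneg (u γ)]
  refine ⟨r γ, u γ, hu, ?_, fun τ hτ => hr γ hτ, fun τ hτ z => ?_⟩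
  · have h1 : DifferentiableOn ℂ (fun τ => C * (-Complex.I / c * autJ γ τ) ^ ((n : ℂ) / 2) *
        gaussSum B b (γ 0 0) c) {τ | 0 < τ.im} := by
      intro τ hτ
      refine DifferentiableAt.differentiableWithinAt ?_
      refine (DifferentiableAt.const_mul ?_ _).mul_const _
      have hd : DifferentiableAt ℂ (fun τ => -Complex.I / c * autJ γ τ) τ :=
        (hasDerivAt_autJ γ τ).differentiableAt.const_mul _
      refine (hd.hasDerivAt.cpow_const ?_).differentiableAt
      left
      have hτ' : 0 < τ.im := hτ
      have : (-Complex.I / c * autJ γ τ).re = τ.im := by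
        rw [autJ, hγ]
        have h3 : -Complex.I / c * (((c : ℤ) : ℂ) * τ + (γ 1 1 : ℂ)) =
            -Complex.I * τ + -Complex.I * ((γ 1 1 / c : ℝ) : ℂ) := by
          push_cast; field_simp; ring
        rw [h3]; simp
      rw [this]; exact hτ'
    refine h1.congr fun τ hτ => ?_
    rw [hr_def, hbase γ hτ]
  · rw [hC γ c hγ hNc τ hτ z, hγ]
    rw [hr_def, Int.cast_natCast]

/-- The transformation law of `θ_{0,0}` under `Γ₀(N)`. -/
theorem hasFactor (h : EvenLattice B b b' N) {γ : SL(2, ℤ)} (hγ : (N : ℤ) ∣ γ 1 0) :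
    HasFactor B b γ := by
  rcases lt_trichotomy (γ 1 0) 0 with hlt | heq | hgt
  · have h10 : (-γ) 1 0 = -γ 1 0 := by rw [Matrix.SpecialLinearGroup.coe_neg, Matrix.neg_apply]
    have hneg : (-γ) 1 0 = ((γ 1 0).natAbs : ℤ) := by
      rw [Matrix.SpecialLinearGroup.coe_neg, Matrix.neg_apply]; omega
    have : NeZero (γ 1 0).natAbs := ⟨by omega⟩
    obtain ⟨r, u, hu, hr, hru, hθ⟩ := h.hasFactor_pos hneg (Int.natCast_dvd.1 hγ)
    have hJ (τ : ℂ) : autJ (-γ) τ = -autJ γ τ := by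
      simp [autJ, Matrix.SpecialLinearGroup.coe_neg]; ring
    have hm (τ : ℂ) : moeb (-γ) τ = moeb γ τ := by
      rw [moeb, hJ, moeb, Matrix.SpecialLinearGroup.coe_neg]
      rw [div_neg, ← neg_div]
      congr 1
      simp; ring
    refine ⟨r, u * (-1) ^ n, by simp [hu], hr, fun τ hτ => ?_, fun τ hτ z => ?_⟩
    · rw [hru τ hτ, hJ, neg_pow]; ring
    · have := hθ τ hτ (-z)
      rw [hm, hJ, theta0_neg, QC_neg, h10] at this
      rw [inv_neg, neg_smul, smul_neg, neg_neg] at this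
      rw [this]
      congr 3
      push_cast
      rw [neg_mul, neg_div_neg_eq]
  · exact h.hasFactor_zero heq
  · have hpos : γ 1 0 = ((γ 1 0).natAbs : ℤ) := by omega
    have : NeZero (γ 1 0).natAbs := ⟨by omega⟩
    exact h.hasFactor_pos hpos (Int.natCast_dvd.1 hγ)

end EvenLattice

end Transformation

/-! ### Theta series with characteristics -/

section Characteristics

variable {V : Type*} [AddCommGroup V] [Module ℝ V] {B : LinearMap.BilinForm ℝ V} {n : ℕ}

/-- The theta series `θ_{α,β}(τ, z)`, summed over integral coordinates. -/
def thetaChar (B : LinearMap.BilinForm ℝ V) (b : Module.Basis (Fin n) ℝ V) (α β : V) (τ : ℂ)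
    (z : ℂ ⊗[ℝ] V) : ℂ :=
  expSeries (fun v : Fin n → ℤ => e (B β (lam b v))) (fun v => Q B (α + lam b v))
    (fun v => B.baseChange ℂ ((1 : ℂ) ⊗ₜ[ℝ] (α + lam b v)) z) τ

lemma summable_thetaChar (hsymm : B.IsSymm) (hpos : ∀ x : V, x ≠ 0 → 0 < B x x)
    (b : Module.Basis (Fin n) ℝ V) (α β : V) {τ : ℂ} (hτ : 0 < τ.im) (z : ℂ ⊗[ℝ] V) :
    Summable fun v : Fin n → ℤ => ‖e (B β (lam b v)) * e (τ * Q B (α + lam b v) +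
      B.baseChange ℂ ((1 : ℂ) ⊗ₜ[ℝ] (α + lam b v)) z)‖ :=
  summable_expSeries (expTame_coset hsymm hpos b α) (PolyBd.of_bounded fun _ => (norm_e_real _).le)
    (littleBd_coset hsymm hpos _ z) hτ

lemma thetaChar_eq_theta0 (hsymm : B.IsSymm) (b : Module.Basis (Fin n) ℝ V) (α β : V) (τ : ℂ)
    (z : ℂ ⊗[ℝ] V) : thetaChar B b α β τ z =
      e (τ * Q B α + B.baseChange ℂ ((1 : ℂ) ⊗ₜ[ℝ] α) z) *
        theta0 B b τ (z + τ • ((1 : ℂ) ⊗ₜ[ℝ] α) + (1 : ℂ) ⊗ₜ[ℝ] β) := by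
  unfold thetaChar theta0 expSeries
  rw [← tsum_mul_left]
  congr 1; funext v
  rw [one_mul, ← e_add, ← e_add]
  congr 1
  simp only [Q_add hsymm, TensorProduct.tmul_add, map_add, LinearMap.add_apply, map_smul,
    smul_eq_mul, baseChange_one_tmul, one_mul]
  rw [hsymm.eq (lam b v) α, hsymm.eq (lam b v) β]
  push_cast
  ring

lemma thetaChar_add_lam (b : Module.Basis (Fin n) ℝ V) (α β : V) (w : Fin n → ℤ) (τ : ℂ)
    (z : ℂ ⊗[ℝ] V) : thetaChar B b (α + lam b w) β τ z =
      e (-(B β (lam b w) : ℂ)) * thetaChar B b α β τ z := by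
  unfold thetaChar expSeries
  rw [← tsum_mul_left, ← (Equiv.addLeft w).tsum_eq fun v => e (-(B β (lam b w) : ℂ)) *
    (e (B β (lam b v)) * e (τ * Q B (α + lam b v) +
      B.baseChange ℂ ((1 : ℂ) ⊗ₜ[ℝ] (α + lam b v)) z))]
  congr 1; funext v
  simp only [Equiv.coe_addLeft, lam_add, ← add_assoc, map_add]
  rw [← mul_assoc, ← e_add (-(B β (lam b w) : ℂ))]
  congr 2
  push_cast; ring

lemma thetaChar_congr (b : Module.Basis (Fin n) ℝ V) (α : V) {β β' : V}
    (hβ : ∀ v, B (β' - β) (lam b v) ∈ IntR) (τ : ℂ) (z : ℂ ⊗[ℝ] V) :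
    thetaChar B b α β' τ z = thetaChar B b α β τ z := by
  unfold thetaChar expSeries
  congr 1; funext v
  congr 1
  apply e_eq_of_sub_mem
  have := hβ v
  rwa [map_sub, LinearMap.sub_apply] at this

/-- Admissible characteristics, in coordinates. -/
structure Admissible (B : LinearMap.BilinForm ℝ V) (b b' : Module.Basis (Fin n) ℝ V) (N' : ℕ)
    (α β : V) : Prop where
  left : ∃ m, α = lam b' m
  norm : (N' : ℝ) * Q B α ∈ IntR
  right : ∃ m w, β = lam b' m + (N' : ℝ)⁻¹ • lam b w

variable {b b' : Module.Basis (Fin n) ℝ V} {N : ℕ}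

lemma EvenLattice.smul_dual (h : EvenLattice B b b' N) {k : ℤ} (hk : (N : ℤ) ∣ k) (m : Fin n → ℤ) :
    ∃ v, (k : ℝ) • lam b' m = lam b v := by
  obtain ⟨q, rfl⟩ := hk
  refine h.exists_lam _ fun i => ?_
  have := mul_mem (int_mem_IntR q) (h.level_B (Pi.single i 1) m)
  rw [lam_single] at this
  rw [map_smul, smul_eq_mul]
  push_cast
  rwa [mul_comm (N : ℝ), mul_assoc]

/-- A multiple by `k` of an admissible `β` is in the lattice if `N ∣ k`. -/
lemma EvenLattice.smul_right (h : EvenLattice B b b' N) {N' : ℕ} (hN'0 : N' ≠ 0) (hN' : N' ∣ N)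
    {k : ℤ} (hk : (N : ℤ) ∣ k) (m w : Fin n → ℤ) :
    ∃ v, (k : ℝ) • (lam b' m + (N' : ℝ)⁻¹ • lam b w) = lam b v := by
  obtain ⟨v, hv⟩ := h.smul_dual hk m
  obtain ⟨q, hq⟩ := (Int.natCast_dvd_natCast.2 hN').trans hk
  refine ⟨v + q • w, ?_⟩
  have h0 : (N' : ℝ) ≠ 0 := by exact_mod_cast hN'0
  rw [smul_add, hv, lam_add, lam_smul, smul_smul, hq]
  congr 2
  push_cast; field_simp

/-- Transformation of the theta series with characteristics, for admissible characteristics and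
`γ ∈ Γ₁(N)`; the root of unity `ξ` disappears in the `N'`-th power. -/
theorem EvenLattice.thetaChar_moeb (h : EvenLattice B b b' N) {N' : ℕ} (hN'0 : N' ≠ 0)
    (hN' : N' ∣ N) {γ : SL(2, ℤ)} (hγ : γ ∈ CongruenceSubgroup.Gamma1 N) {r : ℂ → ℂ}
    (hr : ∀ τ, 0 < τ.im → ∀ z : ℂ ⊗[ℝ] V, theta0 B b (moeb γ τ) ((autJ γ τ)⁻¹ • z) =
      r τ * e (γ 1 0 * QC B z / autJ γ τ) * theta0 B b τ z) {α β : V}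
    (hαβ : Admissible B b b' N' α β) : ∃ ξ : ℂ, ξ ^ N' = 1 ∧ ∀ τ, 0 < τ.im → ∀ z : ℂ ⊗[ℝ] V,
      thetaChar B b α β (moeb γ τ) ((autJ γ τ)⁻¹ • z) =
        ξ * (r τ * e (γ 1 0 * QC B z / autJ γ τ)) * thetaChar B b α β τ z := by
  obtain ⟨⟨mα, hmα⟩, hQα, ⟨mβ, wβ, hβ⟩⟩ := hαβ
  rw [CongruenceSubgroup.Gamma1_mem] at hγ
  obtain ⟨ha, hd, hc⟩ := hγ
  have ha' : (N : ℤ) ∣ γ 0 0 - 1 := by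
    rw [← ZMod.intCast_eq_intCast_iff_dvd_sub]; simpa using ha.symm
  have hd' : (N : ℤ) ∣ γ 1 1 - 1 := by
    rw [← ZMod.intCast_eq_intCast_iff_dvd_sub]; simpa using hd.symm
  have hc' : (N : ℤ) ∣ γ 1 0 := by rwa [← ZMod.intCast_zmod_eq_zero_iff_dvd]
  have hdet : γ 0 0 * γ 1 1 - γ 0 1 * γ 1 0 = 1 := by
    have := γ.det_coe
    rwa [Matrix.det_fin_two] at this
  have hJ (τ : ℂ) : autJ γ τ = γ 1 0 * τ + γ 1 1 := rfl
  have hM (τ : ℂ) : moeb γ τ = (γ 0 0 * τ + γ 0 1) / autJ γ τ := rfl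
  have hJ0 (τ : ℂ) (hτ : 0 < τ.im) : autJ γ τ ≠ 0 := autJ_ne_zero γ hτ
  generalize γ 0 0 = a at *
  generalize γ 0 1 = b₀ at *
  generalize γ 1 0 = c at *
  generalize γ 1 1 = d at *
  have h0 : (N' : ℝ) ≠ 0 := by exact_mod_cast hN'0
  obtain ⟨ℓ₁, hℓ₁⟩ := h.smul_dual ha' mα
  obtain ⟨ℓ₂, hℓ₂⟩ := h.smul_right hN'0 hN' hc' mβ wβ
  obtain ⟨ℓ₃, hℓ₃⟩ := h.smul_right hN'0 hN' hd' mβ wβ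
  rw [← hmα] at hℓ₁
  rw [← hβ] at hℓ₂ hℓ₃
  -- the transformation moves the characteristics to `(α', β') = (α, β) γ`, which are congruent to
  -- `(α, β)` as `γ ∈ Γ₁(N)`
  set α' := (a : ℝ) • α + (c : ℝ) • β with hα'
  set β' := (b₀ : ℝ) • α + (d : ℝ) • β with hβ'
  have hαℓ : α' = α + lam b (ℓ₁ + ℓ₂) := by
    rw [lam_add, ← hℓ₁, ← hℓ₂, hα']; push_cast; module
  have hββ : ∀ v, B (β' - β) (lam b v) ∈ IntR := by
    intro v
    have : β' - β = (b₀ : ℝ) • α + lam b ℓ₃ := by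
      rw [← hℓ₃, hβ']; push_cast; module
    rw [this, map_add, LinearMap.add_apply, map_smul, LinearMap.smul_apply, smul_eq_mul, hmα]
    exact add_mem (mul_mem (int_mem_IntR _) (h.B_dual_lam _ _)) (h.B_lam_lam _ _)
  set E : ℝ := a * b₀ * Q B α + b₀ * c * B α β + c * d * Q B β with hE
  refine ⟨e ((E - B β' (lam b (ℓ₁ + ℓ₂)) : ℝ) : ℂ), ?_, fun τ hτ z => ?_⟩
  · rw [← e_nsmul]
    have hcast : (N' : ℂ) * ((E - B β' (lam b (ℓ₁ + ℓ₂)) : ℝ) : ℂ) =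
      ((N' * (E - B β' (lam b (ℓ₁ + ℓ₂))) : ℝ) : ℂ) := by push_cast; ring
    rw [hcast]
    apply e_eq_one_of_mem
    obtain ⟨q, hq⟩ := (Int.natCast_dvd_natCast.2 hN').trans hc'
    have hq' : (c : ℝ) = N' * q := by rw [hq]; push_cast; ring
    obtain ⟨p, hp⟩ := hc'
    have hp' : (c : ℝ) = N * p := by rw [hp]; push_cast; ring
    have i1 : (c : ℝ) * B α (lam b' mβ) ∈ IntR := by
      rw [hmα, hp', mul_comm (N : ℝ), mul_assoc]
      exact mul_mem (int_mem_IntR _) (h.level_B _ _)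
    have i2 : B α (lam b wβ) ∈ IntR := by rw [hmα]; exact h.B_dual_lam _ _
    have i3 : (c : ℝ) * Q B (lam b' mβ) ∈ IntR := by
      rw [hp', mul_comm (N : ℝ), mul_assoc]
      exact mul_mem (int_mem_IntR _) (h.level _)
    have i4 : ∀ v, (N' : ℝ) * B β' (lam b v) ∈ IntR := by
      intro v
      have : (N' : ℝ) * B β' (lam b v) = ((N' : ℤ) : ℝ) * (b₀ * B α (lam b v)) +
          ((N' : ℤ) : ℝ) * (d * B (lam b' mβ) (lam b v)) + d * B (lam b wβ) (lam b v) := by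
        rw [hβ', hβ]
        simp only [map_add, LinearMap.add_apply, map_smul, LinearMap.smul_apply, smul_eq_mul]
        push_cast
        field_simp
        ring
      rw [this, hmα]
      exact add_mem (add_mem
        (mul_mem (int_mem_IntR _) (mul_mem (int_mem_IntR _) (h.B_dual_lam _ _)))
        (mul_mem (int_mem_IntR _) (mul_mem (int_mem_IntR _) (h.B_dual_lam _ _))))
        (mul_mem (int_mem_IntR _) (h.B_lam_lam _ _))
    have hsplit : (N' : ℝ) * (E - B β' (lam b (ℓ₁ + ℓ₂))) =
        (a : ℝ) * (b₀ * (N' * Q B α)) +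
        (((N' : ℤ) : ℝ) * (b₀ * (c * B α (lam b' mβ))) + (b₀ : ℝ) * (c * B α (lam b wβ))) +
        (((N' : ℤ) : ℝ) * (d * (c * Q B (lam b' mβ))) + (q : ℝ) * (d * Q B (lam b wβ)) +
          (c : ℝ) * (d * B (lam b' mβ) (lam b wβ))) -
        N' * B β' (lam b (ℓ₁ + ℓ₂)) := by
      rw [hE]
      have hBβ : B α β = B α (lam b' mβ) + (N' : ℝ)⁻¹ * B α (lam b wβ) := by
        rw [hβ, map_add, map_smul, smul_eq_mul]
      have hQβ : Q B β = Q B (lam b' mβ) + (N' : ℝ)⁻¹ ^ 2 * Q B (lam b wβ) +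
          (N' : ℝ)⁻¹ * B (lam b' mβ) (lam b wβ) := by
        rw [hβ, Q_add h.symm, Q_smul, map_smul, smul_eq_mul]
      have hqq : (q : ℝ) = c / N' := by rw [hq']; field_simp
      rw [hBβ, hQβ, hqq]
      push_cast
      field_simp
    rw [hsplit]
    refine sub_mem (add_mem (add_mem ?_ (add_mem ?_ ?_)) (add_mem (add_mem ?_ ?_) ?_)) (i4 _)
    · exact mul_mem (int_mem_IntR _) (mul_mem (int_mem_IntR _) hQα)
    · exact mul_mem (int_mem_IntR _) (mul_mem (int_mem_IntR _) i1)
    · exact mul_mem (int_mem_IntR _) (mul_mem (int_mem_IntR _) i2)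
    · exact mul_mem (int_mem_IntR _) (mul_mem (int_mem_IntR _) i3)
    · exact mul_mem (int_mem_IntR _) (mul_mem (int_mem_IntR _) (h.even _))
    · exact mul_mem (int_mem_IntR _) (mul_mem (int_mem_IntR _) (h.B_dual_lam _ _))
  · have hJτ := hJ0 τ hτ
    have hchar : thetaChar B b α' β' τ z =
        e (-(B β' (lam b (ℓ₁ + ℓ₂)) : ℂ)) * thetaChar B b α β τ z := by
      rw [hαℓ, thetaChar_add_lam, thetaChar_congr b α hββ]
    have hmain : thetaChar B b α β (moeb γ τ) ((autJ γ τ)⁻¹ • z) =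
        e E * (r τ * e (c * QC B z / autJ γ τ)) * thetaChar B b α' β' τ z := by
      rw [thetaChar_eq_theta0 h.symm, thetaChar_eq_theta0 h.symm]
      set y : ℂ ⊗[ℝ] V := z + τ • ((1 : ℂ) ⊗ₜ[ℝ] α') + (1 : ℂ) ⊗ₜ[ℝ] β' with hy
      have hy2 : (autJ γ τ)⁻¹ • z + moeb γ τ • ((1 : ℂ) ⊗ₜ[ℝ] α) + (1 : ℂ) ⊗ₜ[ℝ] β =
          (autJ γ τ)⁻¹ • y := by
        have e1 (x : ℝ) (v : V) : (1 : ℂ) ⊗ₜ[ℝ] (x • v) = (x : ℂ) • ((1 : ℂ) ⊗ₜ[ℝ] v) := by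
          rw [TensorProduct.tmul_smul, ← algebraMap_smul ℂ x]; rfl
        have e2 : (1 : ℂ) ⊗ₜ[ℝ] β = ((autJ γ τ)⁻¹ * autJ γ τ) • ((1 : ℂ) ⊗ₜ[ℝ] β) := by
          rw [inv_mul_cancel₀ hJτ, one_smul]
        rw [e2, hy, hα', hβ', TensorProduct.tmul_add, TensorProduct.tmul_add, e1, e1, e1, e1, hM,
          hJ]
        push_cast
        module
      rw [hy2, hr τ hτ]
      have hexp : moeb γ τ * Q B α + B.baseChange ℂ ((1 : ℂ) ⊗ₜ[ℝ] α) ((autJ γ τ)⁻¹ • z) +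
          c * QC B y / autJ γ τ = E + c * QC B z / autJ γ τ +
            (τ * Q B α' + B.baseChange ℂ ((1 : ℂ) ⊗ₜ[ℝ] α') z) := by
        have hQy : QC B y = QC B z + τ ^ 2 * Q B α' + τ * B.baseChange ℂ ((1 : ℂ) ⊗ₜ[ℝ] α') z +
            Q B β' + B.baseChange ℂ ((1 : ℂ) ⊗ₜ[ℝ] β') z + τ * B α' β' := by
          rw [hy, QC_add h.symm, QC_add h.symm, QC_smul, QC_one_tmul, QC_one_tmul]
          simp only [map_add, map_smul, LinearMap.smul_apply, smul_eq_mul, baseChange_one_tmul,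
            one_mul]
          rw [h.symm.eq β' α']
          ring
        have f1 (x y : ℝ) (v w : V) : B.baseChange ℂ ((1 : ℂ) ⊗ₜ[ℝ] (x • v + y • w)) z =
            x * B.baseChange ℂ ((1 : ℂ) ⊗ₜ[ℝ] v) z + y * B.baseChange ℂ ((1 : ℂ) ⊗ₜ[ℝ] w) z := by
          rw [TensorProduct.tmul_add, TensorProduct.tmul_smul, TensorProduct.tmul_smul,
            ← algebraMap_smul ℂ x, ← algebraMap_smul ℂ y, map_add, map_smul, map_smul]
          rfl
        have f2 : Q B α' = a ^ 2 * Q B α + c ^ 2 * Q B β + a * c * B α β := by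
          rw [hα', Q_add h.symm, Q_smul, Q_smul]; simp; ring
        have f3 : Q B β' = b₀ ^ 2 * Q B α + d ^ 2 * Q B β + b₀ * d * B α β := by
          rw [hβ', Q_add h.symm, Q_smul, Q_smul]; simp; ring
        have f4 : B α' β' = 2 * a * b₀ * Q B α + (a * d + b₀ * c) * B α β + 2 * c * d * Q B β := by
          rw [hα', hβ', Q, Q]
          simp only [map_add, map_smul, LinearMap.add_apply, LinearMap.smul_apply, smul_eq_mul]
          rw [h.symm.eq β α]; ring
        rw [hQy, hα', hβ', f1, f1, ← hα', ← hβ', f2, f3, f4, hE, hM, map_smul, smul_eq_mul]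
        have hdet' : (a : ℂ) * d = 1 + b₀ * c := by
          have : a * d = 1 + b₀ * c := by linarith
          exact_mod_cast this
        push_cast
        generalize B.baseChange ℂ ((1 : ℂ) ⊗ₜ[ℝ] α) z = za
        generalize B.baseChange ℂ ((1 : ℂ) ⊗ₜ[ℝ] β) z = zb
        generalize (Q B α : ℂ) = qa
        generalize (Q B β : ℂ) = qb
        generalize (B α β : ℂ) = bab
        field_simp
        rw [hJ]
        linear_combination (-(za + (b₀ + a * τ) * qa)) * hdet'
      have hexp2 := congrArg e hexp
      rw [e_add, e_add _ (τ * (Q B α' : ℂ) + _), e_add (E : ℂ)] at hexp2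
      calc _ = (e (moeb γ τ * Q B α + B.baseChange ℂ ((1 : ℂ) ⊗ₜ[ℝ] α) ((autJ γ τ)⁻¹ • z)) *
          e (c * QC B y / autJ γ τ)) * (r τ * theta0 B b τ y) := by ring
        _ = _ := by rw [hexp2]; ring
    rw [hmain, hchar]
    have : ((E - B β' (lam b (ℓ₁ + ℓ₂)) : ℝ) : ℂ) = E + -(B β' (lam b (ℓ₁ + ℓ₂)) : ℂ) := by
      push_cast; ring
    rw [this, e_add]
    ring

end Characteristics

/-! ### Modular forms from Taylor coefficients of Jacobi forms -/

section EichlerZagier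

/-- The transformation law of the sequence of Taylor coefficients of a Jacobi form of one variable
whose exponential factor is `exp (A c t² / (cτ + d))`; the coefficients of one parity are numbered
consecutively. -/
def JacobiLike (A : ℂ) (γ : SL(2, ℤ)) (ρ : ℂ → ℂ) (ψ : ℕ → ℂ → ℂ) : Prop :=
  ∀ i τ, 0 < τ.im → ψ i (moeb γ τ) = ρ τ * autJ γ τ ^ (2 * i) *
    ∑ l ∈ Finset.range (i + 1), (A * (γ 1 0 / autJ γ τ)) ^ l / l.factorial * ψ (i - l) τ

/-- The combinatorial identity by which the extra terms in the derivative of the transformation law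
of a Jacobi-like sequence cancel against those from the next coefficient. -/
lemma sum_shift_identity (w k : ℂ) (i : ℕ) (ψ : ℕ → ℂ) :
    ∑ l ∈ Finset.range (i + 1), (k + 2 * i - l) * w * (w ^ l / l.factorial * ψ (i - l)) -
      (i + 1) * (i + k) * ∑ l ∈ Finset.range (i + 1 + 1), w ^ l / l.factorial * ψ (i + 1 - l) =
      -∑ l ∈ Finset.range (i + 1), w ^ l / l.factorial *
        ((((i - l : ℕ) : ℂ) + 1) * (((i - l : ℕ) : ℂ) + k) * ψ (i - l + 1)) := by
  have h1 : ∑ l ∈ Finset.range (i + 1), (k + 2 * i - l) * w * (w ^ l / l.factorial * ψ (i - l)) =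
      ∑ l ∈ Finset.range (i + 1 + 1), (l * (k + 2 * i - l + 1)) *
        (w ^ l / l.factorial * ψ (i + 1 - l)) := by
    rw [Finset.sum_range_succ' _ (i + 1)]
    simp only [Nat.cast_zero, zero_mul, add_zero]
    refine Finset.sum_congr rfl fun l _ => ?_
    have hf : ((l.factorial : ℕ) : ℂ) ≠ 0 := by exact_mod_cast l.factorial_ne_zero
    have hl : ((l : ℂ) + 1) ≠ 0 := by exact_mod_cast l.succ_ne_zero
    rw [Nat.factorial_succ, Nat.add_sub_add_right]
    push_cast
    field_simp
    ring
  have h2 : ∑ l ∈ Finset.range (i + 1), w ^ l / l.factorial *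
      ((((i - l : ℕ) : ℂ) + 1) * (((i - l : ℕ) : ℂ) + k) * ψ (i - l + 1)) =
      ∑ l ∈ Finset.range (i + 1 + 1), ((i + 1 - l) * (i - l + k)) *
        (w ^ l / l.factorial * ψ (i + 1 - l)) := by
    rw [Finset.sum_range_succ _ (i + 1)]
    have h0 : ((i : ℂ) + 1 - ((i + 1 : ℕ) : ℂ)) = 0 := by push_cast; ring
    rw [h0, zero_mul, zero_mul, add_zero]
    refine Finset.sum_congr rfl fun l hl => ?_
    have hl' : l ≤ i := Nat.lt_succ_iff.1 (Finset.mem_range.1 hl)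
    rw [Nat.cast_sub hl', Nat.sub_add_comm hl']
    ring
  rw [h1, h2, Finset.mul_sum, ← Finset.sum_sub_distrib, ← Finset.sum_neg_distrib]
  refine Finset.sum_congr rfl fun l _ => ?_
  ring

/-- The corrected derivative `A ∂ψ_i - (i + 1)(i + k) ψ_{i+1}` raises the weight by two. -/
lemma JacobiLike.derivative {A k : ℂ} {γ : SL(2, ℤ)} {ρ : ℂ → ℂ} {ψ ψ' : ℕ → ℂ → ℂ}
    (h : JacobiLike A γ ρ ψ)
    (hρ : ∀ τ, 0 < τ.im → HasDerivAt ρ (k * (γ 1 0 / autJ γ τ) * ρ τ) τ)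
    (hψ : ∀ i τ, 0 < τ.im → HasDerivAt (ψ i) (ψ' i τ) τ) :
    JacobiLike A γ (fun τ => ρ τ * autJ γ τ ^ 2)
      (fun i τ => A * ψ' i τ - (i + 1) * (i + k) * ψ (i + 1) τ) := by
  intro i τ hτ
  have hJ := autJ_ne_zero γ hτ
  set J := autJ γ τ with hJdef
  set η : ℂ := γ 1 0 / J with hη
  have dJ := hasDerivAt_autJ γ τ
  have dlhs : HasDerivAt (fun τ => ψ i (moeb γ τ)) (ψ' i (moeb γ τ) * (1 / J ^ 2)) τ :=
    (hψ i _ (moeb_im_pos γ hτ)).comp τ (hasDerivAt_moeb γ hτ)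
  have dη : HasDerivAt (fun τ => A * ((γ 1 0 : ℂ) / autJ γ τ)) (-η * (A * η)) τ := by
    have := ((dJ.inv hJ).const_mul (γ 1 0 : ℂ)).const_mul A
    refine (this.congr_deriv ?_).congr_of_eventuallyEq (Filter.Eventually.of_forall fun x => ?_)
    · rw [hη, ← hJdef]; field_simp
    · simp [div_eq_mul_inv]
  have dsum : HasDerivAt (fun τ => ∑ l ∈ Finset.range (i + 1),
      (A * ((γ 1 0 : ℂ) / autJ γ τ)) ^ l / l.factorial * ψ (i - l) τ)
      (∑ l ∈ Finset.range (i + 1), (-η * l * ((A * η) ^ l / l.factorial * ψ (i - l) τ) +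
        (A * η) ^ l / l.factorial * ψ' (i - l) τ)) τ := by
    refine HasDerivAt.fun_sum fun l _ => ?_
    refine (((dη.pow l).div_const _).mul (hψ (i - l) τ hτ)).congr_deriv ?_
    rcases l with _ | l
    · simp
    · simp only [Nat.add_sub_cancel, Pi.pow_apply, pow_succ, ← hJdef, ← hη]
      ring
  have drhs := ((hρ τ hτ).mul (dJ.pow (2 * i))).mul dsum
  have heq : (fun τ => ψ i (moeb γ τ)) =ᶠ[nhds τ] fun τ => ρ τ * autJ γ τ ^ (2 * i) *
      ∑ l ∈ Finset.range (i + 1),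
        (A * ((γ 1 0 : ℂ) / autJ γ τ)) ^ l / l.factorial * ψ (i - l) τ := by
    filter_upwards [isOpen_upper.mem_nhds hτ] with x hx
    exact h i x hx
  have hd := (dlhs.congr_of_eventuallyEq heq.symm).unique drhs
  have hψ' : A * ψ' i (moeb γ τ) = ρ τ * J ^ (2 * i + 2) *
      (∑ l ∈ Finset.range (i + 1), (k + 2 * i - l) * (A * η) *
        ((A * η) ^ l / l.factorial * ψ (i - l) τ) +
      A * ∑ l ∈ Finset.range (i + 1), (A * η) ^ l / l.factorial * ψ' (i - l) τ) := by
    have h1 : ψ' i (moeb γ τ) = J ^ 2 * (ψ' i (moeb γ τ) * (1 / J ^ 2)) := by field_simp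
    have h2 : J ^ 2 * (2 * i * J ^ (2 * i - 1) * (γ 1 0 : ℂ)) = 2 * i * η * J ^ (2 * i + 2) := by
      rcases i with _ | i
      · simp
      · rw [hη, show 2 * (i + 1) - 1 = 2 * i + 1 by omega]; field_simp; ring
    have h3 : ∑ l ∈ Finset.range (i + 1), (k + 2 * i - l) * (A * η) *
        ((A * η) ^ l / l.factorial * ψ (i - l) τ) =
        A * η * (k + 2 * i) * ∑ l ∈ Finset.range (i + 1), (A * η) ^ l / l.factorial * ψ (i - l) τ +
        A * ∑ l ∈ Finset.range (i + 1), -η * l * ((A * η) ^ l / l.factorial * ψ (i - l) τ) := by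
      rw [Finset.mul_sum, Finset.mul_sum, ← Finset.sum_add_distrib]
      exact Finset.sum_congr rfl fun l _ => by ring
    rw [h3, h1, hd, Finset.sum_add_distrib]
    simp only [Pi.mul_apply, Pi.pow_apply, ← hJdef, ← hη]
    generalize ∑ l ∈ Finset.range (i + 1), (A * η) ^ l / l.factorial * ψ (i - l) τ = S0
    generalize ∑ l ∈ Finset.range (i + 1), -η * l * ((A * η) ^ l / l.factorial * ψ (i - l) τ) = S1
    generalize ∑ l ∈ Finset.range (i + 1), (A * η) ^ l / l.factorial * ψ' (i - l) τ = S2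
    push_cast
    linear_combination (A * ρ τ * S0) * h2
  have hnext := h (i + 1) τ hτ
  have halg := sum_shift_identity (A * η) k i (fun j => ψ j τ)
  beta_reduce
  rw [hψ', hnext]
  have hsplit : ∑ l ∈ Finset.range (i + 1), (A * η) ^ l / l.factorial *
      (A * ψ' (i - l) τ - (((i - l : ℕ) : ℂ) + 1) * (((i - l : ℕ) : ℂ) + k) * ψ (i - l + 1) τ) =
      A * ∑ l ∈ Finset.range (i + 1), (A * η) ^ l / l.factorial * ψ' (i - l) τ -
        ∑ l ∈ Finset.range (i + 1), (A * η) ^ l / l.factorial *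
        ((((i - l : ℕ) : ℂ) + 1) * (((i - l : ℕ) : ℂ) + k) * ψ (i - l + 1) τ) := by
    rw [Finset.mul_sum, ← Finset.sum_sub_distrib]
    exact Finset.sum_congr rfl fun l _ => by ring
  rw [hsplit, show 2 * (i + 1) = 2 * i + 2 by ring, ← hJdef, ← hη]
  linear_combination (ρ τ * J ^ (2 * i + 2)) * halg

/-- The coefficients of the `r`-th corrected derivative in terms of those of the given series;
`D` is the factor by which `A ∂` acts. -/
def correctedCoeff (k D : ℂ) (a : ℕ → ℂ) : ℕ → ℕ → ℂ
  | 0, i => a i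
  | r + 1, i => D * correctedCoeff k D a r i -
      (i + 1) * (i + (k + 2 * r)) * correctedCoeff k D a r (i + 1)

lemma prod_range_shift (x : ℂ) (ν : ℕ) :
    ∏ t ∈ Finset.range (ν + 1), (x + t) = x * ∏ t ∈ Finset.range ν, (x + 1 + t) := by
  rw [Finset.prod_range_succ', mul_comm]
  congr 1
  · simp
  · exact Finset.prod_congr rfl fun t _ => by push_cast; ring

lemma correctedCoeff_eq (k D : ℂ) (a : ℕ → ℂ) (r i : ℕ) :
    correctedCoeff k D a r i = ∑ ν ∈ Finset.range (r + 1),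
      (r.choose ν : ℂ) * (-1) ^ ν * D ^ (r - ν) * (∏ t ∈ Finset.range ν, (i + 1 + t : ℂ)) *
        (∏ t ∈ Finset.range ν, (i + k + r - 1 + t)) * a (i + ν) := by
  induction r generalizing i with
  | zero => simp [correctedCoeff]
  | succ r ih =>
    rw [correctedCoeff, ih, ih, Finset.sum_range_succ' _ (r + 1)]
    have hF : D * ∑ ν ∈ Finset.range (r + 1),
        (r.choose ν : ℂ) * (-1) ^ ν * D ^ (r - ν) * (∏ t ∈ Finset.range ν, (i + 1 + t : ℂ)) *
          (∏ t ∈ Finset.range ν, (i + k + r - 1 + t)) * a (i + ν) =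
        ∑ ν ∈ Finset.range (r + 1), (r.choose (ν + 1) : ℂ) * (-1) ^ (ν + 1) * D ^ (r - ν) *
          (∏ t ∈ Finset.range (ν + 1), (i + 1 + t : ℂ)) *
          (∏ t ∈ Finset.range (ν + 1), (i + k + r - 1 + t)) * a (i + (ν + 1)) +
        D ^ (r + 1) * a i := by
      rw [Finset.sum_range_succ' _ r, Finset.sum_range_succ _ r, Nat.choose_succ_self, mul_add,
        Finset.mul_sum]
      simp only [Nat.cast_zero, zero_mul, add_zero]
      congr 1
      · refine Finset.sum_congr rfl fun ν hν => ?_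
        rw [show r - ν = r - (ν + 1) + 1 by have := Finset.mem_range.1 hν; omega, pow_succ D]
        ring
      · simp; ring
    rw [hF, Finset.mul_sum, add_sub_right_comm, ← Finset.sum_sub_distrib]
    congr 1
    · refine Finset.sum_congr rfl fun ν hν => ?_
      have hν' : ν ≤ r := Nat.lt_succ_iff.1 (Finset.mem_range.1 hν)
      have hch : (r.choose (ν + 1) : ℂ) * (ν + 1) = r.choose ν * (r - ν) := by
        have := Nat.choose_succ_right_eq r ν
        rw [← Nat.cast_sub hν']
        exact_mod_cast this
      rw [prod_range_shift (i + 1 : ℂ) ν, prod_range_shift (i + k + r - 1) ν,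
        Finset.prod_range_succ (fun t => i + k + ((r + 1 : ℕ) : ℂ) - 1 + t) ν,
        Nat.choose_succ_succ',
        Nat.add_sub_add_right, show i + 1 + ν = i + (ν + 1) by ring]
      have p1 : ∏ t ∈ Finset.range ν, (((i + 1 : ℕ) : ℂ) + 1 + t) =
          ∏ t ∈ Finset.range ν, ((i : ℂ) + 1 + 1 + t) :=
        Finset.prod_congr rfl fun t _ => by push_cast; ring
      have p2 : ∏ t ∈ Finset.range ν, (((i + 1 : ℕ) : ℂ) + k + r - 1 + t) =
          ∏ t ∈ Finset.range ν, ((i : ℂ) + k + r + t) :=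
        Finset.prod_congr rfl fun t _ => by push_cast; ring
      have p3 : ∏ t ∈ Finset.range ν, ((i : ℂ) + k + ((r + 1 : ℕ) : ℂ) - 1 + t) =
          ∏ t ∈ Finset.range ν, ((i : ℂ) + k + r + t) :=
        Finset.prod_congr rfl fun t _ => by push_cast; ring
      have p4 : ∏ t ∈ Finset.range ν, ((i : ℂ) + k + r - 1 + 1 + t) =
          ∏ t ∈ Finset.range ν, ((i : ℂ) + k + r + t) :=
        Finset.prod_congr rfl fun t _ => by ring
      rw [p1, p2, p3, p4]
      generalize ∏ t ∈ Finset.range ν, ((i : ℂ) + 1 + 1 + t) = X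
      generalize ∏ t ∈ Finset.range ν, ((i : ℂ) + k + r + t) = Y
      push_cast
      linear_combination (-1) ^ (ν + 1) * D ^ (r - ν) * (i + 1) * X * Y * a (i + (ν + 1)) * (-hch)
    · simp

variable {X : Type*}

lemma expSeries_comb {m : X → ℝ} (hm : ExpTame m) {c c' : X → ℂ} (hc : PolyBd m c)
    (hc' : PolyBd m c') (a a' : ℂ) {τ : ℂ} (hτ : 0 < τ.im) :
    expSeries (fun x => a * c x - a' * c' x) m 0 τ =
      a * expSeries c m 0 τ - a' * expSeries c' m 0 τ := by
  have h1 := (hasSum_expSeries hm hc (LittleBd.zero hm.1) hτ).mul_left a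
  have h2 := (hasSum_expSeries hm hc' (LittleBd.zero hm.1) hτ).mul_left a'
  refine ((h1.sub h2).congr_fun fun x => ?_).tsum_eq
  simp only [Pi.zero_apply]
  ring

lemma expSeries_const_mul (m : X → ℝ) (c r : X → ℂ) (a τ : ℂ) :
    expSeries (fun x => a * c x) m r τ = a * expSeries c m r τ := by
  unfold expSeries
  rw [← tsum_mul_left]
  congr 1; funext x; ring

/-- Iterating the corrected derivative on exponential series. -/
lemma JacobiLike.iterate {m : X → ℝ} (hm : ExpTame m) {g : ℕ → X → ℂ} (hg : ∀ i, PolyBd m (g i))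
    {A k : ℂ} {γ : SL(2, ℤ)} {ρ : ℂ → ℂ} (h : JacobiLike A γ ρ fun i => expSeries (g i) m 0)
    (hρ : ∀ τ, 0 < τ.im → HasDerivAt ρ (k * (γ 1 0 / autJ γ τ) * ρ τ) τ) (r : ℕ) :
    (∀ i, PolyBd m fun x => correctedCoeff k (A * (2 * Real.pi * Complex.I * m x))
      (fun i => g i x) r i) ∧
    JacobiLike A γ (fun τ => ρ τ * autJ γ τ ^ (2 * r)) fun i => expSeries (fun x =>
      correctedCoeff k (A * (2 * Real.pi * Complex.I * m x)) (fun i => g i x) r i) m 0 := by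
  induction r with
  | zero => exact ⟨hg, by simpa [correctedCoeff] using h⟩
  | succ r ih =>
    obtain ⟨ih1, ih2⟩ := ih
    have hm1 : PolyBd m fun x => (2 * Real.pi * Complex.I * m x : ℂ) :=
      (PolyBd.const _).mul (PolyBd.exponent hm.1)
    have hd (i) := (ih1 i).mul hm1
    have hcoeff (i : ℕ) (x : X) : correctedCoeff k (A * (2 * Real.pi * Complex.I * m x))
        (fun i => g i x) (r + 1) i =
        A * (correctedCoeff k (A * (2 * Real.pi * Complex.I * m x)) (fun i => g i x) r i *
          (2 * Real.pi * Complex.I * m x)) - ((i + 1) * (i + (k + 2 * r))) *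
          correctedCoeff k (A * (2 * Real.pi * Complex.I * m x)) (fun i => g i x) r (i + 1) := by
      rw [correctedCoeff]; ring
    refine ⟨fun i => ?_, ?_⟩
    · simp_rw [hcoeff, sub_eq_add_neg, ← neg_mul]
      exact ((PolyBd.const _).mul (hd i)).add hm.1 ((PolyBd.const _).mul (ih1 (i + 1)))
    · have hρ' : ∀ τ, 0 < τ.im → HasDerivAt (fun τ => ρ τ * autJ γ τ ^ (2 * r))
          ((k + 2 * r) * (γ 1 0 / autJ γ τ) * (ρ τ * autJ γ τ ^ (2 * r))) τ := by
        intro τ hτ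
        have hJ := autJ_ne_zero γ hτ
        refine ((hρ τ hτ).mul ((hasDerivAt_autJ γ τ).pow (2 * r))).congr_deriv ?_
        simp only [Pi.pow_apply]
        rcases r with _ | r
        · simp
        · rw [show 2 * (r + 1) - 1 = 2 * r + 1 by omega]
          push_cast
          field_simp
          ring
      have h1 := ih2.derivative hρ' fun i τ hτ =>
        hasDerivAt_expSeries hm (ih1 i) (LittleBd.zero hm.1) hτ
      intro i τ hτ
      have h2 := h1 i τ hτ
      have h3 (i : ℕ) {τ : ℂ} (hτ : 0 < τ.im) := expSeries_comb hm (hd i) (ih1 (i + 1)) A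
        ((i + 1) * (i + (k + 2 * r))) hτ
      simp_rw [hcoeff]
      rw [h3 i (moeb_im_pos γ hτ)]
      simp_rw [h3 _ hτ]
      rw [show 2 * (r + 1) = 2 * r + 2 by ring, pow_add, ← mul_assoc]
      exact h2

lemma hasSum_exp_sq (w t : ℂ) :
    (Summable fun j : ℕ => ‖(if Even j then w ^ (j / 2) / (j / 2).factorial else 0) * t ^ j‖) ∧
    HasSum (fun j : ℕ => (if Even j then w ^ (j / 2) / (j / 2).factorial else 0) * t ^ j)
      (Complex.exp (w * t ^ 2)) := by
  have hinj : Function.Injective fun l : ℕ => 2 * l := fun a b h => by simpa using h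
  have h0 : ∀ j, j ∉ Set.range (fun l : ℕ => 2 * l) →
      (if Even j then w ^ (j / 2) / ((j / 2).factorial : ℂ) else 0) * t ^ j = 0 := by
    intro j hj
    rw [if_neg, zero_mul]
    rintro ⟨l, rfl⟩
    exact hj ⟨l, by simp; ring⟩
  have h1 (l : ℕ) : (if Even (2 * l) then w ^ (2 * l / 2) / ((2 * l / 2).factorial : ℂ) else 0) *
      t ^ (2 * l) = (w * t ^ 2) ^ l / l.factorial := by
    rw [if_pos (even_two_mul l), Nat.mul_div_cancel_left l two_pos, mul_pow, ← pow_mul]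
    ring
  have hs : HasSum (fun l : ℕ => (w * t ^ 2) ^ l / l.factorial) (Complex.exp (w * t ^ 2)) := by
    rw [Complex.exp_eq_exp_ℂ]
    exact NormedSpace.expSeries_div_hasSum_exp _
  have h2 : HasSum (fun j : ℕ => (if Even j then w ^ (j / 2) / ((j / 2).factorial : ℂ) else 0) *
      t ^ j) (Complex.exp (w * t ^ 2)) := by
    rw [← hinj.hasSum_iff h0]
    exact hs.congr_fun h1
  exact ⟨h2.summable.norm, h2⟩

/-- The terms of even index in a Cauchy product with the series of `exp (w t²)`. -/
lemma sum_even_terms (w : ℂ) (χ : ℕ → ℂ) (i : ℕ) {j₀ : ℕ} (hj : j₀ ≤ 1) :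
    ∑ k ∈ Finset.range (2 * i + j₀ + 1),
      (if Even k then w ^ (k / 2) / ((k / 2).factorial : ℂ) else 0) * χ (2 * i + j₀ - k) =
    ∑ l ∈ Finset.range (i + 1), w ^ l / l.factorial * χ (2 * (i - l) + j₀) := by
  symm
  refine Finset.sum_of_injOn (fun l => 2 * l) (fun a _ b _ h => by simpa using h)
    (fun l hl => ?_) (fun k hk hk' => ?_) (fun l hl => ?_)
  · simp at hl ⊢; omega
  · rw [if_neg, zero_mul]
    rintro ⟨l, rfl⟩
    refine hk' ⟨l, ?_, by simp; ring⟩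
    simp at hk ⊢; omega
  · have : l ≤ i := Nat.lt_succ_iff.1 (Finset.mem_range.1 hl)
    rw [if_pos (even_two_mul l), Nat.mul_div_cancel_left l two_pos,
      show 2 * i + j₀ - 2 * l = 2 * (i - l) + j₀ by omega]

/-- The Taylor coefficients in a direction of a series with the transformation law of a Jacobi
form form a Jacobi-like sequence. -/
lemma jacobiLike_taylor {m : X → ℝ} (hm : ExpTame m) {c r : X → ℂ} (hc : PolyBd m c)
    (hr : LittleBd m r) {A : ℂ} {γ : SL(2, ℤ)} {ρ : ℂ → ℂ}
    (hT : ∀ τ, 0 < τ.im → ∀ t : ℂ, expSeries c m (fun x => (autJ γ τ)⁻¹ * t * r x) (moeb γ τ) =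
      ρ τ * Complex.exp (A * (γ 1 0 / autJ γ τ) * t ^ 2) * expSeries c m (fun x => t * r x) τ)
    {j₀ : ℕ} (hj : j₀ ≤ 1) : JacobiLike A γ (fun τ => ρ τ * autJ γ τ ^ j₀) fun i =>
      expSeries (fun x => c x * ((2 * Real.pi * Complex.I * r x) ^ (2 * i + j₀) /
        (2 * i + j₀).factorial)) m 0 := by
  intro i τ hτ
  have hJ := autJ_ne_zero γ hτ
  let χ (j : ℕ) (τ : ℂ) : ℂ := expSeries (fun x => c x * ((2 * Real.pi * Complex.I * r x) ^ j /
        j.factorial)) m 0 τ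
  set w := A * (γ 1 0 / autJ γ τ) with hw
  have key (j : ℕ) : χ j (moeb γ τ) * (autJ γ τ)⁻¹ ^ j - ρ τ * ∑ k ∈ Finset.range (j + 1),
      (if Even k then w ^ (k / 2) / ((k / 2).factorial : ℂ) else 0) * χ (j - k) τ = 0 := by
    refine coeff_eq_zero_of_hasSum_zero (a := fun j => χ j (moeb γ τ) * (autJ γ τ)⁻¹ ^ j -
      ρ τ * ∑ k ∈ Finset.range (j + 1),
      (if Even k then w ^ (k / 2) / ((k / 2).factorial : ℂ) else 0) * χ (j - k) τ) one_pos
      (fun t _ _ => ?_) j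
    have h1 := (hasSum_taylor hm hc hr (moeb_im_pos γ hτ) ((autJ γ τ)⁻¹ * t)).2
    obtain ⟨h2, h2'⟩ := hasSum_taylor hm hc hr hτ t
    obtain ⟨h3, h3'⟩ := hasSum_exp_sq w t
    have h4 := (hasSum_sum_range_mul_of_summable_norm h3 h2).mul_left (ρ τ)
    rw [h3'.tsum_eq, h2'.tsum_eq] at h4
    have h5 := h1.sub h4
    rw [hT τ hτ t, mul_assoc (ρ τ) (Complex.exp _), sub_self] at h5
    refine h5.congr_fun fun j => ?_
    simp only [χ]
    rw [sub_mul, mul_pow, mul_assoc (ρ τ), Finset.sum_mul]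
    congr 1
    · ring
    · congr 1
      refine Finset.sum_congr rfl fun k hk => ?_
      have hk' : k ≤ j := Nat.lt_succ_iff.1 (Finset.mem_range.1 hk)
      have : t ^ j = t ^ k * t ^ (j - k) := by rw [← pow_add, Nat.add_sub_cancel' hk']
      rw [this]; ring
  have h1 := key (2 * i + j₀)
  rw [sum_even_terms w (fun j => χ j τ) i hj, sub_eq_zero, inv_pow, mul_inv_eq_iff_eq_mul₀
    (pow_ne_zero _ hJ)] at h1
  change χ (2 * i + j₀) (moeb γ τ) = _
  rw [h1, pow_add]
  ring

lemma gammaQuotient_eq (k : ℝ) (r μ : ℕ) {j₀ : ℕ} (hj : j₀ ≤ 1) (hμ : μ ≤ r) :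
    gammaQuotient k (2 * r + j₀) μ =
      ∏ t ∈ Finset.range (r - μ), (k + j₀ + r - 1 + t) := by
  unfold gammaQuotient
  symm
  refine Finset.prod_bij' (fun t _ => (r : ℤ) + j₀ - 1 + t) (fun m _ => (m - (r + j₀ - 1)).toNat)
    (fun t ht => ?_) (fun m hm => ?_) (fun t ht => ?_) (fun m hm => ?_) (fun t ht => ?_)
  · simp only [Finset.mem_range, Finset.mem_Icc] at ht ⊢
    push_cast
    omega
  · simp only [Finset.mem_range, Finset.mem_Icc] at hm ⊢
    push_cast at hm
    omega
  · omega
  · simp only [Finset.mem_Icc] at hm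
    push_cast at hm
    omega
  · push_cast; ring

/-- The polynomial in `m` and `ℓ` whose series is the modular form attached to the Taylor
coefficients of order at most `s`; `q` is the value of the quadratic form at the direction. -/
def taylorPoly (k : ℝ) (s : ℕ) (q m ℓ : ℂ) : ℂ :=
  ∑ μ ∈ Finset.range (s / 2 + 1), (-1) ^ μ * (gammaQuotient k s μ : ℂ) *
    ((q * m) ^ μ / μ.factorial) * (ℓ ^ (s - 2 * μ) / (s - 2 * μ).factorial)

/-- For the Taylor coefficients of an exponential series, the constant term of the `r`-th corrected
derivative is a multiple of `taylorPoly`. -/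
lemma correctedCoeff_taylor (k : ℝ) (q m ℓ c : ℂ) (r : ℕ) {j₀ : ℕ} (hj : j₀ ≤ 1) :
    correctedCoeff (k + j₀) (2 * Real.pi * Complex.I * q * (2 * Real.pi * Complex.I * m))
      (fun i => c * ((2 * Real.pi * Complex.I * ℓ) ^ (2 * i + j₀) / (2 * i + j₀).factorial)) r 0 =
    ((2 * Real.pi * Complex.I) ^ (2 * r + j₀) * r.factorial * (-1) ^ r) *
      (c * taylorPoly k (2 * r + j₀) q m ℓ) := by
  rw [correctedCoeff_eq, taylorPoly, ← Finset.sum_range_reflect, Finset.mul_sum, Finset.mul_sum,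
    show (2 * r + j₀) / 2 = r by omega]
  refine Finset.sum_congr rfl fun μ hμ => ?_
  have hμ' : μ ≤ r := Nat.lt_succ_iff.1 (Finset.mem_range.1 hμ)
  rw [Nat.add_sub_cancel, gammaQuotient_eq k r μ hj hμ', Nat.sub_sub_self hμ',
    Nat.choose_symm hμ']
  have h1 : ∏ t ∈ Finset.range (r - μ), (((0 : ℕ) : ℂ) + 1 + t) = ((r - μ).factorial : ℂ) := by
    rw [← Finset.prod_range_add_one_eq_factorial]
    push_cast
    exact Finset.prod_congr rfl fun t _ => by ring
  have h2 : ∏ t ∈ Finset.range (r - μ), (((0 : ℕ) : ℂ) + (k + j₀) + r - 1 + t) =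
      ((∏ t ∈ Finset.range (r - μ), (k + j₀ + r - 1 + t) : ℝ) : ℂ) := by
    push_cast
    exact Finset.prod_congr rfl fun t _ => by ring
  have h3 : (r.choose μ : ℂ) * ((r - μ).factorial : ℂ) * μ.factorial = r.factorial := by
    have := Nat.choose_mul_factorial_mul_factorial hμ'
    rw [mul_right_comm]
    exact_mod_cast this
  have h4 : ((-1 : ℂ)) ^ (r - μ) = (-1) ^ r * (-1) ^ μ := by
    have h5 : r = (r - μ) + μ := by omega
    conv_rhs => rw [h5, pow_add, mul_assoc, ← mul_pow]
    simp
  have h5 : 2 * r + j₀ - 2 * μ = 2 * (r - μ) + j₀ := by omega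
  have h6 : (2 * Real.pi * Complex.I : ℂ) ^ (2 * r + j₀) =
      (2 * Real.pi * Complex.I) ^ (2 * μ) * (2 * Real.pi * Complex.I) ^ (2 * (r - μ) + j₀) := by
    rw [← pow_add]; congr 1; omega
  have hf : ((μ.factorial : ℕ) : ℂ) ≠ 0 := by exact_mod_cast μ.factorial_ne_zero
  have hf2 : (((2 * (r - μ) + j₀).factorial : ℕ) : ℂ) ≠ 0 := by
    exact_mod_cast Nat.factorial_ne_zero _
  rw [h1, h2, h4, h5, h6, ← h3, zero_add]
  generalize ((∏ t ∈ Finset.range (r - μ), (k + j₀ + r - 1 + t) : ℝ) : ℂ) = G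
  generalize (2 * Real.pi * Complex.I : ℂ) = W
  rw [show W * q * (W * m) = W ^ 2 * (q * m) by ring, mul_pow (W ^ 2), ← pow_mul, mul_pow W ℓ]
  field_simp

/-- The logarithmic derivative of an automorphy factor of weight `κ / 2`. -/
lemma hasDerivAt_of_sq_eq {γ : SL(2, ℤ)} {ρ : ℂ → ℂ} {u : ℂ} (hu : u ≠ 0) {κ : ℕ}
    (hd : DifferentiableOn ℂ ρ {τ | 0 < τ.im}) (hsq : ∀ τ, 0 < τ.im → ρ τ ^ 2 = u * autJ γ τ ^ κ)
    {τ : ℂ} (hτ : 0 < τ.im) : HasDerivAt ρ (κ / 2 * (γ 1 0 / autJ γ τ) * ρ τ) τ := by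
  have hJ := autJ_ne_zero γ hτ
  have h1 := (hd.differentiableAt (isOpen_upper.mem_nhds hτ)).hasDerivAt
  have h2 := h1.pow 2
  have h3 := ((hasDerivAt_autJ γ τ).pow κ).const_mul u
  have heq : (fun τ => u * (autJ γ ^ κ) τ) =ᶠ[nhds τ] ρ ^ 2 := by
    filter_upwards [isOpen_upper.mem_nhds hτ] with x hx
    exact (hsq x hx).symm
  have h4 := h2.unique (h3.congr_of_eventuallyEq heq.symm)
  have hne : ρ τ ≠ 0 := by
    intro h0
    have := hsq τ hτ
    rw [h0, zero_pow two_ne_zero] at this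
    exact mul_ne_zero hu (pow_ne_zero _ hJ) this.symm
  refine h1.congr_deriv ?_
  have h5 : (κ : ℂ) * autJ γ τ ^ (κ - 1) * autJ γ τ = κ * autJ γ τ ^ κ := by
    rcases κ with _ | κ
    · simp
    · rw [Nat.add_sub_cancel, pow_succ, mul_assoc]
  have h6 := hsq τ hτ
  apply mul_left_cancel₀ (mul_ne_zero (mul_ne_zero two_ne_zero hne) hJ)
  have h7 : 2 * ρ τ * autJ γ τ * (κ / 2 * (γ 1 0 / autJ γ τ) * ρ τ) = κ * γ 1 0 * ρ τ ^ 2 := by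
    field_simp
  rw [h7]
  simp at h4
  linear_combination autJ γ τ * h4 + (γ 1 0 : ℂ) * u * h5 - (κ : ℂ) * γ 1 0 * h6

/-- The modular forms attached to the Taylor coefficients of a Jacobi form in one direction: the
constant term of an iterated corrected derivative of the Taylor coefficients transforms without
correction terms. -/
theorem taylorPoly_series_moeb {m : X → ℝ} (hm : ExpTame m) {c r : X → ℂ} (hc : PolyBd m c)
    (hr : LittleBd m r) {q : ℂ} {γ : SL(2, ℤ)} {ρ : ℂ → ℂ} {u : ℂ} (hu : u ≠ 0) {κ : ℕ}
    (hd : DifferentiableOn ℂ ρ {τ | 0 < τ.im}) (hsq : ∀ τ, 0 < τ.im → ρ τ ^ 2 = u * autJ γ τ ^ κ)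
    (hT : ∀ τ, 0 < τ.im → ∀ t : ℂ, expSeries c m (fun x => (autJ γ τ)⁻¹ * t * r x) (moeb γ τ) =
      ρ τ * e (γ 1 0 * (t ^ 2 * q) / autJ γ τ) * expSeries c m (fun x => t * r x) τ)
    (s : ℕ) {τ : ℂ} (hτ : 0 < τ.im) :
    expSeries (fun x => c x * taylorPoly (κ / 2) s q (m x) (r x)) m 0 (moeb γ τ) =
      ρ τ * autJ γ τ ^ s * expSeries (fun x => c x * taylorPoly (κ / 2) s q (m x) (r x)) m 0 τ := by
  obtain ⟨R, j₀, hj, rfl⟩ : ∃ R j₀, j₀ ≤ 1 ∧ s = 2 * R + j₀ := ⟨s / 2, s % 2, by omega, by omega⟩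
  have h1 := jacobiLike_taylor hm hc hr (A := 2 * Real.pi * Complex.I * q) (γ := γ) (ρ := ρ)
    (fun τ hτ t => by
      rw [hT τ hτ t, e]
      congr 3
      ring) hj
  have hρ : ∀ τ, 0 < τ.im → HasDerivAt (fun τ => ρ τ * autJ γ τ ^ j₀)
      ((((κ / 2 : ℝ) : ℂ) + j₀) * (γ 1 0 / autJ γ τ) * (ρ τ * autJ γ τ ^ j₀)) τ := by
    intro τ hτ
    have hJ := autJ_ne_zero γ hτ
    refine ((hasDerivAt_of_sq_eq hu hd hsq hτ).mul ((hasDerivAt_autJ γ τ).pow j₀)).congr_deriv ?_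
    simp only [Pi.pow_apply]
    rcases Nat.le_one_iff_eq_zero_or_eq_one.1 hj with rfl | rfl
    · simp
    · push_cast; simp; field_simp
  have hg (i : ℕ) : PolyBd m fun x => c x * ((2 * Real.pi * Complex.I * r x) ^ (2 * i + j₀) /
        (2 * i + j₀).factorial) := by
    simp_rw [div_eq_mul_inv]
    exact hc.mul ((((PolyBd.const _).mul (hr.polyBd hm.1)).pow _).mul (PolyBd.const _))
  have h2 := (h1.iterate hm hg hρ R).2 0 τ hτ
  have h3 (x : X) := correctedCoeff_taylor (κ / 2) q (m x) (r x) (c x) R hj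
  simp only [h3, expSeries_const_mul, zero_add, Finset.range_one, Finset.sum_singleton, pow_zero,
    Nat.factorial_zero, Nat.cast_one, div_one, one_mul, mul_zero, mul_one, Nat.sub_zero] at h2
  have hne : (2 * Real.pi * Complex.I : ℂ) ^ (2 * R + j₀) * R.factorial * (-1) ^ R ≠ 0 := by
    refine mul_ne_zero (mul_ne_zero (pow_ne_zero _ Complex.two_pi_I_ne_zero) ?_)
      (pow_ne_zero _ (by norm_num))
    exact_mod_cast R.factorial_ne_zero
  apply mul_left_cancel₀ hne
  rw [h2, pow_add]
  ring

end EichlerZagier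

/-! ### The polynomials `P_{k,p,M}` and their generating function -/

section Polynomials

variable {n : ℕ}

/-- The multinomial theorem, for the exponents in a box. -/
lemma sum_box_multinomial {ι K : Type*} [Fintype ι] [DecidableEq ι] [Field K] [CharZero K]
    (a : ι → K) {N T : ℕ} (hNT : N ≤ T) :
    ∑ f ∈ (Fintype.piFinset fun _ : ι => Finset.range (T + 1)) with ∑ i, f i = N,
      ∏ i, a i ^ f i / ((f i).factorial : K) = (∑ i, a i) ^ N / (N.factorial : K) := by
  have hset : ((Fintype.piFinset fun _ : ι => Finset.range (T + 1)).filter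
      fun f => ∑ i, f i = N) = Finset.piAntidiag Finset.univ N := by
    ext f
    simp only [Finset.mem_filter, Fintype.mem_piFinset, Finset.mem_range, Finset.mem_piAntidiag,
      Finset.mem_univ, implies_true, and_true, and_iff_right_iff_imp]
    rintro rfl i
    exact Nat.lt_succ_iff.2 ((Finset.single_le_sum (fun _ _ => Nat.zero_le _)
      (Finset.mem_univ i)).trans hNT)
  rw [hset, Finset.sum_pow_eq_sum_piAntidiag, Finset.sum_div]
  refine Finset.sum_congr rfl fun f hf => ?_
  have hf' : ∑ i, f i = N := (Finset.mem_piAntidiag.1 hf).1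
  have h1 := Nat.multinomial_spec Finset.univ f
  rw [hf'] at h1
  have h2 : ((∏ i, (f i).factorial : ℕ) : K) ≠ 0 := by
    exact_mod_cast Finset.prod_ne_zero_iff.2 fun i _ => (f i).factorial_ne_zero
  have h3 : (N.factorial : K) ≠ 0 := by exact_mod_cast N.factorial_ne_zero
  rw [Finset.prod_div_distrib, div_eq_div_iff (by exact_mod_cast h2) h3, ← h1]
  push_cast
  ring

/-- The multinomial theorem for matrices of exponents. -/
lemma sum_matrices_multinomial {K : Type*} [Field K] [CharZero K] (a : Fin n → Fin n → K)
    {N T : ℕ} (hNT : N ≤ T) :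
    ∑ f ∈ boundedMatrices n T with ∑ i, ∑ j, f i j = N,
      ∏ i, ∏ j, a i j ^ f i j / ((f i j).factorial : K) =
        (∑ i, ∑ j, a i j) ^ N / (N.factorial : K) := by
  have h := sum_box_multinomial (fun x : Fin n × Fin n => a x.1 x.2) hNT
  rw [Fintype.sum_prod_type] at h
  rw [← h]
  refine Finset.sum_nbij' (fun f x => f x.1 x.2) (fun f i j => f (i, j)) ?_ ?_ ?_ ?_ ?_
  · intro f hf
    simp only [boundedMatrices, Finset.mem_filter, Fintype.mem_piFinset] at hf ⊢
    exact ⟨fun x => hf.1 x.1 x.2, by rw [Fintype.sum_prod_type]; exact hf.2⟩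
  · intro f hf
    simp only [boundedMatrices, Finset.mem_filter, Fintype.mem_piFinset] at hf ⊢
    exact ⟨fun i j => hf.1 (i, j), by rw [← hf.2, Fintype.sum_prod_type]⟩
  · intro f _; rfl
  · intro f _; rfl
  · intro f _; rw [Fintype.prod_prod_type]

/-- The sums `(j-th row sum) + (j-th column sum)` of a matrix. -/
def crossSum (Λ : Fin n → Fin n → ℕ) (j : Fin n) : ℕ := ∑ i, Λ j i + ∑ i, Λ i j

lemma sum_crossSum (Λ : Fin n → Fin n → ℕ) : ∑ j, crossSum Λ j = 2 * ∑ i, ∑ j, Λ i j := by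
  unfold crossSum
  rw [Finset.sum_add_distrib, Finset.sum_comm (f := fun j i => Λ i j)]
  ring

lemma sum_columns {K : Type*} [Field K] [CharZero K] (a : Fin n → Fin n → K) {q : Fin n → ℕ}
    {T : ℕ} (hq : ∀ j, q j ≤ T) :
    ∑ f ∈ boundedMatrices n T with ∀ j, ∑ i, f i j = q j,
      ∏ i, ∏ j, a i j ^ f i j / ((f i j).factorial : K) =
        ∏ j, ((∑ i, a i j) ^ q j / ((q j).factorial : K)) := by
  have h (j : Fin n) := sum_box_multinomial (fun i => a i j) (hq j)
  simp_rw [← h]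
  rw [Finset.prod_univ_sum]
  refine Finset.sum_nbij' (fun f j i => f i j) (fun f j i => f i j) ?_ ?_ ?_ ?_ ?_
  · intro f hf
    simp only [boundedMatrices, Finset.mem_filter, Fintype.mem_piFinset] at hf ⊢
    exact fun j => ⟨fun i => hf.1 i j, hf.2 j⟩
  · intro f hf
    simp only [boundedMatrices, Finset.mem_filter, Fintype.mem_piFinset] at hf ⊢
    exact ⟨fun i j => (hf j).1 i, fun j => (hf j).2⟩
  · intro f _; rfl
  · intro f _; rfl
  · intro f _; rw [Finset.prod_comm]

/-- The value of `P_{k,p,M}`, with the sum over the second matrix carried out. -/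
lemma eval_P (k : ℝ) (p : Fin n → ℕ) (M : Matrix (Fin n) (Fin n) ℝ) (m : ℝ) (x : Fin n → ℝ) :
    MvPolynomial.eval (Fin.cons m x : Fin (n + 1) → ℝ) (P k p M) =
      ∑ Λ ∈ boundedMatrices n (s p) with ∀ j, crossSum Λ j ≤ p j,
        ((-1) ^ (∑ i, ∑ j, Λ i j) * 2 ^ (s p - ∑ i, ∑ j, Λ i j) *
          gammaQuotient k (s p) (∑ i, ∑ j, Λ i j) * m ^ (∑ i, ∑ j, Λ i j)) *
        (∏ i, ∏ j, M i j ^ Λ i j / ((Λ i j).factorial : ℝ)) *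
        ∏ j, ((∑ i, x i * M i j) ^ (p j - crossSum Λ j) /
          ((p j - crossSum Λ j).factorial : ℝ)) := by
  have hp (j : Fin n) : p j ≤ s p := Finset.single_le_sum (fun _ _ => Nat.zero_le _)
    (Finset.mem_univ j)
  let F (μ : Fin (n + 1) → ℕ) (y : (Fin n → Fin n → ℕ) × (Fin n → Fin n → ℕ)) : ℝ :=
    ((-1) ^ μ 0 * 2 ^ (s p - μ 0) * gammaQuotient k (s p) (μ 0)) *
      (∏ i, ∏ j, M i j ^ (y.1 i j + y.2 i j) /
            (((y.1 i j).factorial : ℝ) * ((y.2 i j).factorial : ℝ))) *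
      (m ^ μ 0 * ∏ i : Fin n, x i ^ μ i.succ)
  let μ₀ (y : (Fin n → Fin n → ℕ) × (Fin n → Fin n → ℕ)) : Fin (n + 1) → ℕ :=
    Fin.cons (∑ i, ∑ j, y.1 i j) fun i => ∑ j, y.2 i j
  have h1 : MvPolynomial.eval (Fin.cons m x : Fin (n + 1) → ℝ) (P k p M) =
      ∑ y ∈ boundedMatrices n (s p) ×ˢ boundedMatrices n (s p) with
        ∀ j, ∑ i, y.2 i j + crossSum y.1 j = p j, F (μ₀ y) y := by
    have h2 : MvPolynomial.eval (Fin.cons m x : Fin (n + 1) → ℝ) (P k p M) =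
        ∑ μ ∈ (Fintype.piFinset fun _ : Fin (n + 1) => Finset.range (s p + 1)) with
          2 * μ 0 + ∑ i : Fin n, μ i.succ = s p,
        ∑ y ∈ boundedMatrices n (s p) ×ˢ boundedMatrices n (s p) with
          (∑ i, ∑ j, y.1 i j = μ 0) ∧ (∀ i, ∑ j, y.2 i j = μ i.succ) ∧
            (∀ j, ∑ i, y.2 i j + (∑ i, y.1 j i + ∑ i, y.1 i j) = p j), F μ y := by
      rw [P, map_sum]
      refine Finset.sum_congr rfl fun μ _ => ?_
      rw [map_mul, MvPolynomial.eval_C, map_prod, Fin.prod_univ_succ]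
      simp only [map_pow, MvPolynomial.eval_X, Fin.cons_zero, Fin.cons_succ, F]
      rw [Finset.mul_sum, Finset.sum_mul]
    rw [h2, Finset.sum_comm' (s' := fun y => {μ₀ y})
      (t' := (boundedMatrices n (s p) ×ˢ boundedMatrices n (s p)).filter
        fun y => ∀ j, ∑ i, y.2 i j + crossSum y.1 j = p j)]
    · simp only [Finset.sum_singleton]
    · intro μ y
      simp only [Finset.mem_filter, Finset.mem_singleton]
      constructor
      · rintro ⟨_, hy, h3, h4, h5⟩
        refine ⟨?_, hy, h5⟩
        funext i
        refine Fin.cases ?_ (fun i => ?_) i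
        · simp only [μ₀, Fin.cons_zero]; exact h3.symm
        · simp only [μ₀, Fin.cons_succ]; exact (h4 i).symm
      · rintro ⟨rfl, hy, h5⟩
        have hs : 2 * (∑ i, ∑ j, y.1 i j) + ∑ i, ∑ j, y.2 i j = s p := by
          rw [s, ← Finset.sum_congr rfl fun j _ => h5 j, Finset.sum_add_distrib, sum_crossSum,
            Finset.sum_comm (f := fun j i => y.2 i j)]
          ring
        refine ⟨⟨?_, ?_⟩, hy, ?_, fun i => ?_, h5⟩
        · rw [Fintype.mem_piFinset]
          intro i
          rw [Finset.mem_range, Nat.lt_succ_iff]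
          refine Fin.cases ?_ (fun i => ?_) i
          · simp only [μ₀, Fin.cons_zero]; omega
          · simp only [μ₀, Fin.cons_succ]
            have := Finset.single_le_sum (f := fun i => ∑ j, y.2 i j) (fun _ _ => Nat.zero_le _)
              (Finset.mem_univ i)
            omega
        · simpa only [μ₀, Fin.cons_zero, Fin.cons_succ] using hs
        · simp only [μ₀, Fin.cons_zero]
        · simp only [μ₀, Fin.cons_succ]
  rw [h1, Finset.sum_finset_product' _
    ((boundedMatrices n (s p)).filter fun Λ => ∀ j, crossSum Λ j ≤ p j)
    (fun Λ => (boundedMatrices n (s p)).filter fun Ω => ∀ j, ∑ i, Ω i j = p j - crossSum Λ j)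
    ?_ (f := fun Λ Ω => F (μ₀ (Λ, Ω)) (Λ, Ω))]
  · refine Finset.sum_congr rfl fun Λ _ => ?_
    rw [← sum_columns (fun i j => x i * M i j) (q := fun j => p j - crossSum Λ j) (T := s p)
      fun j => (Nat.sub_le _ _).trans (hp j), Finset.mul_sum]
    refine Finset.sum_congr rfl fun Ω _ => ?_
    simp only [F, μ₀, Fin.cons_zero, Fin.cons_succ]
    have h3 : ∏ i, ∏ j, (x i * M i j) ^ Ω i j / ((Ω i j).factorial : ℝ) =
        (∏ i, ∏ j, M i j ^ Ω i j / ((Ω i j).factorial : ℝ)) * ∏ i, x i ^ ∑ j, Ω i j := by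
      rw [← Finset.prod_mul_distrib]
      refine Finset.prod_congr rfl fun i _ => ?_
      rw [← Finset.prod_pow_eq_pow_sum, ← Finset.prod_mul_distrib]
      exact Finset.prod_congr rfl fun j _ => by rw [mul_pow]; ring
    have h4 : ∏ i, ∏ j, M i j ^ (Λ i j + Ω i j) /
        (((Λ i j).factorial : ℝ) * ((Ω i j).factorial : ℝ)) =
        (∏ i, ∏ j, M i j ^ Λ i j / ((Λ i j).factorial : ℝ)) *
          ∏ i, ∏ j, M i j ^ Ω i j / ((Ω i j).factorial : ℝ) := by
      rw [← Finset.prod_mul_distrib]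
      refine Finset.prod_congr rfl fun i _ => ?_
      rw [← Finset.prod_mul_distrib]
      exact Finset.prod_congr rfl fun j _ => by rw [pow_add, mul_div_mul_comm]
    rw [h3, h4]
    ring
  · rintro ⟨Λ, Ω⟩
    simp only [Finset.mem_filter, Finset.mem_product]
    constructor
    · rintro ⟨⟨h3, h4⟩, h5⟩
      exact ⟨⟨h3, fun j => by have := h5 j; omega⟩, h4, fun j => by have := h5 j; omega⟩
    · rintro ⟨⟨h3, h6⟩, h4, h5⟩
      exact ⟨⟨h3, h4⟩, fun j => by have := h5 j; have := h6 j; omega⟩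

/-- The homogeneous generating function of the values of the polynomials `P_{k,p,M}`. -/
lemma sum_eval_P (k : ℝ) (σ : ℕ) (M : Matrix (Fin n) (Fin n) ℝ) (m : ℝ) (x : Fin n → ℝ)
    (z : Fin n → ℂ) :
    ∑ p ∈ Finset.piAntidiag Finset.univ σ, (∏ j, z j ^ p j) *
      ((MvPolynomial.eval (Fin.cons m x : Fin (n + 1) → ℝ) (P k p M) : ℝ) : ℂ) =
    2 ^ σ * taylorPoly k σ ((∑ i, ∑ j, (M i j : ℂ) * z i * z j) / 2) m
      (∑ j, (∑ i, (x i : ℂ) * M i j) * z j) := by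
  let G (Λ : Fin n → Fin n → ℕ) : ℂ := (-1) ^ (∑ i, ∑ j, Λ i j) * 2 ^ (σ - ∑ i, ∑ j, Λ i j) *
    (gammaQuotient k σ (∑ i, ∑ j, Λ i j) : ℂ) * (m : ℂ) ^ (∑ i, ∑ j, Λ i j)
  let W (Λ : Fin n → Fin n → ℕ) : ℂ :=
    ∏ i, ∏ j, ((M i j : ℂ) * z i * z j) ^ Λ i j / ((Λ i j).factorial : ℂ)
  let ℓ : ℂ := ∑ j, (∑ i, (x i : ℂ) * M i j) * z j
  have hz (Λ : Fin n → Fin n → ℕ) : ∏ j, z j ^ crossSum Λ j = ∏ i, ∏ j, (z i * z j) ^ Λ i j := by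
    unfold crossSum
    simp_rw [pow_add, ← Finset.prod_pow_eq_pow_sum, mul_pow]
    rw [Finset.prod_mul_distrib, Finset.prod_comm (f := fun j i => z j ^ Λ i j),
      ← Finset.prod_mul_distrib]
    exact Finset.prod_congr rfl fun i _ => (Finset.prod_mul_distrib).symm
  have h1 : ∑ p ∈ Finset.piAntidiag Finset.univ σ, (∏ j, z j ^ p j) *
      ((MvPolynomial.eval (Fin.cons m x : Fin (n + 1) → ℝ) (P k p M) : ℝ) : ℂ) =
      ∑ p ∈ Finset.piAntidiag Finset.univ σ,
        ∑ Λ ∈ boundedMatrices n σ with ∀ j, crossSum Λ j ≤ p j, G Λ * W Λ *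
          ∏ j, (((∑ i, (x i : ℂ) * M i j) * z j) ^ (p j - crossSum Λ j) /
            ((p j - crossSum Λ j).factorial : ℂ)) := by
    refine Finset.sum_congr rfl fun p hp => ?_
    have hp' : s p = σ := (Finset.mem_piAntidiag.1 hp).1
    rw [eval_P, hp']
    push_cast
    rw [Finset.mul_sum]
    refine Finset.sum_congr rfl fun Λ hΛ => ?_
    have hΛ' := (Finset.mem_filter.1 hΛ).2
    have h2 : ∏ j, z j ^ p j = (∏ i, ∏ j, (z i * z j) ^ Λ i j) *
        ∏ j, z j ^ (p j - crossSum Λ j) := by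
      rw [← hz, ← Finset.prod_mul_distrib]
      refine Finset.prod_congr rfl fun j _ => ?_
      rw [← pow_add, Nat.add_sub_cancel' (hΛ' j)]
    have h3 : W Λ = (∏ i, ∏ j, (z i * z j) ^ Λ i j) *
        ∏ i, ∏ j, (M i j : ℂ) ^ Λ i j / ((Λ i j).factorial : ℂ) := by
      rw [← Finset.prod_mul_distrib]
      refine Finset.prod_congr rfl fun i _ => ?_
      rw [← Finset.prod_mul_distrib]
      exact Finset.prod_congr rfl fun j _ => by rw [mul_assoc, mul_pow]; ring
    have h4 : ∏ j, (((∑ i, (x i : ℂ) * M i j) * z j) ^ (p j - crossSum Λ j) /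
            ((p j - crossSum Λ j).factorial : ℂ)) = (∏ j, z j ^ (p j - crossSum Λ j)) *
          ∏ j, ((∑ i, (x i : ℂ) * M i j) ^ (p j - crossSum Λ j) /
            ((p j - crossSum Λ j).factorial : ℂ)) := by
      rw [← Finset.prod_mul_distrib]
      exact Finset.prod_congr rfl fun j _ => by rw [mul_pow]; ring
    rw [h2, h3, h4]
    simp only [G]
    ring
  have h5 : ∑ p ∈ Finset.piAntidiag Finset.univ σ,
        ∑ Λ ∈ boundedMatrices n σ with ∀ j, crossSum Λ j ≤ p j, G Λ * W Λ *
          ∏ j, (((∑ i, (x i : ℂ) * M i j) * z j) ^ (p j - crossSum Λ j) /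
            ((p j - crossSum Λ j).factorial : ℂ)) =
      ∑ Λ ∈ boundedMatrices n σ with ∑ i, ∑ j, Λ i j ≤ σ / 2, G Λ * W Λ *
        (ℓ ^ (σ - 2 * ∑ i, ∑ j, Λ i j) / ((σ - 2 * ∑ i, ∑ j, Λ i j).factorial : ℂ)) := by
    rw [Finset.sum_comm' (s' := fun Λ => (Finset.piAntidiag Finset.univ σ).filter
        fun p => ∀ j, crossSum Λ j ≤ p j)
      (t' := (boundedMatrices n σ).filter fun Λ => ∑ i, ∑ j, Λ i j ≤ σ / 2)]
    · refine Finset.sum_congr rfl fun Λ hΛ => ?_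
      have hΛ' := (Finset.mem_filter.1 hΛ).2
      rw [← Finset.mul_sum]
      congr 1
      have h6 := sum_box_multinomial (fun j => (∑ i, (x i : ℂ) * M i j) * z j)
        (N := σ - 2 * ∑ i, ∑ j, Λ i j) (T := σ) (Nat.sub_le _ _)
      rw [show ∑ j, (∑ i, (x i : ℂ) * M i j) * z j = ℓ from rfl] at h6
      rw [← h6]
      refine Finset.sum_nbij' (fun p j => p j - crossSum Λ j) (fun q j => q j + crossSum Λ j)
        ?_ ?_ ?_ ?_ ?_
      · intro p hp
        simp only [Finset.mem_filter, Finset.mem_piAntidiag, Finset.mem_univ, implies_true,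
          and_true, Fintype.mem_piFinset, Finset.mem_range] at hp ⊢
        have h7 : ∑ j, (p j - crossSum Λ j) + 2 * ∑ i, ∑ j, Λ i j = σ := by
          rw [← sum_crossSum, ← Finset.sum_add_distrib, ← hp.1]
          exact Finset.sum_congr rfl fun j _ => Nat.sub_add_cancel (hp.2 j)
        refine ⟨fun j => ?_, by omega⟩
        have := Finset.single_le_sum (f := fun j => p j - crossSum Λ j)
          (fun _ _ => Nat.zero_le _) (Finset.mem_univ j)
        omega
      · intro q hq
        simp only [Finset.mem_filter, Finset.mem_piAntidiag, Finset.mem_univ, implies_true,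
          and_true, Fintype.mem_piFinset, Finset.mem_range] at hq ⊢
        refine ⟨?_, fun j => by omega⟩
        rw [Finset.sum_add_distrib, sum_crossSum, hq.2]
        omega
      · intro p hp
        simp only [Finset.mem_filter] at hp
        funext j
        exact Nat.sub_add_cancel (hp.2 j)
      · intro q _
        funext j
        simp
      · intro p _; rfl
    · intro p Λ
      simp only [Finset.mem_filter]
      constructor
      · rintro ⟨hp, hΛ, hc⟩
        refine ⟨⟨hp, hc⟩, hΛ, ?_⟩
        have h6 := Finset.sum_le_sum fun j (_ : j ∈ Finset.univ) => hc j
        rw [sum_crossSum, (Finset.mem_piAntidiag.1 hp).1] at h6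
        omega
      · rintro ⟨⟨hp, hc⟩, hΛ, _⟩
        exact ⟨hp, hΛ, hc⟩
  rw [h1, h5, ← Finset.sum_fiberwise_of_maps_to (s := (boundedMatrices n σ).filter
    fun Λ => ∑ i, ∑ j, Λ i j ≤ σ / 2) (t := Finset.range (σ / 2 + 1))
    (g := fun Λ => ∑ i, ∑ j, Λ i j)
    fun Λ hΛ => Finset.mem_range.2 (Nat.lt_succ_iff.2 (Finset.mem_filter.1 hΛ).2), taylorPoly,
    Finset.mul_sum]
  refine Finset.sum_congr rfl fun μ hμ => ?_
  have hμ' : μ ≤ σ / 2 := Nat.lt_succ_iff.1 (Finset.mem_range.1 hμ)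
  have hset : (((boundedMatrices n σ).filter fun Λ => ∑ i, ∑ j, Λ i j ≤ σ / 2).filter
      fun Λ => ∑ i, ∑ j, Λ i j = μ) =
        (boundedMatrices n σ).filter fun Λ => ∑ i, ∑ j, Λ i j = μ := by
    ext Λ
    simp only [Finset.mem_filter]
    constructor
    · rintro ⟨⟨h6, _⟩, h7⟩; exact ⟨h6, h7⟩
    · rintro ⟨h6, h7⟩; exact ⟨⟨h6, h7.trans_le hμ'⟩, h7⟩
  have h6 := sum_matrices_multinomial (fun i j => (M i j : ℂ) * z i * z j) (N := μ) (T := σ)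
    (hμ'.trans (Nat.div_le_self _ _))
  have h7 : (2 : ℂ) ^ σ = 2 ^ (σ - μ) * 2 ^ μ := by
    rw [← pow_add, Nat.sub_add_cancel (hμ'.trans (Nat.div_le_self _ _))]
  rw [hset, mul_pow, div_pow]
  calc _ = ∑ Λ ∈ boundedMatrices n σ with ∑ i, ∑ j, Λ i j = μ,
        ((-1) ^ μ * 2 ^ (σ - μ) * (gammaQuotient k σ μ : ℂ) * (m : ℂ) ^ μ *
        (ℓ ^ (σ - 2 * μ) / ((σ - 2 * μ).factorial : ℂ))) * W Λ := by
        refine Finset.sum_congr rfl fun Λ hΛ => ?_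
        simp only [G, (Finset.mem_filter.1 hΛ).2]
        ring
    _ = _ := by
        rw [← Finset.mul_sum, h6, h7]
        field_simp
        ring

end Polynomials

/-! ### Linear combinations of powers of theta series -/

section Powers

lemma e_sum {κ : Type*} (S : Finset κ) (f : κ → ℂ) : e (∑ i ∈ S, f i) = ∏ i ∈ S, e (f i) := by
  classical
  induction S using Finset.induction_on with
  | empty => simp [e_zero]
  | insert i S hi ih => rw [Finset.sum_insert hi, Finset.prod_insert hi, e_add, ih]

variable {V : Type*} [AddCommGroup V] [Module ℝ V] {n N' : ℕ} {ι : Type*}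

/-- The exponent of `τ` at the index `(i, v₁, …, v_{N'})` in the expansion of
`∑ aᵢ θ_{αᵢ,βᵢ}^{N'}`. -/
def powExp (B : LinearMap.BilinForm ℝ V) (b : Module.Basis (Fin n) ℝ V) (N' : ℕ) (α : ι → V)
    (x : ι × (Fin N' → Fin n → ℤ)) : ℝ := ∑ j, Q B (α x.1 + lam b (x.2 j))

/-- The vector paired with `z` at the index `(i, v₁, …, v_{N'})` in the expansion of
`∑ aᵢ θ_{αᵢ,βᵢ}^{N'}`. -/
def powVec (b : Module.Basis (Fin n) ℝ V) (N' : ℕ) (α : ι → V)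
    (x : ι × (Fin N' → Fin n → ℤ)) : V := ∑ j, (α x.1 + lam b (x.2 j))

/-- The coefficient at the index `(i, v₁, …, v_{N'})` in the expansion of
`∑ aᵢ θ_{αᵢ,βᵢ}^{N'}`. -/
def powCoeff (B : LinearMap.BilinForm ℝ V) (b : Module.Basis (Fin n) ℝ V) (N' : ℕ) (β : ι → V)
    (a : ι → ℂ) (x : ι × (Fin N' → Fin n → ℤ)) : ℂ :=
  a x.1 * e (B (β x.1) (∑ j, lam b (x.2 j)))

/-- The pairing of `z` with `powVec`. -/
def powLin (B : LinearMap.BilinForm ℝ V) (b : Module.Basis (Fin n) ℝ V) (N' : ℕ) (α : ι → V)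
    (z : ℂ ⊗[ℝ] V) (x : ι × (Fin N' → Fin n → ℤ)) : ℂ :=
  B.baseChange ℂ ((1 : ℂ) ⊗ₜ[ℝ] powVec b N' α x) z

variable {B : LinearMap.BilinForm ℝ V} {b : Module.Basis (Fin n) ℝ V}

lemma expTame_powExp [Fintype ι] (hsymm : B.IsSymm) (hpos : ∀ x : V, x ≠ 0 → 0 < B x x)
    (α : ι → V) : ExpTame (powExp B b N' α) :=
  ExpTame.prodFintype fun i => (expTame_coset hsymm hpos b (α i)).pi N'

lemma powLin_eq_sum (α : ι → V) (z : ℂ ⊗[ℝ] V) (x : ι × (Fin N' → Fin n → ℤ)) :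
    powLin B b N' α z x =
      ∑ j, B.baseChange ℂ ((1 : ℂ) ⊗ₜ[ℝ] (α x.1 + lam b (x.2 j))) z := by
  rw [powLin, powVec, TensorProduct.tmul_sum, map_sum, LinearMap.sum_apply]

lemma littleBd_powLin (hsymm : B.IsSymm) (hpos : ∀ x : V, x ≠ 0 → 0 < B x x) (α : ι → V)
    (z : ℂ ⊗[ℝ] V) : LittleBd (powExp B b N' α) (powLin B b N' α z) := fun ε hε => by
  obtain ⟨C, hC⟩ := baseChange_le_eps_Q hsymm hpos z ε hε
  refine ⟨∑ _j : Fin N', C, fun x => ?_⟩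
  rw [powLin_eq_sum, powExp, Finset.mul_sum, ← Finset.sum_add_distrib]
  exact (norm_sum_le _ _).trans (Finset.sum_le_sum fun j _ => hC _)

lemma polyBd_powCoeff [Fintype ι] (m : ι × (Fin N' → Fin n → ℤ) → ℝ) (β : ι → V) (a : ι → ℂ) :
    PolyBd m (powCoeff B b N' β a) :=
  PolyBd.of_bounded (C := ∑ i, ‖a i‖) fun x => by
    rw [powCoeff, norm_mul, norm_e_real, mul_one]
    exact Finset.single_le_sum (f := fun i => ‖a i‖) (fun _ _ => norm_nonneg _)
      (Finset.mem_univ x.1)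

/-- The expansion of a linear combination of `N'`-th powers of theta series. -/
lemma sum_thetaChar_pow [Fintype ι] (hsymm : B.IsSymm) (hpos : ∀ x : V, x ≠ 0 → 0 < B x x)
    (α β : ι → V) (a : ι → ℂ) {τ : ℂ} (hτ : 0 < τ.im) (z : ℂ ⊗[ℝ] V) :
    ∑ i, a i * thetaChar B b (α i) (β i) τ z ^ N' =
      expSeries (powCoeff B b N' β a) (powExp B b N' α) (powLin B b N' α z) τ := by
  have hs := summable_expSeries (expTame_powExp (b := b) (N' := N') hsymm hpos α)
    (polyBd_powCoeff (B := B) (b := b) _ β a) (littleBd_powLin hsymm hpos α z) hτ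
  rw [expSeries, hs.of_norm.tsum_prod, tsum_fintype]
  refine Finset.sum_congr rfl fun i _ => ?_
  have h1 := (summable_and_tsum_prod_pi (k := N') (fun _ v => e (B (β i) (lam b v)) *
    e (τ * Q B (α i + lam b v) + B.baseChange ℂ ((1 : ℂ) ⊗ₜ[ℝ] (α i + lam b v)) z))
    (fun _ => summable_thetaChar hsymm hpos b (α i) (β i) hτ z)).2
  rw [Finset.prod_const, Finset.card_univ, Fintype.card_fin] at h1
  rw [thetaChar, expSeries, ← h1, ← tsum_mul_left]
  refine tsum_congr fun v => ?_
  rw [powCoeff, powLin_eq_sum, powExp, mul_assoc, Finset.prod_mul_distrib, ← e_sum, ← e_sum,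
    Finset.sum_add_distrib, ← Finset.mul_sum, map_sum]
  push_cast
  rfl

/-- For admissible characteristics the exponents of `τ` are natural numbers. -/
lemma EvenLattice.exists_powExp {b' : Module.Basis (Fin n) ℝ V} {N : ℕ}
    (h : EvenLattice B b b' N) {α β : ι → V} (hαβ : ∀ i, Admissible B b b' N' (α i) (β i)) :
    ∃ k : ι × (Fin N' → Fin n → ℤ) → ℕ, powExp B b N' α = fun x => (k x : ℝ) := by
  have key : ∀ x, ∃ k : ℕ, powExp B b N' α x = k := by
    intro x
    have h1 : powExp B b N' α x ∈ IntR := by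
      have : powExp B b N' α x = N' * Q B (α x.1) +
          ∑ j, (Q B (lam b (x.2 j)) + B (α x.1) (lam b (x.2 j))) := by
        rw [powExp]
        simp_rw [Q_add h.symm, add_assoc]
        rw [Finset.sum_add_distrib]
        simp
      rw [this]
      obtain ⟨m, hm⟩ := (hαβ x.1).left
      refine add_mem (hαβ x.1).norm (sum_mem fun j _ => add_mem (h.even _) ?_)
      rw [hm]; exact h.B_dual_lam _ _
    obtain ⟨k, hk⟩ := mem_IntR.1 h1
    have h2 : (0 : ℝ) ≤ k := hk ▸ Finset.sum_nonneg fun j _ => Q_nonneg h.pos _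
    refine ⟨k.toNat, ?_⟩
    rw [hk]
    have : (0 : ℤ) ≤ k := by exact_mod_cast h2
    exact_mod_cast (Int.toNat_of_nonneg this).symm
  choose k hk using key
  exact ⟨k, funext hk⟩

/-- The linear combination of powers transforms like a Jacobi form under `Γ₁(N)`. -/
lemma EvenLattice.powSeries_moeb [Fintype ι] {b' : Module.Basis (Fin n) ℝ V} {N : ℕ}
    (h : EvenLattice B b b' N) (hN'0 : N' ≠ 0) (hN' : N' ∣ N) {α β : ι → V}
    (hαβ : ∀ i, Admissible B b b' N' (α i) (β i)) (a : ι → ℂ) {γ : SL(2, ℤ)}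
    (hγ : γ ∈ CongruenceSubgroup.Gamma1 N) :
    ∃ (ρ : ℂ → ℂ) (u : ℂ), ‖u‖ = 1 ∧ DifferentiableOn ℂ ρ {τ | 0 < τ.im} ∧
      (∀ τ, 0 < τ.im → ρ τ ^ 2 = u * autJ γ τ ^ (N' * n)) ∧
      ∀ τ, 0 < τ.im → ∀ z : ℂ ⊗[ℝ] V,
        expSeries (powCoeff B b N' β a) (powExp B b N' α)
          (powLin B b N' α ((autJ γ τ)⁻¹ • z)) (moeb γ τ) =
        ρ τ * e (γ 1 0 * (N' * QC B z) / autJ γ τ) *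
          expSeries (powCoeff B b N' β a) (powExp B b N' α) (powLin B b N' α z) τ := by
  have hc : (N : ℤ) ∣ γ 1 0 := by
    rw [← ZMod.intCast_zmod_eq_zero_iff_dvd]
    exact ((CongruenceSubgroup.Gamma1_mem _ _).1 hγ).2.2
  obtain ⟨r, u, hu, hd, hsq, hr⟩ := h.hasFactor hc
  refine ⟨fun τ => r τ ^ N', u ^ N', by rw [norm_pow, hu, one_pow], hd.pow _, fun τ hτ => ?_,
    fun τ hτ z => ?_⟩
  · rw [← pow_mul, mul_comm N' 2, pow_mul, hsq τ hτ, mul_pow, ← pow_mul, mul_comm n]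
  · rw [← sum_thetaChar_pow h.symm h.pos α β a (moeb_im_pos γ hτ),
      ← sum_thetaChar_pow h.symm h.pos α β a hτ, Finset.mul_sum]
    refine Finset.sum_congr rfl fun i _ => ?_
    obtain ⟨ξ, hξ, h1⟩ := h.thetaChar_moeb hN'0 hN' hγ hr (hαβ i)
    rw [h1 τ hτ z, mul_pow, mul_pow, mul_pow, hξ, ← e_nsmul]
    have : (N' : ℂ) * (γ 1 0 * QC B z / autJ γ τ) = γ 1 0 * (N' * QC B z) / autJ γ τ := by ring
    rw [this]; ring

end Powers

/-! ### The modular forms attached to the exponents -/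

section Forms

/-- A homogeneous polynomial that vanishes at all points has vanishing coefficients. -/
lemma eq_zero_of_sum_piAntidiag {n σ : ℕ} {A : (Fin n → ℕ) → ℂ}
    (h : ∀ Z : Fin n → ℂ, ∑ p ∈ Finset.piAntidiag Finset.univ σ, (∏ j, Z j ^ p j) * A p = 0)
    {p : Fin n → ℕ} (hp : s p = σ) : A p = 0 := by
  classical
  set F : MvPolynomial (Fin n) ℂ := ∑ q ∈ Finset.piAntidiag Finset.univ σ,
    MvPolynomial.monomial (Finsupp.equivFunOnFinite.symm q) (A q) with hF
  have h0 : F = 0 := by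
    refine MvPolynomial.funext fun Z => ?_
    rw [hF, map_sum, map_zero, ← h Z]
    refine Finset.sum_congr rfl fun q _ => ?_
    rw [MvPolynomial.eval_monomial, Finsupp.prod_fintype _ _ fun i => pow_zero _, mul_comm]
    simp
  have h1 := congrArg (MvPolynomial.coeff (Finsupp.equivFunOnFinite.symm p)) h0
  rw [hF, MvPolynomial.coeff_sum, MvPolynomial.coeff_zero,
    Finset.sum_eq_single p] at h1
  · simpa using h1
  · intro q _ hq
    rw [MvPolynomial.coeff_monomial, if_neg]
    exact fun h2 => hq (Finsupp.equivFunOnFinite.symm.injective h2)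
  · intro hp'
    exact absurd (by simpa [Finset.mem_piAntidiag, s] using hp) hp'

variable {V : Type*} [AddCommGroup V] [Module ℝ V] {n N' : ℕ} {ι : Type*}

/-- The point of the complexification of `V` with the coordinates `Z`. -/
def coordPt (b : Module.Basis (Fin n) ℝ V) (Z : Fin n → ℂ) : ℂ ⊗[ℝ] V :=
  ∑ j, Z j • ((1 : ℂ) ⊗ₜ[ℝ] b j)

/-- The value of `P_{N' n / 2, p, N' G}` at the exponent of `τ` and the coordinates of the vector
paired with `z`, divided by `N'`. -/
def powPoly (B : LinearMap.BilinForm ℝ V) (b : Module.Basis (Fin n) ℝ V) (N' : ℕ) (α : ι → V)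
    (p : Fin n → ℕ) (x : ι × (Fin N' → Fin n → ℤ)) : ℝ :=
  MvPolynomial.eval (Fin.cons (powExp B b N' α x) (b.repr ((N' : ℝ)⁻¹ • powVec b N' α x)) :
    Fin (n + 1) → ℝ) (P ((N' : ℝ) * (n : ℝ) / 2) p ((N' : ℝ) • gram B b))

variable {B : LinearMap.BilinForm ℝ V} {b : Module.Basis (Fin n) ℝ V}

lemma QC_coordPt (Z : Fin n → ℂ) :
    QC B (coordPt b Z) = (∑ i, ∑ j, (gram B b i j : ℂ) * Z i * Z j) / 2 := by
  unfold QC coordPt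
  simp only [map_sum, LinearMap.sum_apply, map_smul, LinearMap.smul_apply, smul_eq_mul,
    baseChange_one_tmul, one_mul, gram, Matrix.of_apply]
  rw [Finset.sum_comm]
  congr 1
  refine Finset.sum_congr rfl fun i _ => ?_
  rw [Finset.mul_sum]
  exact Finset.sum_congr rfl fun j _ => by ring

lemma powLin_basis (α : ι → V) (j : Fin n) (x : ι × (Fin N' → Fin n → ℤ)) :
    powLin B b N' α ((1 : ℂ) ⊗ₜ[ℝ] b j) x = (B (powVec b N' α x) (b j) : ℂ) := by
  rw [powLin, baseChange_one_tmul, one_mul]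

lemma powLin_smul (α : ι → V) (a : ℂ) (z : ℂ ⊗[ℝ] V) :
    powLin B b N' α (a • z) = fun x => a * powLin B b N' α z x := by
  funext x
  rw [powLin, map_smul, smul_eq_mul]
  rfl

lemma powLin_coordPt (α : ι → V) (Z : Fin n → ℂ) (x : ι × (Fin N' → Fin n → ℤ)) :
    powLin B b N' α (coordPt b Z) x = ∑ j, (B (powVec b N' α x) (b j) : ℂ) * Z j := by
  rw [powLin, coordPt, map_sum]
  refine Finset.sum_congr rfl fun j _ => ?_
  rw [map_smul, smul_eq_mul, baseChange_one_tmul, one_mul, mul_comm]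

lemma sum_repr_gram (hN'0 : N' ≠ 0) (w : V) (j : Fin n) :
    ∑ i, b.repr ((N' : ℝ)⁻¹ • w) i * ((N' : ℝ) • gram B b) i j = B w (b j) := by
  have h0 : (N' : ℝ) ≠ 0 := by exact_mod_cast hN'0
  have h1 : B w (b j) = ∑ i, b.repr w i * B (b i) (b j) := by
    conv_lhs => rw [← b.sum_repr w]
    simp [-Module.Basis.sum_repr]
  rw [h1]
  refine Finset.sum_congr rfl fun i _ => ?_
  rw [map_smul, Finsupp.smul_apply, Matrix.smul_apply, smul_eq_mul, smul_eq_mul, gram,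
    Matrix.of_apply]
  field_simp

/-- The generating function of the values `powPoly`. -/
lemma sum_powPoly (hN'0 : N' ≠ 0) (α : ι → V) (σ : ℕ) (Z : Fin n → ℂ)
    (x : ι × (Fin N' → Fin n → ℤ)) :
    ∑ p ∈ Finset.piAntidiag Finset.univ σ, (∏ j, Z j ^ p j) * (powPoly B b N' α p x : ℂ) =
      2 ^ σ * taylorPoly ((N' : ℝ) * n / 2) σ (N' * QC B (coordPt b Z)) (powExp B b N' α x)
        (powLin B b N' α (coordPt b Z) x) := by
  unfold powPoly
  rw [sum_eval_P, powLin_coordPt, QC_coordPt]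
  congr 2
  · rw [mul_div_assoc', Finset.mul_sum]
    congr 1
    refine Finset.sum_congr rfl fun i _ => ?_
    rw [Finset.mul_sum]
    refine Finset.sum_congr rfl fun j _ => ?_
    simp [mul_assoc]
  · refine Finset.sum_congr rfl fun j _ => ?_
    rw [← sum_repr_gram hN'0]
    push_cast
    rfl

lemma gammaQuotient_pos {k : ℝ} (hk : 0 < k) (σ : ℕ) : 0 < gammaQuotient k σ 0 := by
  refine Finset.prod_pos fun m hm => ?_
  rw [Finset.mem_Icc] at hm
  have h0 : 0 ≤ m := by omega
  have : (0 : ℝ) ≤ m := by exact_mod_cast h0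
  linarith

/-- The expansion of `powPoly` in monomials in the pairings with the basis vectors; the leading
coefficient does not vanish. -/
lemma powPoly_eq (hn : 1 ≤ n) (hN'0 : N' ≠ 0) (α : ι → V) (p : Fin n → ℕ) :
    ∃ K : (Fin n → Fin n → ℕ) → ℂ, K 0 ≠ 0 ∧ ∀ x, (powPoly B b N' α p x : ℂ) =
      ∑ Λ ∈ boundedMatrices n (s p) with ∀ j, crossSum Λ j ≤ p j,
        K Λ * (powExp B b N' α x : ℂ) ^ (∑ i, ∑ j, Λ i j) *
          ∏ j, (B (powVec b N' α x) (b j) : ℂ) ^ (p j - crossSum Λ j) := by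
  refine ⟨fun Λ => (((-1) ^ (∑ i, ∑ j, Λ i j) * 2 ^ (s p - ∑ i, ∑ j, Λ i j) *
    gammaQuotient ((N' : ℝ) * n / 2) (s p) (∑ i, ∑ j, Λ i j) *
    (∏ i, ∏ j, ((N' : ℝ) • gram B b) i j ^ Λ i j / ((Λ i j).factorial : ℝ)) *
    ∏ j, ((p j - crossSum Λ j).factorial : ℝ)⁻¹ : ℝ) : ℂ), ?_, fun x => ?_⟩
  · have hk : (0 : ℝ) < (N' : ℝ) * n / 2 := by
      have h1 : (0 : ℝ) < N' := by exact_mod_cast Nat.pos_of_ne_zero hN'0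
      have h2 : (0 : ℝ) < n := by exact_mod_cast hn
      positivity
    rw [Complex.ofReal_ne_zero]
    simp only [Pi.zero_apply, Finset.sum_const_zero, pow_zero, Nat.factorial_zero, Nat.cast_one,
      div_one, Finset.prod_const_one, mul_one, one_mul, Nat.sub_zero]
    refine mul_ne_zero (mul_ne_zero (by positivity) (gammaQuotient_pos hk _).ne') ?_
    exact Finset.prod_ne_zero_iff.2 fun j _ => by positivity
  · rw [powPoly, eval_P, Complex.ofReal_sum]
    refine Finset.sum_congr rfl fun Λ _ => ?_
    simp_rw [sum_repr_gram hN'0]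
    simp only [div_eq_mul_inv, Finset.prod_mul_distrib]
    push_cast
    ring

lemma polyBd_monomial (hsymm : B.IsSymm) (hpos : ∀ x : V, x ≠ 0 → 0 < B x x) (α : ι → V)
    (p : Fin n → ℕ) : PolyBd (powExp B b N' α) fun x =>
      ∏ j, (B (powVec b N' α x) (b j) : ℂ) ^ p j := by
  refine PolyBd.prod _ fun j _ => PolyBd.pow ?_ _
  simp_rw [← powLin_basis]
  exact (littleBd_powLin hsymm hpos α _).polyBd
    fun x => Finset.sum_nonneg fun _ _ => Q_nonneg hpos _

lemma polyBd_powPoly (hsymm : B.IsSymm) (hpos : ∀ x : V, x ≠ 0 → 0 < B x x) (hn : 1 ≤ n)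
    (hN'0 : N' ≠ 0) (α : ι → V) (p : Fin n → ℕ) :
    PolyBd (powExp B b N' α) fun x => (powPoly B b N' α p x : ℂ) := by
  obtain ⟨K, -, hK⟩ := powPoly_eq (B := B) (b := b) hn hN'0 α p
  have h0 : ∀ x, 0 ≤ powExp B b N' α x :=
    fun x => Finset.sum_nonneg fun _ _ => Q_nonneg hpos _
  simp_rw [hK]
  refine PolyBd.sum h0 _ fun Λ _ => ?_
  exact ((PolyBd.const _).mul ((PolyBd.exponent h0).pow _)).mul
    (polyBd_monomial hsymm hpos α fun j => p j - crossSum Λ j)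

/-- The generating function of the series with the coefficients `powPoly`. -/
lemma sum_expSeries_powPoly [Fintype ι] (hsymm : B.IsSymm) (hpos : ∀ x : V, x ≠ 0 → 0 < B x x)
    (hn : 1 ≤ n) (hN'0 : N' ≠ 0) (α β : ι → V) (a : ι → ℂ) (σ : ℕ) (Z : Fin n → ℂ) {τ : ℂ}
    (hτ : 0 < τ.im) :
    ∑ p ∈ Finset.piAntidiag Finset.univ σ, (∏ j, Z j ^ p j) *
      expSeries (fun x => powCoeff B b N' β a x * powPoly B b N' α p x) (powExp B b N' α) 0 τ =
    2 ^ σ * expSeries (fun x => powCoeff B b N' β a x * taylorPoly ((N' : ℝ) * n / 2) σ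
      (N' * QC B (coordPt b Z)) (powExp B b N' α x) (powLin B b N' α (coordPt b Z) x))
        (powExp B b N' α) 0 τ := by
  have hm := expTame_powExp (b := b) (N' := N') hsymm hpos α
  rw [← expSeries_const_mul, expSeries]
  refine (HasSum.tsum_eq ?_).symm
  have h1 := hasSum_sum (s := Finset.piAntidiag Finset.univ σ)
    fun p _ => (hasSum_expSeries hm ((polyBd_powCoeff (B := B) (b := b) _ β a).mul
      (polyBd_powPoly hsymm hpos hn hN'0 α p)) (LittleBd.zero hm.1) hτ).mul_left (∏ j, Z j ^ p j)
  refine h1.congr_fun fun x => ?_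
  have h2 := sum_powPoly (B := B) (b := b) hN'0 α σ Z x
  rw [mul_left_comm, ← h2, Finset.mul_sum, Finset.sum_mul]
  refine Finset.sum_congr rfl fun p _ => ?_
  simp only [Pi.zero_apply]
  ring

variable {b' : Module.Basis (Fin n) ℝ V} {N : ℕ}

/-- The series with the coefficients `powPoly` transform like modular forms of weight
`N' n / 2 + s(p)` under `Γ₁(N)`, up to a factor of absolute value one. -/
lemma EvenLattice.norm_powPoly_series_moeb [Fintype ι] (h : EvenLattice B b b' N) (hn : 1 ≤ n)
    (hN'0 : N' ≠ 0) (hN' : N' ∣ N) {α β : ι → V}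
    (hαβ : ∀ i, Admissible B b b' N' (α i) (β i)) (a : ι → ℂ) (p : Fin n → ℕ) {γ : SL(2, ℤ)}
    (hγ : γ ∈ CongruenceSubgroup.Gamma1 N) {τ : ℂ} (hτ : 0 < τ.im) :
    ‖expSeries (fun x => powCoeff B b N' β a x * powPoly B b N' α p x) (powExp B b N' α) 0
      (moeb γ τ)‖ ^ 2 = ‖autJ γ τ‖ ^ (N' * n + 2 * s p) *
      ‖expSeries (fun x => powCoeff B b N' β a x * powPoly B b N' α p x) (powExp B b N' α) 0
        τ‖ ^ 2 := by
  obtain ⟨ρ, u, hu, hd, hsq, hT⟩ := h.powSeries_moeb hN'0 hN' hαβ a hγ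
  have hu0 : u ≠ 0 := by rw [← norm_ne_zero_iff, hu]; exact one_ne_zero
  have hm := expTame_powExp (b := b) (N' := N') h.symm h.pos α
  have key : expSeries (fun x => powCoeff B b N' β a x * powPoly B b N' α p x)
      (powExp B b N' α) 0 (moeb γ τ) = ρ τ * autJ γ τ ^ s p *
      expSeries (fun x => powCoeff B b N' β a x * powPoly B b N' α p x) (powExp B b N' α) 0 τ := by
    rw [← sub_eq_zero]
    -- compare the generating functions of both sides at `Z`, which belong to the direction `Z`
    refine eq_zero_of_sum_piAntidiag (σ := s p) (A := fun p' =>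
      expSeries (fun x => powCoeff B b N' β a x * powPoly B b N' α p' x)
        (powExp B b N' α) 0 (moeb γ τ) - ρ τ * autJ γ τ ^ s p *
      expSeries (fun x => powCoeff B b N' β a x * powPoly B b N' α p' x)
        (powExp B b N' α) 0 τ) (fun Z => ?_) rfl
    simp_rw [mul_sub, mul_left_comm (∏ j, Z j ^ _) (ρ τ * autJ γ τ ^ s p)]
    rw [Finset.sum_sub_distrib, ← Finset.mul_sum,
      sum_expSeries_powPoly h.symm h.pos hn hN'0 α β a _ Z (moeb_im_pos γ hτ),
      sum_expSeries_powPoly h.symm h.pos hn hN'0 α β a _ Z hτ, sub_eq_zero]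
    have h1 := taylorPoly_series_moeb hm (polyBd_powCoeff (B := B) (b := b) _ β a)
      (littleBd_powLin h.symm h.pos α (coordPt b Z)) (q := N' * QC B (coordPt b Z)) hu0 hd hsq
      (fun τ hτ t => by
        have h2 := hT τ hτ (t • coordPt b Z)
        rw [smul_smul, powLin_smul, powLin_smul, QC_smul] at h2
        rw [h2]
        congr 3
        ring) (s p) hτ
    rw [Nat.cast_mul] at h1
    rw [h1]
    ring
  have hρ : ‖ρ τ‖ ^ 2 = ‖autJ γ τ‖ ^ (N' * n) := by
    rw [← norm_pow, hsq τ hτ, norm_mul, hu, one_mul, norm_pow]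
  rw [key, norm_mul, norm_mul, norm_pow, mul_pow, mul_pow, hρ, pow_add, ← pow_mul,
    mul_comm 2 (s p)]

/-- Vanishing of the coefficients up to the bound implies vanishing of the modular form. -/
lemma EvenLattice.powPoly_series_eq_zero [Fintype ι] (h : EvenLattice B b b' N) (hn : 1 ≤ n)
    (hN0 : 0 < N) (hN'0 : N' ≠ 0) (hN' : N' ∣ N) {α β : ι → V}
    (hαβ : ∀ i, Admissible B b b' N' (α i) (β i)) (a : ι → ℂ) (p : Fin n → ℕ)
    {k : ι × (Fin N' → Fin n → ℤ) → ℕ} (hk : powExp B b N' α = fun x => (k x : ℝ))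
    (hv : ∀ j ≤ coeffBound N N' p,
      ∑' x : k ⁻¹' {j}, powCoeff B b N' β a x * powPoly B b N' α p x = 0)
    {τ : ℂ} (hτ : 0 < τ.im) :
    expSeries (fun x => powCoeff B b N' β a x * powPoly B b N' α p x) (powExp B b N' α) 0 τ
      = 0 := by
  have hm := expTame_powExp (b := b) (N' := N') h.symm h.pos α
  have hc := (polyBd_powCoeff (B := B) (b := b) (powExp B b N' α) β a).mul
    (polyBd_powPoly h.symm h.pos hn hN'0 α p)
  obtain ⟨C, A, hC, hg⟩ := norm_expSeries_le hm hc
  have hdec : ∃ C' : ℝ, 0 ≤ C' ∧ ∀ τ : ℂ, 1 / 2 ≤ τ.im →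
      ‖expSeries (fun x => powCoeff B b N' β a x * powPoly B b N' α p x) (powExp B b N' α) 0 τ‖ ≤
        C' * Real.exp (-(2 * Real.pi * (coeffBound N N' p + 1) * τ.im)) := by
    rw [hk] at hm ⊢
    refine norm_expSeries_le_of_fiber hm (by rwa [hk] at hc) hv
  obtain ⟨C', -, hC'⟩ := hdec
  refine sturm_bound hN0 (differentiableOn_expSeries hm hc (LittleBd.zero hm.1))
    (fun η hη τ hτ => h.norm_powPoly_series_moeb hn hN'0 hN' hαβ a p hη hτ) hC hg hC' ?_ hτ
  -- the weight of the form is half of `N' n + 2 s(p)`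
  refine lt_of_eq_of_lt ?_ (Nat.lt_floor_add_one _)
  congr 2
  push_cast
  ring

lemma finite_fiber [Fintype ι] (hsymm : B.IsSymm) (hpos : ∀ x : V, x ≠ 0 → 0 < B x x) {α : ι → V}
    {k : ι × (Fin N' → Fin n → ℤ) → ℕ} (hk : powExp B b N' α = fun x => (k x : ℝ)) (j : ℕ) :
    (k ⁻¹' {j}).Finite := by
  refine ((expTame_powExp (b := b) (N' := N') hsymm hpos α).finite_le j).subset fun x hx => ?_
  rw [hk]
  exact le_of_eq (congrArg (Nat.cast : ℕ → ℝ) (show k x = j from hx))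

/-- Passing from the polynomials `powPoly` to monomials, along a set of exponents that is closed
under lowering by an even amount. -/
lemma fiber_monomial_eq_zero [Fintype ι] (hsymm : B.IsSymm) (hpos : ∀ x : V, x ≠ 0 → 0 < B x x)
    (hn : 1 ≤ n) (hN'0 : N' ≠ 0) {α : ι → V} {c : ι × (Fin N' → Fin n → ℤ) → ℂ}
    {k : ι × (Fin N' → Fin n → ℤ) → ℕ} (hk : powExp B b N' α = fun x => (k x : ℝ))
    {S : Set (Fin n → ℕ)} (hS : ∀ p ∈ S, ∀ q, q ≤ p → s q ≡ s p [MOD 2] → q ∈ S) (j : ℕ)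
    (hv : ∀ p ∈ S, ∑' x : k ⁻¹' {j}, c x * powPoly B b N' α p x = 0) :
    ∀ p ∈ S, ∑' x : k ⁻¹' {j}, c x * ∏ i, (B (powVec b N' α x) (b i) : ℂ) ^ p i = 0 := by
  have hfin := finite_fiber hsymm hpos hk j
  have : Fintype (k ⁻¹' {j}) := hfin.fintype
  simp only [tsum_fintype] at hv ⊢
  suffices ∀ σ p, s p = σ → p ∈ S →
      ∑ x : k ⁻¹' {j}, c x * ∏ i, (B (powVec b N' α x) (b i) : ℂ) ^ p i = 0 from
    fun p hp => this _ p rfl hp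
  intro σ
  induction σ using Nat.strong_induction_on with
  | _ σ ih =>
  intro p hpσ hp
  obtain ⟨K, hK0, hK⟩ := powPoly_eq (B := B) (b := b) hn hN'0 α p
  have h1 := hv p hp
  simp_rw [hK, Finset.mul_sum] at h1
  rw [Finset.sum_comm, Finset.sum_eq_single 0] at h1
  · have h2 : ∀ x : k ⁻¹' {j}, c x * (K 0 * (powExp B b N' α x : ℂ) ^
        (∑ i, ∑ j, (0 : Fin n → Fin n → ℕ) i j) * ∏ i, (B (powVec b N' α x) (b i) : ℂ) ^
          (p i - crossSum 0 i)) =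
        K 0 * (c x * ∏ i, (B (powVec b N' α x) (b i) : ℂ) ^ p i) := by
      intro x
      simp [crossSum]
      ring
    simp_rw [h2] at h1
    rw [← Finset.mul_sum] at h1
    exact (mul_eq_zero.1 h1).resolve_left hK0
  -- the exponents in the other terms are smaller than `p` by an even amount, and the power of `m`
  -- is constant on the fibre
  · intro Λ hΛ hΛ0
    rw [Finset.mem_filter] at hΛ
    have h2 : ∀ x : k ⁻¹' {j}, c x * (K Λ * (powExp B b N' α x : ℂ) ^ (∑ i, ∑ j, Λ i j) *
          ∏ i, (B (powVec b N' α x) (b i) : ℂ) ^ (p i - crossSum Λ i)) =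
        (K Λ * (j : ℂ) ^ (∑ i, ∑ j, Λ i j)) *
          (c x * ∏ i, (B (powVec b N' α x) (b i) : ℂ) ^ (p i - crossSum Λ i)) := by
      intro x
      have : k x = j := x.2
      rw [hk]
      simp only [this, Complex.ofReal_natCast]
      ring
    simp_rw [h2]
    rw [← Finset.mul_sum]
    have hs : s (fun i => p i - crossSum Λ i) + 2 * ∑ i, ∑ j, Λ i j = s p := by
      rw [s, ← sum_crossSum, ← Finset.sum_add_distrib]
      exact Finset.sum_congr rfl fun i _ => Nat.sub_add_cancel (hΛ.2 i)
    have hpos' : 0 < ∑ i, ∑ j, Λ i j := by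
      rw [Nat.pos_iff_ne_zero]
      intro h0
      apply hΛ0
      funext i i'
      rw [Finset.sum_eq_zero_iff] at h0
      exact Finset.sum_eq_zero_iff.1 (h0 i (Finset.mem_univ _)) i' (Finset.mem_univ _)
    rw [ih _ (by omega) (fun i => p i - crossSum Λ i) rfl
      (hS p hp _ (fun i => Nat.sub_le _ _) (by unfold Nat.ModEq; omega)), mul_zero]
  · intro h0
    refine absurd (Finset.mem_filter.2 ⟨?_, fun i => ?_⟩) h0
    · simp [boundedMatrices]
    · simp [crossSum]

/-- If the linear combination of powers vanishes, so do all coefficients of the modular forms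
attached to it. -/
lemma fiber_powPoly_eq_zero [Fintype ι] (hsymm : B.IsSymm) (hpos : ∀ x : V, x ≠ 0 → 0 < B x x)
    (hN'0 : N' ≠ 0) {α β : ι → V} {a : ι → ℂ}
    {k : ι × (Fin N' → Fin n → ℤ) → ℕ} (hk : powExp B b N' α = fun x => (k x : ℝ))
    (hf : ∀ τ : ℂ, 0 < τ.im → ∀ z : ℂ ⊗[ℝ] V,
      expSeries (powCoeff B b N' β a) (powExp B b N' α) (powLin B b N' α z) τ = 0)
    (p : Fin n → ℕ) (j : ℕ) :
    ∑' x : k ⁻¹' {j}, powCoeff B b N' β a x * powPoly B b N' α p x = 0 := by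
  have hfin := finite_fiber hsymm hpos hk j
  have : Fintype (k ⁻¹' {j}) := hfin.fintype
  have hm := expTame_powExp (b := b) (N' := N') hsymm hpos α
  have hc := polyBd_powCoeff (B := B) (b := b) (powExp B b N' α) β a
  -- the coefficients of the Taylor expansion in the direction `z` vanish, hence so do the sums of
  -- `(B(·, z))ⁱ` over the fibres; the values `powPoly` are combinations of these by
  -- `sum_powPoly`
  have key : ∀ (z : ℂ ⊗[ℝ] V) (i : ℕ),
      ∑ x : k ⁻¹' {j}, powCoeff B b N' β a x * powLin B b N' α z x ^ i = 0 := by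
    intro z i
    have hr := littleBd_powLin (N' := N') (b := b) hsymm hpos α z
    have h1 : ∀ τ : ℂ, 0 < τ.im → expSeries (fun x => powCoeff B b N' β a x *
        ((2 * Real.pi * Complex.I * powLin B b N' α z x) ^ i / i.factorial))
          (powExp B b N' α) 0 τ = 0 := by
      intro τ hτ
      refine coeff_eq_zero_of_hasSum_zero (a := fun i => expSeries (fun x => powCoeff B b N' β a x *
        ((2 * Real.pi * Complex.I * powLin B b N' α z x) ^ i / i.factorial))
          (powExp B b N' α) 0 τ) one_pos (fun t _ _ => ?_) i
      have h2 := (hasSum_taylor hm hc hr hτ t).2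
      rwa [← powLin_smul, hf τ hτ] at h2
    have hcb : PolyBd (powExp B b N' α) fun x => powCoeff B b N' β a x *
        ((2 * Real.pi * Complex.I * powLin B b N' α z x) ^ i / i.factorial) := by
      simp_rw [div_eq_mul_inv]
      exact hc.mul ((((PolyBd.const _).mul (hr.polyBd hm.1)).pow i).mul (PolyBd.const _))
    rw [hk] at hm hcb h1
    have h3 := fiber_tsum_eq_zero hm hcb h1 j
    rw [tsum_fintype] at h3
    have h4 : ∀ x : k ⁻¹' {j}, powCoeff B b N' β a x *
        ((2 * Real.pi * Complex.I * powLin B b N' α z x) ^ i / i.factorial) =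
        ((2 * Real.pi * Complex.I) ^ i / i.factorial) *
          (powCoeff B b N' β a x * powLin B b N' α z x ^ i) := fun x => by
      rw [mul_pow]; ring
    simp_rw [h4] at h3
    rw [← Finset.mul_sum] at h3
    refine (mul_eq_zero.1 h3).resolve_left (div_ne_zero (pow_ne_zero _ Complex.two_pi_I_ne_zero) ?_)
    exact_mod_cast i.factorial_ne_zero
  rw [tsum_fintype]
  refine eq_zero_of_sum_piAntidiag (A := fun p => ∑ x : k ⁻¹' {j},
    powCoeff B b N' β a x * powPoly B b N' α p x) (σ := s p) (fun Z => ?_) rfl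
  simp_rw [Finset.mul_sum]
  rw [Finset.sum_comm]
  have h5 : ∀ x : k ⁻¹' {j}, ∑ q ∈ Finset.piAntidiag Finset.univ (s p), (∏ i, Z i ^ q i) *
      (powCoeff B b N' β a x * powPoly B b N' α q x) =
      ∑ μ ∈ Finset.range (s p / 2 + 1), (2 ^ s p * ((-1) ^ μ *
        (gammaQuotient ((N' : ℝ) * n / 2) (s p) μ : ℂ) *
        ((N' * QC B (coordPt b Z) * j) ^ μ / μ.factorial) * ((s p - 2 * μ).factorial : ℂ)⁻¹)) *
        (powCoeff B b N' β a x * powLin B b N' α (coordPt b Z) x ^ (s p - 2 * μ)) := by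
    intro x
    have hx : k x = j := x.2
    simp_rw [mul_left_comm _ (powCoeff B b N' β a x)]
    rw [← Finset.mul_sum, sum_powPoly hN'0, taylorPoly, Finset.mul_sum, Finset.mul_sum]
    refine Finset.sum_congr rfl fun μ _ => ?_
    rw [hk]
    simp only [hx, Complex.ofReal_natCast]
    ring
  simp_rw [h5]
  rw [Finset.sum_comm]
  refine Finset.sum_eq_zero fun μ _ => ?_
  rw [← Finset.mul_sum, key, mul_zero]

end Forms

/-! ### The decomposition along the discriminant group -/

section Decomposition

variable {V : Type*} [AddCommGroup V] [Module ℝ V] {n N' : ℕ} {ι T : Type*}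

/-- The theta series of the coset of `ρ` with the weight `F`. -/
def cosetSeries (B : LinearMap.BilinForm ℝ V) (b : Module.Basis (Fin n) ℝ V) (ρ : V) (F : V → ℂ)
    (τ : ℂ) (z : ℂ ⊗[ℝ] V) : ℂ :=
  expSeries (fun k : Fin n → ℤ => F (ρ + lam b k)) (fun k => Q B (ρ + lam b k))
    (fun k => B.baseChange ℂ ((1 : ℂ) ⊗ₜ[ℝ] (ρ + lam b k)) z) τ

/-- The vectors `ρ t` represent the classes, modulo the lattice with the basis `b`, of the vectors
`y` for which `N' y` is in the lattice with the basis `b'`. -/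
def IsCosetReps (b b' : Module.Basis (Fin n) ℝ V) (N' : ℕ) (ρ : T → V) : Prop :=
  ∀ y, (∃ m, (N' : ℝ) • y = lam b' m) →
    ∃! x : T × (Fin n → ℤ), y = ρ x.1 + lam b x.2

variable {B : LinearMap.BilinForm ℝ V} {b b' : Module.Basis (Fin n) ℝ V} {N : ℕ}

lemma Q_smul_form (a : ℝ) (v : V) : Q (a • B) v = a * Q B v := by
  simp only [Q, LinearMap.smul_apply, smul_eq_mul, mul_div_assoc]

lemma baseChange_smul_form (a : ℝ) (v : V) (z : ℂ ⊗[ℝ] V) :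
    (a • B).baseChange ℂ ((1 : ℂ) ⊗ₜ[ℝ] v) z = a * B.baseChange ℂ ((1 : ℂ) ⊗ₜ[ℝ] v) z := by
  induction z with
  | zero => simp
  | tmul c w => simp only [baseChange_one_tmul, LinearMap.smul_apply, smul_eq_mul]; push_cast; ring
  | add x y hx hy => rw [map_add, map_add, hx, hy, mul_add]

/-- The sum of the `Q (u j)` is minimal, for a given sum of the `u j`, at equal `u j`. -/
lemma sum_Q_eq (hsymm : B.IsSymm) (hN'0 : N' ≠ 0) (u : Fin N' → V) :
    ∑ j, Q B (u j) = N' * Q B ((N' : ℝ)⁻¹ • ∑ j, u j) +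
      ∑ j, Q B (u j - (N' : ℝ)⁻¹ • ∑ j, u j) := by
  have h0 : (N' : ℝ) ≠ 0 := by exact_mod_cast hN'0
  set y := (N' : ℝ)⁻¹ • ∑ j, u j with hy
  have h1 : ∀ j, Q B (u j) = Q B y + Q B (u j - y) + B y (u j - y) := fun j => by
    rw [← Q_add hsymm, add_sub_cancel]
  have h2 : ∑ j, (u j - y) = 0 := by
    rw [Finset.sum_sub_distrib, Finset.sum_const, Finset.card_univ, Fintype.card_fin,
      ← Nat.cast_smul_eq_nsmul ℝ, hy, smul_smul, mul_inv_cancel₀ h0, one_smul, sub_self]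
  simp_rw [h1]
  rw [Finset.sum_add_distrib, Finset.sum_add_distrib, ← map_sum, h2, map_zero, add_zero]
  simp

lemma EvenLattice.powVec_mem_dual (h : EvenLattice B b b' N) {α β : ι → V}
    (hαβ : ∀ i, Admissible B b b' N' (α i) (β i)) (x : ι × (Fin N' → Fin n → ℤ)) :
    ∃ m, powVec b N' α x = lam b' m := by
  refine h.exists_lam' _ fun i => ?_
  rw [← lam_single b i, powVec, map_sum, LinearMap.sum_apply]
  refine sum_mem fun j _ => ?_
  obtain ⟨m, hm⟩ := (hαβ x.1).left
  rw [map_add, LinearMap.add_apply, hm]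
  exact add_mem (h.B_dual_lam _ _) (h.B_lam_lam _ _)

/-- The lattice acts freely on the index set of the expansion, by translating all `vⱼ`
simultaneously; grouping the terms by orbits expresses the series through the theta series of the
cosets. -/
lemma EvenLattice.exists_decomposition [Fintype ι] [Fintype T] (h : EvenLattice B b b' N)
    (hN'0 : N' ≠ 0) {α β : ι → V} (hαβ : ∀ i, Admissible B b b' N' (α i) (β i)) (a : ι → ℂ)
    {ρ : T → V} (hρ : IsCosetReps b b' N' ρ) :
    ∃ g : T → ℂ → ℂ, (∀ t, DifferentiableOn ℂ (g t) {τ | 0 < τ.im}) ∧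
      ∀ F : V → ℂ, PolyBd (powExp B b N' α) (fun x => F ((N' : ℝ)⁻¹ • powVec b N' α x)) →
        ∀ τ : ℂ, 0 < τ.im → ∀ z : ℂ ⊗[ℝ] V,
          expSeries (fun x => powCoeff B b N' β a x * F ((N' : ℝ)⁻¹ • powVec b N' α x))
            (powExp B b N' α) (powLin B b N' α z) τ =
          ∑ t, g t τ * cosetSeries ((N' : ℝ) • B) b (ρ t) F τ z := by
  classical
  have h0 : (N' : ℝ) ≠ 0 := by exact_mod_cast hN'0
  set y : ι × (Fin N' → Fin n → ℤ) → V := fun x => (N' : ℝ)⁻¹ • powVec b N' α x with hy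
  have hy' : ∀ x, ∃ m, (N' : ℝ) • y x = lam b' m := fun x => by
    rw [hy]
    simp only [smul_smul, mul_inv_cancel₀ h0, one_smul]
    exact h.powVec_mem_dual hαβ x
  -- `y x` is the mean of the vectors `αᵢ + vⱼ`, and `π x` consists of its class and its lattice
  -- coordinates relative to the representative
  choose π hπ huniq using fun x => hρ (y x) (hy' x)
  let shift (x : ι × (Fin N' → Fin n → ℤ)) (l : Fin n → ℤ) : ι × (Fin N' → Fin n → ℤ) :=
    (x.1, fun j => x.2 j + l)
  have hshift_shift (x l l') : shift (shift x l) l' = shift x (l + l') := by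
    simp only [shift, add_assoc]
  have hshift_zero (x) : shift x 0 = x := by simp only [shift, add_zero, Prod.mk.eta]
  have hyshift (x l) : y (shift x l) = y x + lam b l := by
    have : powVec b N' α (shift x l) = powVec b N' α x + (N' : ℝ) • lam b l := by
      simp only [powVec, shift, lam_add, ← add_assoc]
      rw [Finset.sum_add_distrib, Finset.sum_const, Finset.card_univ, Fintype.card_fin,
        Nat.cast_smul_eq_nsmul]
    simp only [hy, this, smul_add, smul_smul, inv_mul_cancel₀ h0, one_smul]
  have hπshift (x l) : π (shift x l) = ((π x).1, (π x).2 + l) := by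
    refine (huniq _ _ ?_).symm
    simp only [hyshift, lam_add, ← add_assoc]
    rw [hπ x]
  have hcshift (x l) : powCoeff B b N' β a (shift x l) = powCoeff B b N' β a x := by
    simp only [powCoeff, shift]
    congr 1
    apply e_eq_of_sub_mem
    rw [← map_sub, ← Finset.sum_sub_distrib]
    simp only [lam_add, add_sub_cancel_left]
    rw [Finset.sum_const, Finset.card_univ, Fintype.card_fin, ← Nat.cast_smul_eq_nsmul ℝ, map_smul]
    obtain ⟨m, w, hw⟩ := (hαβ x.1).right
    have : (N' : ℝ) • B (β x.1) (lam b l) =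
        ((N' : ℤ) : ℝ) * B (lam b' m) (lam b l) + B (lam b w) (lam b l) := by
      rw [hw]
      simp only [map_add, LinearMap.add_apply, map_smul, LinearMap.smul_apply, smul_eq_mul]
      push_cast
      field_simp
    rw [this]
    exact add_mem (mul_mem (int_mem_IntR _) (h.B_dual_lam _ _)) (h.B_lam_lam _ _)
  -- the part of the exponent that is invariant under the translations
  obtain ⟨μ, hμ⟩ : ∃ μ : ι × (Fin N' → Fin n → ℤ) → ℝ,
      ∀ x, μ x = ∑ j, Q B (α x.1 + lam b (x.2 j) - y x) := ⟨_, fun _ => rfl⟩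
  have hμ0 (x) : 0 ≤ μ x := hμ x ▸ Finset.sum_nonneg fun _ _ => Q_nonneg h.pos _
  have hexp (x) : powExp B b N' α x = N' * Q B (y x) + μ x := by
    rw [hμ]; exact sum_Q_eq h.symm hN'0 _
  have hμshift (x l) : μ (shift x l) = μ x := by
    rw [hμ, hμ]
    refine Finset.sum_congr rfl fun j _ => ?_
    rw [hyshift]
    simp only [shift, lam_add]
    congr 1
    abel
  -- `X₀` is a set of representatives of the orbits
  let X₀ := {x : ι × (Fin N' → Fin n → ℤ) // (π x).2 = 0}
  let E : X₀ × (Fin n → ℤ) ≃ ι × (Fin N' → Fin n → ℤ) :=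
    { toFun := fun x => shift x.1 x.2
      invFun := fun x => (⟨shift x (-(π x).2), by rw [hπshift]; simp⟩, (π x).2)
      left_inv := fun x => by
        have h1 : π (shift x.1 x.2) = ((π x.1).1, x.2) := by rw [hπshift, x.1.2, zero_add]
        refine Prod.ext (Subtype.ext ?_) ?_
        · simp only [h1, hshift_shift, add_neg_cancel, hshift_zero]
        · simp only [h1]
      right_inv := fun x => by simp only [hshift_shift, neg_add_cancel, hshift_zero] }
  have hy0 (x : X₀) (l) : y (shift x l) = ρ (π x).1 + lam b l := by
    rw [hπ, hπshift, x.2, zero_add]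
  have hm0 : ExpTame fun x : X₀ => μ x := by
    refine ((expTame_powExp (b := b) (N' := N') h.symm h.pos α).comp_injective
      (φ := fun x : X₀ => x.1) Subtype.val_injective).mono (fun x => hμ0 x) one_pos le_rfl
      (b := ∑ t, N' * Q B (ρ t)) fun x => ?_
    have h1 := hy0 x 0
    rw [hshift_zero] at h1
    have h2 : lam b (0 : Fin n → ℤ) = 0 := by
      have := lam_smul b (0 : ℤ) 0
      simpa using this
    rw [h2, add_zero] at h1
    rw [Function.comp_apply, hexp, h1, one_mul, add_comm]
    gcongr
    exact Finset.single_le_sum (f := fun t => N' * Q B (ρ t))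
      (fun t _ => mul_nonneg (Nat.cast_nonneg _) (Q_nonneg h.pos _)) (Finset.mem_univ (π x).1)
  -- the coefficients of the `t`-th component, which is a series over the orbits in the class `t`
  obtain ⟨G, hG⟩ : ∃ G : T → X₀ → ℂ, ∀ t x, G t x =
    if (π x).1 = t then powCoeff B b N' β a x else 0 := ⟨_, fun _ _ => rfl⟩
  have hGb (t) : PolyBd (fun x : X₀ => μ x) (G t) := by
    obtain ⟨C, k, hC⟩ := polyBd_powCoeff (B := B) (b := b) μ β a
    refine ⟨C, k, fun x => ?_⟩
    rw [hG]
    split_ifs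
    · exact hC x
    · rw [norm_zero]; exact (norm_nonneg _).trans (hC x)
  refine ⟨fun t => expSeries (G t) (fun x => μ x) 0, fun t =>
    differentiableOn_expSeries hm0 (hGb t) (LittleBd.zero hm0.1), fun F hF τ hτ z => ?_⟩
  have hs := (summable_expSeries (expTame_powExp (b := b) (N' := N') h.symm h.pos α)
    ((polyBd_powCoeff (B := B) (b := b) _ β a).mul hF)
    (littleBd_powLin h.symm h.pos α z) hτ).of_norm
  have hs' := (E.summable_iff).2 hs
  rw [expSeries, ← E.tsum_eq]
  refine (Summable.tsum_prod hs').trans ?_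
  have hterm (x : X₀) (l : Fin n → ℤ) :
      powCoeff B b N' β a (E (x, l)) * F (y (E (x, l))) *
        e (τ * (powExp B b N' α (E (x, l)) : ℂ) + powLin B b N' α z (E (x, l))) =
      powCoeff B b N' β a x * e (τ * μ x) * (F (ρ (π x).1 + lam b l) *
        e (τ * (Q ((N' : ℝ) • B) (ρ (π x).1 + lam b l) : ℂ) +
          ((N' : ℝ) • B).baseChange ℂ ((1 : ℂ) ⊗ₜ[ℝ] (ρ (π x).1 + lam b l)) z)) := by
    have hE : E (x, l) = shift x l := rfl
    have hlin : powLin B b N' α z (shift x l) =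
        N' * B.baseChange ℂ ((1 : ℂ) ⊗ₜ[ℝ] (y (shift x l))) z := by
      have h3 : powVec b N' α (shift x l) = (N' : ℝ) • y (shift x l) := by
        simp only [hy, smul_smul, mul_inv_cancel₀ h0, one_smul]
      rw [powLin, h3, TensorProduct.tmul_smul, ← algebraMap_smul ℂ (N' : ℝ), map_smul,
        LinearMap.smul_apply, smul_eq_mul]
      simp
    rw [hE, hcshift, hexp, hμshift, hlin, hy0, Q_smul_form, baseChange_smul_form]
    rw [mul_assoc (powCoeff B b N' β a x), mul_assoc (powCoeff B b N' β a x),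
      mul_left_comm (e (τ * μ x)), ← e_add]
    congr 3
    push_cast
    ring
  refine (tsum_congr fun x => tsum_congr fun l => hterm x l).trans ?_
  simp_rw [tsum_mul_left]
  have hsplit (x : X₀) : powCoeff B b N' β a x * e (τ * μ x) *
      ∑' l : Fin n → ℤ, F (ρ (π x).1 + lam b l) *
        e (τ * (Q ((N' : ℝ) • B) (ρ (π x).1 + lam b l) : ℂ) +
          ((N' : ℝ) • B).baseChange ℂ ((1 : ℂ) ⊗ₜ[ℝ] (ρ (π x).1 + lam b l)) z) =
      ∑ t, G t x * e (τ * μ x + (0 : X₀ → ℂ) x) * cosetSeries ((N' : ℝ) • B) b (ρ t) F τ z := by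
    rw [Finset.sum_eq_single (π x).1]
    · rw [hG, if_pos rfl, Pi.zero_apply, add_zero]; rfl
    · intro t _ ht
      rw [hG, if_neg ht.symm, zero_mul, zero_mul]
    · intro h1; exact absurd (Finset.mem_univ _) h1
  simp_rw [hsplit]
  have hs3 (t) := (hasSum_expSeries hm0 (hGb t) (LittleBd.zero hm0.1) hτ).mul_right
    (cosetSeries ((N' : ℝ) • B) b (ρ t) F τ z)
  exact (hasSum_sum fun t _ => hs3 t).tsum_eq

end Decomposition

/-! ### The determinant of derivatives of theta series -/

section Determinant

variable {V : Type*} [AddCommGroup V] [Module ℝ V] {n : ℕ} {B : LinearMap.BilinForm ℝ V}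
  {b : Module.Basis (Fin n) ℝ V}

lemma polyBd_pairing (hsymm : B.IsSymm) (hpos : ∀ x : V, x ≠ 0 → 0 < B x x) (ρ v : V) :
    PolyBd (fun k : Fin n → ℤ => Q B (ρ + lam b k)) fun k => (B (ρ + lam b k) v : ℂ) := by
  have h := (littleBd_coset hsymm hpos (fun k : Fin n → ℤ => ρ + lam b k)
    ((1 : ℂ) ⊗ₜ[ℝ] v)).polyBd fun k => Q_nonneg hpos _
  simpa only [baseChange_one_tmul, one_mul] using h

lemma polyBd_prod_pairing (hsymm : B.IsSymm) (hpos : ∀ x : V, x ≠ 0 → 0 < B x x) (ρ : V)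
    (p : Fin n → ℕ) :
    PolyBd (fun k : Fin n → ℤ => Q B (ρ + lam b k))
      fun k => ∏ i, (B (ρ + lam b k) (b i) : ℂ) ^ p i :=
  PolyBd.prod _ fun i _ => (polyBd_pairing hsymm hpos ρ (b i)).pow _

/-- Termwise differentiation of the theta series of a coset. -/
lemma lineDeriv_cosetSeries (hsymm : B.IsSymm) (hpos : ∀ x : V, x ≠ 0 → 0 < B x x) {ρ : V}
    {F : V → ℂ} (hF : PolyBd (fun k : Fin n → ℤ => Q B (ρ + lam b k)) fun k => F (ρ + lam b k))
    {τ : ℂ} (hτ : 0 < τ.im) (v : V) (z : ℂ ⊗[ℝ] V) :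
    lineDeriv ℂ (cosetSeries B b ρ F τ) z ((1 : ℂ) ⊗ₜ[ℝ] v) =
      cosetSeries B b ρ (fun w => F w * (2 * Real.pi * Complex.I * B w v)) τ z := by
  have h := hasDerivAt_expSeries_dir (expTame_coset hsymm hpos b ρ) hF
    (littleBd_coset hsymm hpos (fun k : Fin n → ℤ => ρ + lam b k) z)
    (ℓ := fun k => (B (ρ + lam b k) v : ℂ)) (D := 1 + |B v v|) (fun k => by
      have h1 := abs_le_eps_Q hsymm hpos v one_pos (ρ + lam b k)
      have h2 := Q_nonneg hpos (ρ + lam b k)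
      rw [Complex.norm_real, Real.norm_eq_abs]
      have h3 := le_abs_self (B v v)
      have h4 := abs_nonneg (B v v)
      change _ ≤ (1 + |B v v|) * (1 + Q B (ρ + lam b k))
      nlinarith) hτ
  refine Eq.trans ?_ h.deriv
  rw [lineDeriv]
  congr 1
  funext t
  rw [cosetSeries]
  congr 1
  funext k
  rw [map_add, map_smul, smul_eq_mul, baseChange_one_tmul, one_mul]

lemma iterate_lineDeriv_cosetSeries (hsymm : B.IsSymm) (hpos : ∀ x : V, x ≠ 0 → 0 < B x x) {ρ : V}
    {τ : ℂ} (hτ : 0 < τ.im) (v : V) (q : ℕ) :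
    ∀ {F : V → ℂ} (_ : PolyBd (fun k : Fin n → ℤ => Q B (ρ + lam b k)) fun k => F (ρ + lam b k)),
    (fun (h : ℂ ⊗[ℝ] V → ℂ) z => lineDeriv ℂ h z ((1 : ℂ) ⊗ₜ[ℝ] v))^[q] (cosetSeries B b ρ F τ) =
      cosetSeries B b ρ (fun w => F w * (2 * Real.pi * Complex.I * B w v) ^ q) τ := by
  induction q with
  | zero => intro F _; simp
  | succ q ih =>
    intro F hF
    rw [Function.iterate_succ_apply]
    have h1 : (fun z => lineDeriv ℂ (cosetSeries B b ρ F τ) z ((1 : ℂ) ⊗ₜ[ℝ] v)) =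
        cosetSeries B b ρ (fun w => F w * (2 * Real.pi * Complex.I * B w v)) τ :=
      funext fun z => lineDeriv_cosetSeries hsymm hpos hF hτ v z
    rw [h1, ih (hF.mul ((PolyBd.const _).mul (polyBd_pairing hsymm hpos ρ v)))]
    congr 1
    funext w
    ring

/-- Iterated partial derivatives of the theta series of a coset. -/
lemma iterPartial_cosetSeries (hsymm : B.IsSymm) (hpos : ∀ x : V, x ≠ 0 → 0 < B x x) {ρ : V}
    {τ : ℂ} (hτ : 0 < τ.im) (p : Fin n → ℕ) (z : ℂ ⊗[ℝ] V) :
    iterPartial b p (cosetSeries B b ρ 1 τ) z = (2 * Real.pi * Complex.I) ^ s p *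
      cosetSeries B b ρ (fun w => ∏ i, (B w (b i) : ℂ) ^ p i) τ z := by
  have key : ∀ l : List (Fin n), l.foldr
      (fun i g => (fun h z => lineDeriv ℂ h z ((1 : ℂ) ⊗ₜ[ℝ] b i))^[p i] g)
        (cosetSeries B b ρ 1 τ) = cosetSeries B b ρ
          (fun w => (l.map fun i => (2 * Real.pi * Complex.I * B w (b i)) ^ p i).prod) τ ∧
      PolyBd (fun k : Fin n → ℤ => Q B (ρ + lam b k)) (fun k =>
        (l.map fun i => (2 * Real.pi * Complex.I * (B (ρ + lam b k) (b i) : ℂ)) ^ p i).prod) := by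
    intro l
    induction l with
    | nil => exact ⟨rfl, by simpa using PolyBd.const 1⟩
    | cons i l ih =>
      obtain ⟨ih1, ih2⟩ := ih
      refine ⟨?_, ?_⟩
      · rw [List.foldr_cons, ih1, iterate_lineDeriv_cosetSeries hsymm hpos hτ (b i) (p i) ih2]
        congr 1
        funext w
        rw [List.map_cons, List.prod_cons, mul_comm]
      · simp_rw [List.map_cons, List.prod_cons]
        exact (((PolyBd.const _).mul (polyBd_pairing hsymm hpos ρ (b i))).pow _).mul ih2
  rw [iterPartial, (key _).1, cosetSeries, cosetSeries, ← expSeries_const_mul]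
  congr 1
  funext k
  rw [← List.ofFn_eq_map, List.prod_ofFn, s, ← Finset.prod_pow_eq_pow_sum,
    ← Finset.prod_mul_distrib]
  exact Finset.prod_congr rfl fun i _ => mul_pow _ _ _

lemma differentiableOn_cosetSeries (hsymm : B.IsSymm) (hpos : ∀ x : V, x ≠ 0 → 0 < B x x) {ρ : V}
    {F : V → ℂ} (hF : PolyBd (fun k : Fin n → ℤ => Q B (ρ + lam b k)) fun k => F (ρ + lam b k))
    (z : ℂ ⊗[ℝ] V) :
    DifferentiableOn ℂ (fun τ => cosetSeries B b ρ F τ z) {τ | 0 < τ.im} :=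
  differentiableOn_expSeries (expTame_coset hsymm hpos b ρ) hF (littleBd_coset hsymm hpos _ z)

variable {N' N : ℕ} {ι : Type*} {b' : Module.Basis (Fin n) ℝ V}

/-- If the determinant does not vanish identically, then the vanishing of the Taylor coefficients
for the given exponents implies the vanishing of the linear combination of powers: the components
from `exists_decomposition` solve a homogeneous linear system with this determinant. -/
theorem EvenLattice.powSeries_eq_zero [Fintype ι] (h : EvenLattice B b b' N) (hN'0 : N' ≠ 0)
    {α β : ι → V} (hαβ : ∀ i, Admissible B b b' N' (α i) (β i)) (a : ι → ℂ) {d : ℕ}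
    {ρ : Fin d → V} (hρ : IsCosetReps b b' N' ρ) (p : Fin d → Fin n → ℕ) {τ₀ : ℂ} (hτ₀ : 0 < τ₀.im)
    (hdet : (Matrix.of fun i j : Fin d => cosetSeries ((N' : ℝ) • B) b (ρ j)
      (fun w => ∏ l, (((N' : ℝ) • B) w (b l) : ℂ) ^ p i l) τ₀ 0).det ≠ 0)
    (hv : ∀ i, ∀ τ : ℂ, 0 < τ.im → expSeries (fun x => powCoeff B b N' β a x *
      ∏ l, (B (powVec b N' α x) (b l) : ℂ) ^ p i l) (powExp B b N' α) 0 τ = 0)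
    {τ : ℂ} (hτ : 0 < τ.im) (z : ℂ ⊗[ℝ] V) :
    expSeries (powCoeff B b N' β a) (powExp B b N' α) (powLin B b N' α z) τ = 0 := by
  have hN'pos : (0 : ℝ) < N' := by exact_mod_cast Nat.pos_of_ne_zero hN'0
  have hsymm' : ((N' : ℝ) • B).IsSymm := ⟨fun x y => by
    simp only [LinearMap.smul_apply, h.symm.eq x y]⟩
  have hpos' : ∀ x : V, x ≠ 0 → 0 < ((N' : ℝ) • B) x x := fun x hx => by
    simp only [LinearMap.smul_apply, smul_eq_mul]
    exact mul_pos hN'pos (h.pos x hx)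
  obtain ⟨g, hg, hdec⟩ := h.exists_decomposition hN'0 hαβ a hρ
  obtain ⟨M, hM⟩ : ∃ M : ℂ → Matrix (Fin d) (Fin d) ℂ, ∀ τ, M τ = Matrix.of fun i j : Fin d =>
    cosetSeries ((N' : ℝ) • B) b (ρ j)
      (fun w => ∏ l, (((N' : ℝ) • B) w (b l) : ℂ) ^ p i l) τ 0 := ⟨_, fun _ => rfl⟩
  have hpair : ∀ x l, ((N' : ℝ) • B) ((N' : ℝ)⁻¹ • powVec b N' α x) (b l) =
      B (powVec b N' α x) (b l) := fun x l => by
    simp only [LinearMap.smul_apply, map_smul, smul_eq_mul]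
    field_simp
  have hMg : ∀ τ, 0 < τ.im → (M τ).mulVec (fun t => g t τ) = 0 := by
    intro τ hτ
    funext i
    have h1 := hdec (fun w => ∏ l, (((N' : ℝ) • B) w (b l) : ℂ) ^ p i l) (by
      simp only [hpair]
      exact polyBd_monomial h.symm h.pos α (p i)) τ hτ 0
    simp only [hpair] at h1
    have h2 : powLin B b N' α 0 = 0 := funext fun x => by simp [powLin]
    rw [h2, hv i τ hτ] at h1
    rw [Pi.zero_apply, h1, hM]
    simp only [Matrix.mulVec, dotProduct, Matrix.of_apply]
    exact Finset.sum_congr rfl fun t _ =>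
      mul_comm (cosetSeries ((N' : ℝ) • B) b (ρ t) _ τ 0) (g t τ)
  -- multiply the linear system by the adjugate matrix
  have hdetg : ∀ t τ, 0 < τ.im → (M τ).det * g t τ = 0 := by
    intro t τ hτ
    have h1 := congrArg (fun v => (M τ).adjugate.mulVec v) (hMg τ hτ)
    simp only [Matrix.mulVec_mulVec, Matrix.adjugate_mul, Matrix.mulVec_zero,
      Matrix.smul_mulVec, Matrix.one_mulVec] at h1
    exact congrFun h1 t
  have hMan : AnalyticOnNhd ℂ (fun τ => (M τ).det) {τ | 0 < τ.im} := by
    refine DifferentiableOn.analyticOnNhd ?_ isOpen_upper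
    simp_rw [Matrix.det_apply, hM, Matrix.of_apply]
    refine DifferentiableOn.fun_sum fun σ _ => ?_
    refine DifferentiableOn.const_smul (DifferentiableOn.fun_finsetProd fun i _ => ?_) _
    exact differentiableOn_cosetSeries hsymm' hpos' (polyBd_prod_pairing hsymm' hpos' _ _) 0
  -- the ring of holomorphic functions on the upper half plane has no zero divisors
  have hg0 : ∀ t τ, 0 < τ.im → g t τ = 0 := by
    intro t
    rcases AnalyticOnNhd.eq_zero_or_eq_zero_of_mul_eq_zero hMan
      ((hg t).analyticOnNhd isOpen_upper) (fun τ hτ => hdetg t τ hτ) isPreconnected_upper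
      with h1 | h1
    · exact absurd (h1 τ₀ hτ₀) (by rw [hM]; exact hdet)
    · exact fun τ hτ => h1 τ hτ
  have h3 := hdec (fun _ => 1) (PolyBd.const 1) τ hτ z
  simp only [mul_one] at h3
  rw [h3]
  exact Finset.sum_eq_zero fun t _ => by rw [hg0 t τ hτ, zero_mul]

end Determinant

/-! ### Coordinates for the lattice and its discriminant group -/

section Coordinates

variable {V : Type*} [AddCommGroup V] [Module ℝ V] {n : ℕ} {B : LinearMap.BilinForm ℝ V}
  {b : Module.Basis (Fin n) ℝ V} {L : Submodule ℤ V}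

/-- The integral coordinates of the lattice with the basis `b`. -/
def latticeEquiv (hb : Submodule.span ℤ (Set.range b) = L) : (Fin n → ℤ) ≃ L :=
  Equiv.ofBijective (fun k => ⟨lam b k, hb ▸ (mem_span_iff_vec b _).2 ⟨k, rfl⟩⟩)
    ⟨fun k l hkl => lam_injective b (congrArg Subtype.val hkl), fun v => by
      obtain ⟨k, hk⟩ := (mem_span_iff_vec b _).1
        (show (v : V) ∈ Submodule.span ℤ (Set.range b) by rw [hb]; exact v.2)
      exact ⟨k, Subtype.ext hk.symm⟩⟩

lemma coe_latticeEquiv (hb : Submodule.span ℤ (Set.range b) = L) (k : Fin n → ℤ) :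
    (latticeEquiv hb k : V) = lam b k := rfl

lemma theta_eq_thetaChar (hb : Submodule.span ℤ (Set.range b) = L) (α β : V)
    (x : ℍ × (ℂ ⊗[ℝ] V)) : theta B L α β x = thetaChar B b α β x.1 x.2 := by
  rw [theta, ← (latticeEquiv hb).tsum_eq]
  rfl

lemma mem_dual_iff (hb : Submodule.span ℤ (Set.range b) = L) (v : V) :
    v ∈ B.dualSubmodule L ↔ ∀ i, B v (b i) ∈ IntR := by
  have h1 (x : ℝ) : x ∈ (1 : Submodule ℤ ℝ) ↔ x ∈ IntR := by
    rw [Submodule.mem_one, mem_IntR]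
    simp [eq_comm]
  rw [LinearMap.BilinForm.mem_dualSubmodule]
  refine ⟨fun h i => (h1 _).1 (h _ (hb ▸ Submodule.subset_span ⟨i, rfl⟩)), fun h w hw => ?_⟩
  obtain ⟨k, rfl⟩ := (mem_span_iff_vec b w).1 (hb.symm ▸ hw)
  rw [h1, vec_eq, map_sum]
  refine sum_mem fun i _ => ?_
  rw [map_smul, smul_eq_mul]
  exact mul_mem (int_mem_IntR _) (h i)

/-- The Jacobi theta series of a class, summed over integral coordinates relative to a
representative. -/
lemma jacobiThetaLattice_eq (hb : Submodule.span ℤ (Set.range b) = L) (hL : L ≤ B.dualSubmodule L)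
    (v : B.dualSubmodule L) (τ : ℍ) (z : ℂ ⊗[ℝ] V) :
    jacobiThetaLattice B L (Submodule.Quotient.mk v) τ z = cosetSeries B b v 1 τ z := by
  have hmk (w : B.dualSubmodule L) : (Submodule.Quotient.mk w : DiscGroup B L) =
      Submodule.Quotient.mk v ↔ (w : V) - v ∈ L := by
    rw [Submodule.Quotient.eq]
    rfl
  let E : (Fin n → ℤ) ≃ {w : B.dualSubmodule L // (Submodule.Quotient.mk w : DiscGroup B L) =
      Submodule.Quotient.mk v} := Equiv.ofBijective
    (fun k => ⟨v + ⟨latticeEquiv hb k, hL (latticeEquiv hb k).2⟩, (hmk _).2 (by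
      rw [Submodule.coe_add, add_sub_cancel_left]; exact (latticeEquiv hb k).2)⟩)
    ⟨fun k l hkl => by
      have h1 := congrArg (fun w => ((w.1 : B.dualSubmodule L) : V)) hkl
      simp only [Submodule.coe_add, add_right_inj] at h1
      exact lam_injective b h1, fun w => by
      obtain ⟨k, hk⟩ := (latticeEquiv hb).surjective ⟨_, (hmk w.1).1 w.2⟩
      refine ⟨k, Subtype.ext (Subtype.ext ?_)⟩
      simp only [hk, Submodule.coe_add, add_sub_cancel]⟩
  rw [jacobiThetaLattice, ← E.tsum_eq, cosetSeries, expSeries]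
  refine tsum_congr fun k => ?_
  rw [Pi.one_apply, one_mul]
  rfl

variable {b' : Module.Basis (Fin n) ℝ V} {N N' : ℕ}

/-- Representatives of the discriminant group of the rescaled lattice. -/
lemma EvenLattice.isCosetReps (h : EvenLattice B b b' N)
    (hb : Submodule.span ℤ (Set.range b) = L) {T : Type*}
    (t : T ≃ DiscGroup ((N' : ℝ) • B) L) (v : T → ((N' : ℝ) • B).dualSubmodule L)
    (hv : ∀ i, Submodule.Quotient.mk (v i) = t i) :
    IsCosetReps b b' N' fun i => (v i : V) := by
  intro y ⟨m, hm⟩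
  have hy : y ∈ ((N' : ℝ) • B).dualSubmodule L := by
    rw [mem_dual_iff hb]
    intro i
    have : ((N' : ℝ) • B) y (b i) = B (lam b' m) (lam b (Pi.single i 1)) := by
      rw [← hm, lam_single]; simp
    rw [this]
    exact h.B_dual_lam _ _
  have hmk (i : T) : t i = Submodule.Quotient.mk ⟨y, hy⟩ ↔ y - v i ∈ L := by
    rw [← hv, eq_comm, Submodule.Quotient.eq]
    rfl
  obtain ⟨i, hi⟩ := t.surjective (Submodule.Quotient.mk ⟨y, hy⟩)
  obtain ⟨k, hk⟩ := (latticeEquiv hb).surjective ⟨_, (hmk i).1 hi⟩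
  have hk' : lam b k = y - v i := congrArg Subtype.val hk
  refine ⟨(i, k), by simp [hk'], ?_⟩
  rintro ⟨i', k'⟩ hik
  have h1 : y - v i' = lam b k' := by rw [hik]; simp
  have h2 : i' = i := t.injective (by
    rw [hi, hmk, h1]
    exact (latticeEquiv hb k').2)
  subst h2
  rw [h1] at hk'
  rw [lam_injective b hk']

/-- The sequences `Θ` are the coefficients of the modular forms attached to the exponents. -/
lemma sum_thetaCoeff {ι : Type*} [Fintype ι] (hsymm : B.IsSymm)
    (hpos : ∀ x : V, x ≠ 0 → 0 < B x x)
    (hb : Submodule.span ℤ (Set.range b) = L) (α β : ι → V) (a : ι → ℂ)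
    {k : ι × (Fin N' → Fin n → ℤ) → ℕ} (hk : powExp B b N' α = fun x => (k x : ℝ))
    (x : (Fin n → ℕ) × ℕ) :
    ∑ i, a i * thetaCoeff B L b N' (α i) (β i) x =
      ∑' y : k ⁻¹' {x.2}, powCoeff B b N' β a y * powPoly B b N' α x.1 y := by
  classical
  -- all sums are finite, so that the sum over the fibre can be taken separately for each `i`
  have hfin := finite_fiber hsymm hpos hk x.2
  set f : ι × (Fin N' → Fin n → ℤ) → ℂ := (k ⁻¹' {x.2}).indicator fun y =>
    powCoeff B b N' β a y * powPoly B b N' α x.1 y with hf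
  have hsupp : f.support.Finite := hfin.subset Set.support_indicator_subset
  rw [tsum_subtype (k ⁻¹' {x.2}) fun y => powCoeff B b N' β a y * powPoly B b N' α x.1 y, ← hf,
    (summable_of_hasFiniteSupport hsupp).tsum_prod, tsum_fintype]
  refine Finset.sum_congr rfl fun i _ => ?_
  have hsupp' : (fun v => f (i, v)).support.Finite :=
    hsupp.preimage (f := fun v => (i, v)) fun v _ w _ hvw => (Prod.mk.inj hvw).2
  rw [tsum_eq_finsum hsupp', thetaCoeff,
    ← finsum_comp_equiv (Equiv.piCongrRight fun _ : Fin N' => latticeEquiv hb)]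
  have hsupp2 : (fun v : Fin N' → Fin n → ℤ => if k (i, v) = x.2 then
      e (B (β i) (∑ j, lam b (v j))) * (powPoly B b N' α x.1 (i, v) : ℂ)
        else 0).support.Finite := by
    refine (hfin.preimage (f := fun v => (i, v)) fun v _ w _ hvw => (Prod.mk.inj hvw).2).subset
      fun v hv => ?_
    by_contra hcon
    exact hv (if_neg hcon)
  have h1 : ∀ v : Fin N' → Fin n → ℤ,
      (∑ᶠ _ : ∑ j, Q B (α i + (Equiv.piCongrRight (fun _ : Fin N' => latticeEquiv hb) v j : V)) =
        (x.2 : ℝ),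
        e (B (β i) (∑ j, (Equiv.piCongrRight (fun _ : Fin N' => latticeEquiv hb) v j : V)) : ℂ) *
      (MvPolynomial.eval
        (Fin.cons (x.2 : ℝ) (b.repr ((N' : ℝ)⁻¹ • ∑ j, (α i +
          (Equiv.piCongrRight (fun _ : Fin N' => latticeEquiv hb) v j : V)))) : Fin (n + 1) → ℝ)
        (P ((N' : ℝ) * (n : ℝ) / 2) x.1 ((N' : ℝ) • gram B b)) : ℝ)) =
      if k (i, v) = x.2 then
        e (B (β i) (∑ j, lam b (v j))) * (powPoly B b N' α x.1 (i, v) : ℂ) else 0 := by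
    intro v
    rw [finsum_eq_if]
    have h2 := congrFun hk (i, v)
    have h3 : powExp B b N' α (i, v) = ∑ j, Q B (α i +
      (Equiv.piCongrRight (fun _ : Fin N' => latticeEquiv hb) v j : V)) := rfl
    rw [← h3, h2]
    simp only [Nat.cast_inj]
    split_ifs with h4
    · rw [powPoly, h2, h4]
      rfl
    · rfl
  rw [finsum_congr h1, ← smul_eq_mul, smul_finsum' _ hsupp2]
  refine finsum_congr fun v => ?_
  rw [hf, Set.indicator_apply]
  by_cases h5 : k (i, v) = x.2
  · rw [if_pos h5, if_pos (show (i, v) ∈ k ⁻¹' {x.2} from h5), powCoeff, smul_eq_mul, mul_assoc]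
  · rw [if_neg h5, if_neg (show (i, v) ∉ k ⁻¹' {x.2} from h5), smul_zero]

/-- An even lattice and its level, in the coordinates of a basis and of its dual basis. -/
lemma evenLattice_of_isLevel (hsymm : B.IsSymm) (hpos : ∀ x : V, x ≠ 0 → 0 < B x x)
    (hb : Submodule.span ℤ (Set.range b) = L) (heven : ∀ v ∈ L, ∃ m : ℤ, Q B v = m)
    (hN : IsLevel B L N) :
    EvenLattice B b (B.dualBasis (nondegenerate_of_posDef hpos) b) N := by
  have hdual : ∀ i j, B (B.dualBasis (nondegenerate_of_posDef hpos) b i) (b j) =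
      if j = i then 1 else 0 :=
    fun i j => LinearMap.BilinForm.apply_dualBasis_left _ _ _ _
  refine ⟨hsymm, hpos, hdual, fun v => ?_, fun m => ?_⟩
  · obtain ⟨j, hj⟩ := heven _ (latticeEquiv hb v).2
    exact mem_IntR.2 ⟨j, hj⟩
  · refine mem_IntR.2 (hN.1.2 _ ((mem_dual_iff hb _).2 fun i => ?_))
    rw [B_vec_left]
    simp only [hdual, mul_ite, mul_one, mul_zero, Finset.sum_ite_eq, Finset.mem_univ, if_true]
    exact int_mem_IntR _

end Coordinates

/-! ### The criterion for linear relations -/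

section Criterion

variable {V : Type*} [AddCommGroup V] [Module ℝ V] {n N N' : ℕ} {B : LinearMap.BilinForm ℝ V}
  {b b' : Module.Basis (Fin n) ℝ V} {ι : Type*}

/-- A linear combination of powers vanishes if and only if the coefficients of the attached modular
forms vanish up to the bound. -/
theorem EvenLattice.powSeries_eq_zero_iff [Fintype ι] (h : EvenLattice B b b' N) (hn : 1 ≤ n)
    (hN0 : 0 < N) (hN'0 : N' ≠ 0) (hN' : N' ∣ N) {α β : ι → V}
    (hαβ : ∀ i, Admissible B b b' N' (α i) (β i)) (a : ι → ℂ)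
    {k : ι × (Fin N' → Fin n → ℤ) → ℕ} (hk : powExp B b N' α = fun x => (k x : ℝ)) {d : ℕ}
    {ρ : Fin d → V} (hρ : IsCosetReps b b' N' ρ) (p : Fin d → Fin n → ℕ) {τ₀ : ℂ} (hτ₀ : 0 < τ₀.im)
    (hdet : (Matrix.of fun i j : Fin d => cosetSeries ((N' : ℝ) • B) b (ρ j)
      (fun w => ∏ l, (((N' : ℝ) • B) w (b l) : ℂ) ^ p i l) τ₀ 0).det ≠ 0) :
    (∀ τ : ℂ, 0 < τ.im → ∀ z : ℂ ⊗[ℝ] V,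
      expSeries (powCoeff B b N' β a) (powExp B b N' α) (powLin B b N' α z) τ = 0) ↔
    ∀ q ∈ precClosure (Set.range p), ∀ m ≤ coeffBound N N' q,
      ∑' x : k ⁻¹' {m}, powCoeff B b N' β a x * powPoly B b N' α q x = 0 := by
  have hm := expTame_powExp (b := b) (N' := N') h.symm h.pos α
  have hc := polyBd_powCoeff (B := B) (b := b) (powExp B b N' α) β a
  refine ⟨fun hf q _ m _ => fiber_powPoly_eq_zero h.symm h.pos hN'0 hk hf q m, fun hv τ hτ z => ?_⟩
  -- all coefficients of the modular forms vanish
  have h1 : ∀ q ∈ precClosure (Set.range p), ∀ m,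
      ∑' x : k ⁻¹' {m}, powCoeff B b N' β a x * powPoly B b N' α q x = 0 := by
    intro q hq
    have h2 := hc.mul (polyBd_powPoly h.symm h.pos hn hN'0 α q)
    have h3 := fun τ hτ => h.powPoly_series_eq_zero hn hN0 hN'0 hN' hαβ a q hk (hv q hq) (τ := τ) hτ
    rw [hk] at h2 h3
    exact fiber_tsum_eq_zero (hk ▸ hm) h2 h3
  -- hence so do those of the corresponding sums of monomials, for every exponent in the closure
  have h4 := fun m => fiber_monomial_eq_zero h.symm h.pos hn hN'0 hk
    (S := precClosure (Set.range p)) (fun q ⟨r, hr, hqr, hmod⟩ q' hq' hmod' =>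
      ⟨r, hr, hq'.trans hqr, hmod'.trans hmod⟩) m fun q hq => h1 q hq m
  refine h.powSeries_eq_zero hN'0 hαβ a hρ p hτ₀ hdet (fun i τ hτ => ?_) hτ z
  have h5 := hc.mul (polyBd_monomial (b := b) (N' := N') h.symm h.pos α (p i))
  have h6 := fun m => h4 m (p i) ⟨p i, ⟨i, rfl⟩, le_rfl, rfl⟩
  rw [hk] at h5 ⊢
  exact expSeries_eq_zero_of_fiber (hk ▸ hm) h5 h6 hτ

end Criterion

end LatticeTheta

end

theorem mainTheorem2 {V : Type*} [AddCommGroup V] [Module ℝ V]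
    (n : ℕ) (hn : 1 ≤ n)
    (B : LinearMap.BilinForm ℝ V) (hsymm : B.IsSymm) (hpos : ∀ x : V, x ≠ 0 → 0 < B x x)
    -- the even lattice `L` in `V` with `ℤ`-basis `b`
    (L : Submodule ℤ V) (b : Module.Basis (Fin n) ℝ V)
    (hb : Submodule.span ℤ (Set.range b) = L)
    (heven : ∀ v ∈ L, ∃ m : ℤ, LatticeTheta.Q B v = m)
    (N N' : ℕ) (hN : LatticeTheta.IsLevel B L N) (hN' : N' ∣ N)
    -- the set `{p₁, …, p_d}` of exponents and the discriminant group `{t₁, …, t_d}` of `(L, N' B)`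
    (d : ℕ) (p : Fin d → Fin n → ℕ) (hp : Function.Injective p)
    (t : Fin d ≃ LatticeTheta.DiscGroup ((N' : ℝ) • B) L)
    (hF : ∃ τ : UpperHalfPlane, LatticeTheta.thetaDet ((N' : ℝ) • B) L b p t τ ≠ 0)
    -- a finite family of admissible pairs `(α, β)`, and the coefficients of the relation
    {ι : Type*} [Fintype ι] (α β : ι → V)
    (hα : ∀ i, α i ∈ B.dualSubmodule L)
    (hQα : ∀ i, ∃ m : ℤ, LatticeTheta.Q B (α i) = (m : ℝ) / (N' : ℝ))
    (hβ : ∀ i, ∃ u ∈ B.dualSubmodule L, ∃ w ∈ L, β i = u + (N' : ℝ)⁻¹ • w)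
    (a : ι → ℂ) :
    ∑ i, a i • LatticeTheta.theta B L (α i) (β i) ^ N' = 0 ↔
      ∑ i, a i • (fun x : LatticeTheta.indexSet N N' (Set.range p) =>
        LatticeTheta.thetaCoeff B L b N' (α i) (β i) x.1) = 0 := by
  open LatticeTheta in
  have hN0 : 0 < N := hN.1.1
  have hN'0 : N' ≠ 0 := fun h0 => hN0.ne' (Nat.eq_zero_of_zero_dvd (h0 ▸ hN'))
  have hN'R : (N' : ℝ) ≠ 0 := by exact_mod_cast hN'0
  have hN'pos : (0 : ℝ) < N' := by exact_mod_cast Nat.pos_of_ne_zero hN'0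
  have h := evenLattice_of_isLevel hsymm hpos hb heven hN
  have hadm : ∀ i, Admissible B b (B.dualBasis (nondegenerate_of_posDef hpos) b) N'
      (α i) (β i) := by
    intro i
    refine ⟨h.exists_lam' _ ((mem_dual_iff hb _).1 (hα i)), ?_, ?_⟩
    · obtain ⟨m, hm⟩ := hQα i
      exact mem_IntR.2 ⟨m, by rw [hm]; field_simp⟩
    · obtain ⟨u, hu, w, hw, huw⟩ := hβ i
      obtain ⟨m, hm⟩ := h.exists_lam' _ ((mem_dual_iff hb _).1 hu)
      obtain ⟨l, hl⟩ := (latticeEquiv hb).surjective ⟨w, hw⟩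
      exact ⟨m, l, by rw [huw, hm, ← coe_latticeEquiv hb, hl]⟩
  obtain ⟨k, hk⟩ := h.exists_powExp hadm
  -- the rescaled form is again positive definite and integral on the lattice
  have hsymm' : ((N' : ℝ) • B).IsSymm := ⟨fun x y => by
    simp only [LinearMap.smul_apply, hsymm.eq x y]⟩
  have hpos' : ∀ x : V, x ≠ 0 → 0 < ((N' : ℝ) • B) x x := fun x hx => by
    simp only [LinearMap.smul_apply, smul_eq_mul]
    exact mul_pos hN'pos (hpos x hx)
  have hL : L ≤ ((N' : ℝ) • B).dualSubmodule L := by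
    intro v hv
    obtain ⟨l, hl⟩ := (latticeEquiv hb).surjective ⟨v, hv⟩
    have hl' : lam b l = v := congrArg Subtype.val hl
    rw [mem_dual_iff hb]
    intro i
    rw [← hl', ← lam_single b i, LinearMap.smul_apply, LinearMap.smul_apply, smul_eq_mul]
    exact mul_mem (int_mem_IntR N') (h.B_lam_lam _ _)
  choose v hv using fun j => Submodule.Quotient.mk_surjective _ (t j)
  obtain ⟨τ₀, hτ₀⟩ := hF
  have hdet : (Matrix.of fun i j : Fin d => cosetSeries ((N' : ℝ) • B) b (v j : V)
      (fun w => ∏ l, (((N' : ℝ) • B) w (b l) : ℂ) ^ p i l) τ₀ 0).det ≠ 0 := by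
    convert hτ₀ using 2
    rw [thetaDet]
    congr 2
    funext i j
    rw [← hv j, funext fun z => jacobiThetaLattice_eq hb hL (v j) τ₀ z,
      iterPartial_cosetSeries hsymm' hpos' τ₀.im_pos, ← mul_assoc, one_div,
      inv_mul_cancel₀ (pow_ne_zero _ Complex.two_pi_I_ne_zero), one_mul]
  have key := h.powSeries_eq_zero_iff hn hN0 hN'0 hN' hadm a hk (h.isCosetReps hb t v hv) p
    τ₀.im_pos hdet
  have hleft : ∑ i, a i • theta B L (α i) (β i) ^ N' = 0 ↔
      ∀ τ : ℂ, 0 < τ.im → ∀ z : ℂ ⊗[ℝ] V, expSeries (powCoeff B b N' β a) (powExp B b N' α)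
        (powLin B b N' α z) τ = 0 := by
    have h1 (x : ℍ × (ℂ ⊗[ℝ] V)) : (∑ i, a i • theta B L (α i) (β i) ^ N') x =
        expSeries (powCoeff B b N' β a) (powExp B b N' α) (powLin B b N' α x.2) x.1 := by
      rw [← sum_thetaChar_pow hsymm hpos α β a x.1.im_pos x.2]
      simp [theta_eq_thetaChar hb]
    refine ⟨fun h2 τ hτ z => ?_, fun h2 => funext fun x => ?_⟩
    · rw [← h1 (⟨τ, hτ⟩, z), h2, Pi.zero_apply]
    · rw [h1, h2 _ x.1.im_pos, Pi.zero_apply]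
  have hright : ∑ i, a i • (fun x : indexSet N N' (Set.range p) =>
        thetaCoeff B L b N' (α i) (β i) x.1) = 0 ↔
      ∀ q ∈ precClosure (Set.range p), ∀ m ≤ coeffBound N N' q,
        ∑' x : k ⁻¹' {m}, powCoeff B b N' β a x * powPoly B b N' α q x = 0 := by
    have h1 (x : indexSet N N' (Set.range p)) : (∑ i, a i • (fun x : indexSet N N' (Set.range p) =>
        thetaCoeff B L b N' (α i) (β i) x.1)) x =
        ∑' y : k ⁻¹' {x.1.2}, powCoeff B b N' β a y * powPoly B b N' α x.1.1 y := by
      rw [← sum_thetaCoeff hsymm hpos hb α β a hk x.1]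
      simp
    refine ⟨fun h2 q hq m hm => ?_, fun h2 => funext fun x => ?_⟩
    · rw [← h1 ⟨(q, m), hq, hm⟩, h2, Pi.zero_apply]
    · rw [h1, Pi.zero_apply]
      exact h2 _ x.2.1 _ x.2.2
  rw [hleft, hright]
  exact key
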